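/- Proposition 4. Let $(M_1,g_1),\dots,(M_N,g_N)$ be oriented Riemannian manifolds of dimensions $D_1,\dots,D_N$ with spin structures $P_i\to P_{SO}(M_i)$, and let $S_i=P_i\times_{\mathrm{Spin}(D_i)}\Delta_i$ be their spinor bundles, where $\Delta_i$ is an irreducible complex module of the Clifford algebra $C\ell(D_i)$ (unit vectors square to $-1$). Let $M=M_1\times\cdots\times M_N$ carry the product metric and the product orientation, put $D=D_1+\cdots+D_N$, and let $$P=(P_1\times\cdots\times P_N)\times_{\mathrm{Spin}(D_1)\times\cdots\times\mathrm{Spin}(D_N)}\mathrm{Spin}(D)$$ be the induced spin structure of $M$, so that $P_1\times\cdots\times P_N$ is a reduction of $P$; here $[p,b]$ is sent to the frame obtained by joining the frames of the $p_i$ and rotating by $b$. For $D_i$ even let $S_i=S_i^+\oplus S_i^-$ be the decomposition into the eigenbundles, for the eigenvalues $\pm1$, of the normalized volume element $i^{D_i/2}e_1\cdots e_{D_i}$; for $D_i$ odd put $S_i^+=S_i^-=S_i$. Let $W=\bigotimes_{i=1}^N(S_i^+\oplus S_i^-)$, a bundle over $M$. Let $N_o$ be the number of indices $i$ with $D_i$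 odd, choose a set $T$ of $N_o-[N_o/2]$ of these indices, and let $S\subset W$ be the subbundle in which the factor $S_i^+\oplus S_i^-=S_i\oplus S_i$ is replaced by its diagonal $\{(\xi,\xi)\}$ for every $i\in T$. Let $\hat S$ be its standard fibre, constructed in the same way from the $\Delta_i$. Then for every irreducible complex $C\ell(D)$-module $\Delta$ the spinor bundle $P\times_{\mathrm{Spin}(D)}\Delta$ of $M$ is isomorphic to $S$ as a smooth complex vector bundle, and the isomorphism $\varphi:S\to P\times_{\mathrm{Spin}(D)}\Delta$ can be chosen compatible with the reduction: there is a linear isomorphism $L:\hat S\to\Delta$ such that for all $p\in P_1\times\cdots\times P_N$ the map $\varphi$ becomes $L$ if $S$ is identified with $\hat S$, and the spinor bundle with $\Delta$, by means of $p$. If moreover $T$ contains at most the last index $N$, then $S$ is stable under the Clifford multiplication of $W$, $$X\,(\xi_1\otimes\cdots\otimes\xi_N)=\sum_{i=1}^N(-1)^{\epsilon_1+\cdots+\epsilon_{i-1}}\,\xi_1\otimes\cdots\otimes X_i\xi_i\otimes\cdots\otimes\xi_N,\qquad X_i(\xi^+,\xi^-)=(X_i\xi^-,X_i\xi^+),$$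 for $X=X_1+\cdots+X_N\in TM=\bigoplus_i TM_i$ and homogeneous $\xi_j\in S_j^{\epsilon_j}$, and the same $\varphi$ can be chosen such that $\varphi(X\Xi)=\varepsilon\,X\varphi(\Xi)$ for all $X$ and $\Xi$, with a constant sign $\varepsilon\in\{1,-1\}$ which is $1$ if $D$ is even. -/

import Mathlib

open scoped Manifold ContDiff TensorProduct
open Bundle CliffordAlgebra

universe u v v' w w' f m

noncomputable section

namespace SpinProduct

section Clifford

variable (κ : Type) [Fintype κ]

/-- The quadratic form `v ↦ -|v|²`, so that unit vectors square to `-1` in the Clifford algebra. -/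
def stdForm : QuadraticForm ℝ (κ → ℝ) :=
  QuadraticMap.weightedSumSquares ℝ (fun _ : κ => (-1 : ℝ))

/-- The real Clifford algebra of Euclidean space with basis indexed by `κ`. -/
abbrev Cl : Type := CliffordAlgebra (stdForm κ)

/-- The spin group of Euclidean space with basis indexed by `κ`. -/
abbrev Spin : Submonoid (Cl κ) := spinGroup (stdForm κ)

variable {κ}

lemma stdForm_apply (v : κ → ℝ) : stdForm κ v = -∑ k, v k * v k := by
  simp [stdForm, QuadraticMap.weightedSumSquares_apply]

lemma ι_injective : Function.Injective (ι (stdForm κ)) := by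
  intro v w h
  have := congrArg (equivExterior (stdForm κ)) h
  simp only [equivExterior, changeFormEquiv_apply, changeForm_ι] at this
  exact (ExteriorAlgebra.ι_inj ℝ v w).1 this

instance : FiniteDimensional ℝ (Cl κ) := by
  let := LinearOrder.lift' _ (Fintype.equivFin κ).injective
  have b := (Module.Basis.ExteriorAlgebra (Pi.basisFun ℝ κ))
  have : Module.Finite ℝ (ExteriorAlgebra ℝ (κ → ℝ)) := Module.Finite.of_basis b
  exact Module.Finite.equiv (equivExterior (stdForm κ)).symm

lemma conj_mem (a : Spin κ) (v : κ → ℝ) :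
    (a : Cl κ) * ι (stdForm κ) v * ((a⁻¹ : Spin κ) : Cl κ) ∈ LinearMap.range (ι (stdForm κ)) := by
  have := spinGroup.conjAct_smul_ι_mem_range_ι (Q := stdForm κ) (x := spinGroup.toUnits a) a.2 v
  simpa [ConjAct.units_smul_def, ← map_inv] using this

/-- The covering homomorphism `Spin → SO`: the rotation `v ↦ a v a⁻¹`. -/
def rot (a : Spin κ) : (κ → ℝ) →ₗ[ℝ] (κ → ℝ) :=
  (LinearEquiv.ofInjective (ι (stdForm κ)) ι_injective).symm.toLinearMap ∘ₗ
    ((LinearMap.mulLeft ℝ (a : Cl κ) ∘ₗ LinearMap.mulRight ℝ ((a⁻¹ : Spin κ) : Cl κ)) ∘ₗ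
      ι (stdForm κ)).codRestrict (LinearMap.range (ι (stdForm κ)))
        (fun v => by simpa [mul_assoc] using conj_mem a v)

lemma ι_rot (a : Spin κ) (v : κ → ℝ) :
    ι (stdForm κ) (rot a v) = a * ι (stdForm κ) v * ((a⁻¹ : Spin κ) : Cl κ) := by
  have h : ∀ y : LinearMap.range (ι (stdForm κ)),
      ι (stdForm κ) ((LinearEquiv.ofInjective (ι (stdForm κ)) ι_injective).symm y) = y := by
    intro y
    have := congrArg Subtype.val
      ((LinearEquiv.ofInjective (ι (stdForm κ)) ι_injective).apply_symm_apply y)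
    simpa using this
  simp [rot, h, mul_assoc]

lemma coe_mul_coe_inv (a : Spin κ) : (a : Cl κ) * ((a⁻¹ : Spin κ) : Cl κ) = 1 := by
  rw [← Submonoid.coe_mul, mul_inv_cancel, Submonoid.coe_one]

lemma coe_inv_mul_coe (a : Spin κ) : ((a⁻¹ : Spin κ) : Cl κ) * (a : Cl κ) = 1 := by
  rw [← Submonoid.coe_mul, inv_mul_cancel, Submonoid.coe_one]

lemma rot_mul (a b : Spin κ) (v : κ → ℝ) : rot (a * b) v = rot a (rot b v) := by
  apply ι_injective
  simp [ι_rot, mul_assoc]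

lemma rot_one (v : κ → ℝ) : rot (1 : Spin κ) v = v := by
  apply ι_injective
  simp [ι_rot]

/-- The rotation attached to an element of the spin group, as a linear automorphism. -/
def rotEquiv (a : Spin κ) : (κ → ℝ) ≃ₗ[ℝ] (κ → ℝ) :=
  LinearEquiv.ofLinearMap (rot a) (rot a⁻¹)
    (LinearMap.ext fun v => by simp [← rot_mul, rot_one])
    (LinearMap.ext fun v => by simp [← rot_mul, rot_one])

lemma stdForm_rot (a : Spin κ) (v : κ → ℝ) : stdForm κ (rot a v) = stdForm κ v := by
  have h1 := ι_sq_scalar (stdForm κ) (rot a v)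
  have h2 := ι_sq_scalar (stdForm κ) v
  have inv := coe_inv_mul_coe a
  have key : ι (stdForm κ) (rot a v) * ι (stdForm κ) (rot a v) =
      algebraMap ℝ (Cl κ) (stdForm κ v) := by
    rw [ι_rot]
    calc _ = (a : Cl κ) * ι (stdForm κ) v * (((a⁻¹ : Spin κ) : Cl κ) * a) * ι (stdForm κ) v *
          ((a⁻¹ : Spin κ) : Cl κ) := by simp only [mul_assoc]
      _ = (a : Cl κ) * (ι (stdForm κ) v * ι (stdForm κ) v) * ((a⁻¹ : Spin κ) : Cl κ) := by
          rw [inv]; simp only [mul_assoc, mul_one]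
      _ = _ := by
          rw [h2, ← Algebra.commutes, mul_assoc, coe_mul_coe_inv, mul_one]
  rw [h1] at key
  exact (algebraMap ℝ (Cl κ)).injective key

lemma dot_rot (a : Spin κ) (v w : κ → ℝ) : rot a v ⬝ᵥ rot a w = v ⬝ᵥ w := by
  have h := stdForm_rot a (v + w)
  have hv := stdForm_rot a v
  have hw := stdForm_rot a w
  rw [map_add] at h
  simp only [stdForm_apply, Pi.add_apply, mul_add, add_mul, Finset.sum_add_distrib] at h hv hw
  simp only [dotProduct]
  have c1 : ∑ k, rot a w k * rot a v k = ∑ k, rot a v k * rot a w k :=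
    Finset.sum_congr rfl fun _ _ => mul_comm _ _
  have c2 : ∑ k, w k * v k = ∑ k, v k * w k := Finset.sum_congr rfl fun _ _ => mul_comm _ _
  rw [c1, c2] at h
  linarith

lemma exists_twisted (x : (Cl κ)ˣ) (hx : x ∈ lipschitzGroup (stdForm κ)) :
    ∃ (ε : ℝ) (A : (κ → ℝ) →ₗ[ℝ] (κ → ℝ)), (ε = 1 ∨ ε = -1) ∧ LinearMap.det A = ε ∧
      involute (x : Cl κ) = ε • (x : Cl κ) ∧
      ∀ w, ι (stdForm κ) (A w) * x = involute (x : Cl κ) * ι (stdForm κ) w := by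
  induction hx using Subgroup.closure_induction with
  | mem x hx =>
    obtain ⟨v, hv⟩ := hx
    have hQ : stdForm κ v ≠ 0 := by
      intro h0
      have := ι_sq_scalar (stdForm κ) v
      rw [h0, map_zero, hv] at this
      exact (x * x).ne_zero (by simp at this)
    set q := stdForm κ v with hq
    let f : Module.Dual ℝ (κ → ℝ) := (-q⁻¹) • (QuadraticMap.polarBilin (stdForm κ) v)
    refine ⟨-1, LinearMap.transvection f v, Or.inr rfl, ?_, ?_, ?_⟩
    · rw [LinearMap.transvection.det]
      simp only [f, LinearMap.smul_apply, QuadraticMap.polarBilin_apply_apply,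
        QuadraticMap.polar_self, smul_eq_mul, ← hq]
      field_simp; ring
    · rw [← hv]; simp
    · intro w
      rw [← hv, involute_ι, LinearMap.transvection.apply, map_add, map_smul, add_mul, smul_mul_assoc,
        ι_sq_scalar, ← hq, Algebra.smul_def, ← (algebraMap ℝ (Cl κ)).map_mul, neg_mul,
        ι_mul_ι_comm]
      simp only [f, LinearMap.smul_apply, QuadraticMap.polarBilin_apply_apply, smul_eq_mul]
      have : -q⁻¹ * QuadraticMap.polar (stdForm κ) v w * q = -QuadraticMap.polar (stdForm κ) v w := by
        field_simp
      rw [this, map_neg, QuadraticMap.polar_comm _ w v]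
      abel
  | one => exact ⟨1, LinearMap.id, Or.inl rfl, by simp, by simp, by simp⟩
  | mul x y _ _ hx hy =>
    obtain ⟨ε, A, hε, hA, hi, h⟩ := hx
    obtain ⟨ε', A', hε', hA', hi', h'⟩ := hy
    refine ⟨ε * ε', A ∘ₗ A', ?_, ?_, ?_, ?_⟩
    · rcases hε with rfl | rfl <;> rcases hε' with rfl | rfl <;> simp
    · rw [LinearMap.det_comp, hA, hA']
    · simp [hi, hi', smul_smul, mul_comm]
    · intro w
      simp only [LinearMap.comp_apply, Units.val_mul, map_mul, mul_assoc]
      rw [← mul_assoc, h, mul_assoc, h']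
  | inv x _ hx =>
    obtain ⟨ε, A, hε, hA, hi, h⟩ := hx
    have hε0 : ε ≠ 0 := by rcases hε with rfl | rfl <;> norm_num
    have hεε : ε⁻¹ = ε := by rcases hε with rfl | rfl <;> norm_num
    have hu : IsUnit (LinearMap.det A) := by rw [hA]; exact hε0.isUnit
    let e := LinearMap.equivOfDetNeZero A (by rw [hA]; exact hε0)
    have hei : involute ((x⁻¹ : (Cl κ)ˣ) : Cl κ) = ε • ((x⁻¹ : (Cl κ)ˣ) : Cl κ) := by
      have h1 : involute ((x⁻¹ : (Cl κ)ˣ) : Cl κ) * involute (x : Cl κ) = 1 := by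
        rw [← map_mul, Units.inv_mul, map_one]
      rw [hi, mul_smul_comm] at h1
      have h2 := congrArg (· * ((x⁻¹ : (Cl κ)ˣ) : Cl κ)) h1
      simp only [smul_mul_assoc, Units.mul_inv_cancel_right, one_mul] at h2
      rw [← h2, smul_smul, show ε * ε = 1 by rcases hε with rfl | rfl <;> norm_num, one_smul, h2]
    refine ⟨ε, e.symm, hε, ?_, hei, ?_⟩
    · have : LinearMap.det A * LinearMap.det (e.symm : (κ → ℝ) →ₗ[ℝ] (κ → ℝ)) = 1 := by
        rw [← LinearMap.det_comp]
        have : A ∘ₗ (e.symm : (κ → ℝ) →ₗ[ℝ] (κ → ℝ)) = LinearMap.id := by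
          exact LinearMap.ext fun v => e.apply_symm_apply v
        rw [this, LinearMap.det_id]
      rw [hA] at this
      rw [← hεε]; exact eq_inv_of_mul_eq_one_right this
    · intro w
      have h1 := h (e.symm w)
      have : A (e.symm w) = w := e.apply_symm_apply w
      rw [LinearEquiv.coe_coe, hei]
      rw [this, hi] at h1
      have h2 := congrArg (fun z => ε • (((x⁻¹ : (Cl κ)ˣ) : Cl κ) * z *
        ((x⁻¹ : (Cl κ)ˣ) : Cl κ))) h1
      simp only [smul_mul_assoc, mul_smul_comm, smul_smul, mul_assoc,
        Units.inv_mul_cancel_left, Units.mul_inv, mul_one] at h2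
      rw [smul_mul_assoc, h2]
      have : ε * ε = 1 := by rcases hε with rfl | rfl <;> norm_num
      rw [this, one_smul]

lemma det_rot_pos (a : Spin κ) : 0 < LinearMap.det (rot a) := by
  obtain ⟨ε, A, hε, hA, hi, h⟩ := exists_twisted (spinGroup.toUnits a)
    (spinGroup.units_mem_lipschitzGroup a.2)
  have hinv : involute (a : Cl κ) = a := spinGroup.involute_eq a.2
  have e1 : ((spinGroup.toUnits a : (Cl κ)ˣ) : Cl κ) = a := rfl
  rw [e1, hinv] at hi h
  have hone : ε = 1 := by
    rcases hε with h | rfl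
    · exact h
    · exfalso
      have h2 : (a : Cl κ) = 0 := by
        have h3 : (2 : ℝ) • (a : Cl κ) = 0 := by
          rw [two_smul]; nth_rewrite 1 [hi]; simp
        exact (smul_eq_zero.1 h3).resolve_left two_ne_zero
      have := coe_mul_coe_inv a
      rw [h2, zero_mul] at this
      exact zero_ne_one this
  have : rot a = A := by
    refine LinearMap.ext fun v => ι_injective ?_
    simp only [ι_rot, ← h, mul_assoc, coe_mul_coe_inv, mul_one]
  rw [this, hA, hone]; exact one_pos

end Clifford

section Sum

variable {J : Type} [Fintype J] [DecidableEq J] {κ : J → Type} [∀ j, Fintype (κ j)]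

/-- The inclusion of the `j`-th summand into the orthogonal direct sum. -/
def incl (j : J) : stdForm (κ j) →qᵢ stdForm (Σ j, κ j) where
  toFun v s := (Pi.single j v : ∀ j, κ j → ℝ) s.1 s.2
  map_add' v w := by ext s; simp [Pi.single_add]
  map_smul' r v := by ext s; simp [Pi.single_smul]
  map_app' v := by
    change stdForm (Σ j, κ j) (fun s => (Pi.single j v : ∀ j, κ j → ℝ) s.1 s.2) = _
    rw [stdForm_apply, stdForm_apply, Fintype.sum_sigma, Finset.sum_eq_single j]
    · simp
    · intro b _ hb; simp [Pi.single_eq_of_ne hb]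
    · simp

lemma incl_apply (j : J) (v : κ j → ℝ) (s : Σ j, κ j) :
    incl j v s = (Pi.single j v : ∀ j, κ j → ℝ) s.1 s.2 := rfl

lemma incl_ortho {j k : J} (h : j ≠ k) (v : κ j → ℝ) (w : κ k → ℝ) :
    (stdForm (Σ j, κ j)).IsOrtho (incl j v) (incl k w) := by
  rw [QuadraticMap.isOrtho_def]
  simp only [stdForm_apply, Pi.add_apply, mul_add, add_mul, Finset.sum_add_distrib]
  have z : ∀ s : Σ j, κ j, incl j v s * incl k w s = 0 := by
    intro s
    rw [incl_apply, incl_apply]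
    by_cases hs : s.1 = j
    · have : s.1 ≠ k := fun h' => h (hs.symm.trans h')
      simp [Pi.single_eq_of_ne this]
    · simp [Pi.single_eq_of_ne hs]
  have z' : ∀ s : Σ j, κ j, incl k w s * incl j v s = 0 := fun s => by rw [mul_comm, z]
  simp only [z, z', Finset.sum_const_zero]
  ring

lemma map_star_cl {V W : Type} [AddCommGroup V] [Module ℝ V] [AddCommGroup W] [Module ℝ W]
    {Q : QuadraticForm ℝ V} {Q' : QuadraticForm ℝ W} (f : Q →qᵢ Q') (x : CliffordAlgebra Q) :
    CliffordAlgebra.map f (star x) = star (CliffordAlgebra.map f x) := by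
  induction x using CliffordAlgebra.induction with
  | algebraMap r => simp [CliffordAlgebra.star_algebraMap]
  | ι v => simp [CliffordAlgebra.star_ι]
  | mul a b ha hb => simp [ha, hb]
  | add a b ha hb => simp [ha, hb]

lemma map_mem_evenOdd {V W : Type} [AddCommGroup V] [Module ℝ V] [AddCommGroup W] [Module ℝ W]
    {Q : QuadraticForm ℝ V} {Q' : QuadraticForm ℝ W} (f : Q →qᵢ Q') {x : CliffordAlgebra Q}
    (hx : x ∈ CliffordAlgebra.even Q) : CliffordAlgebra.map f x ∈ CliffordAlgebra.even Q' := by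
  have hx' : x ∈ evenOdd Q 0 := hx
  clear hx
  change _ ∈ evenOdd Q' 0
  induction x, hx' using CliffordAlgebra.even_induction with
  | algebraMap r => rw [AlgHom.commutes]; exact SetLike.algebraMap_mem_graded _ _
  | add x y hx hy ihx ihy => rw [_root_.map_add]; exact Submodule.add_mem _ ihx ihy
  | ι_mul_ι_mul v w x hx ih =>
    rw [map_mul, map_mul, map_apply_ι, map_apply_ι]
    have := SetLike.mul_mem_graded (A := evenOdd Q')
      (ι_mul_ι_mem_evenOdd_zero Q' (f v) (f w)) ih
    simpa using this

lemma map_mem_spinGroup {V W : Type} [AddCommGroup V] [Module ℝ V] [AddCommGroup W] [Module ℝ W]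
    {Q : QuadraticForm ℝ V} {Q' : QuadraticForm ℝ W} (f : Q →qᵢ Q') {x : CliffordAlgebra Q}
    (hx : x ∈ spinGroup Q) : CliffordAlgebra.map f x ∈ spinGroup Q' := by
  refine ⟨⟨?_, ?_⟩, map_mem_evenOdd f (spinGroup.mem_even hx)⟩
  · obtain ⟨u, hu, rfl⟩ := pinGroup.mem_lipschitzGroup (spinGroup.mem_pin hx)
    refine ⟨Units.map (CliffordAlgebra.map f : CliffordAlgebra Q →* CliffordAlgebra Q') u, ?_, rfl⟩
    have h : lipschitzGroup Q ≤ (lipschitzGroup Q').comap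
        (Units.map (CliffordAlgebra.map f : CliffordAlgebra Q →* CliffordAlgebra Q')) := by
      refine (Subgroup.closure_le _).2 ?_
      rintro y ⟨v, hv⟩
      refine Subgroup.subset_closure ⟨f v, ?_⟩
      simp [← hv]
    exact h hu
  · have h1 := spinGroup.star_mul_self_of_mem hx
    have h2 := spinGroup.mul_star_self_of_mem hx
    constructor
    · rw [← map_star_cl, ← map_mul, h1, map_one]
    · rw [← map_star_cl, ← map_mul, h2, map_one]

/-- The homomorphism `Spin(κ j) → Spin(⨁ κ)` induced by the inclusion of the `j`-th summand. -/
def spinIncl (j : J) : Spin (κ j) →* Spin (Σ j, κ j) where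
  toFun a := ⟨CliffordAlgebra.map (incl j) a, map_mem_spinGroup _ a.2⟩
  map_one' := Subtype.ext (map_one _)
  map_mul' a b := Subtype.ext (map_mul _ _ _)

lemma spinIncl_commute : Pairwise fun j k : J => ∀ (a : Spin (κ j)) (b : Spin (κ k)),
    Commute (spinIncl j a) (spinIncl k b) := by
  intro j k hjk a b
  refine Subtype.ext ?_
  exact commute_map_mul_map_of_isOrtho_of_mem_evenOdd_zero_left (incl j) (incl k)
    (incl_ortho hjk) _ _ (spinGroup.mem_even a.2) (i₂ := 0) (spinGroup.mem_even b.2)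

/-- The homomorphism `∏ Spin(κ j) → Spin(⨁ κ)`, `(aⱼ) ↦ ∏ aⱼ`. -/
def spinProd : (∀ j, Spin (κ j)) →* Spin (Σ j, κ j) :=
  MonoidHom.noncommPiCoprod spinIncl spinIncl_commute

/-- Rotations act blockwise: `spinProd a` rotates the `j`-th summand by `a j`. -/
lemma rot_spinIncl_self (j : J) (a : Spin (κ j)) (v : κ j → ℝ) :
    rot (spinIncl j a) (incl j v) = incl j (rot a v) := by
  apply ι_injective
  rw [ι_rot, ← map_inv, ← map_apply_ι, ← map_apply_ι, ι_rot]
  simp [spinIncl]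

lemma rot_spinIncl_of_ne {j k : J} (h : j ≠ k) (a : Spin (κ j)) (v : κ k → ℝ) :
    rot (spinIncl j a) (incl k v) = incl k v := by
  apply ι_injective
  rw [ι_rot, ← map_apply_ι]
  have : Commute ((spinIncl j a : Spin (Σ j, κ j)) : Cl (Σ j, κ j))
      (CliffordAlgebra.map (incl k) (ι _ v)) :=
    commute_map_mul_map_of_isOrtho_of_mem_evenOdd_zero_left (incl j) (incl k)
      (incl_ortho h) _ _ (spinGroup.mem_even a.2) (i₂ := 1) (ι_mem_evenOdd_one _ v)
  rw [this.eq, mul_assoc, coe_mul_coe_inv, mul_one]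

lemma eq_sum_incl (v : (Σ j, κ j) → ℝ) : v = ∑ j, incl j (fun a => v ⟨j, a⟩) := by
  ext s
  rw [Finset.sum_apply, Finset.sum_eq_single s.1]
  · simp [incl_apply]
  · intro j _ hj; simp [incl_apply, Pi.single_eq_of_ne hj.symm]
  · simp

lemma spinProd_eq_mul (a : ∀ j, Spin (κ j)) (j : J) :
    spinProd a = spinIncl j (a j) * spinProd (Function.update a j 1) := by
  have e : spinIncl j (a j) = spinProd (Pi.mulSingle j (a j)) :=
    (MonoidHom.noncommPiCoprod_mulSingle (hcomm := spinIncl_commute) spinIncl j (a j)).symm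
  rw [e]
  rw [← map_mul]
  congr 1
  ext1 k
  by_cases h : k = j
  · subst h; simp
  · simp [h]

lemma rot_noncommProd (s : Finset J) (f : J → Spin (Σ j, κ j)) (hf) (w : (Σ j, κ j) → ℝ)
    (h : ∀ j ∈ s, rot (f j) w = w) : rot (s.noncommProd f hf) w = w := by
  induction s using Finset.induction_on with
  | empty => simp [rot_one]
  | insert j s hj ih =>
    rw [Finset.noncommProd_insert_of_notMem _ _ _ _ hj, rot_mul,
      ih _ (fun k hk => h k (Finset.mem_insert_of_mem hk)), h j (Finset.mem_insert_self _ _)]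

lemma rot_spinProd_incl (a : ∀ j, Spin (κ j)) (j : J) (v : κ j → ℝ) :
    rot (spinProd a) (incl j v) = incl j (rot (a j) v) := by
  rw [spinProd_eq_mul a j, rot_mul]
  have : rot (spinProd (Function.update a j 1)) (incl j v) = incl j v := by
    rw [spinProd, MonoidHom.noncommPiCoprod_apply]
    refine rot_noncommProd _ _ _ _ fun k _ => ?_
    by_cases h : k = j
    · subst h; simp [rot_one]
    · exact rot_spinIncl_of_ne h _ _
  rw [this, rot_spinIncl_self]

lemma rot_spinProd (a : ∀ j, Spin (κ j)) (v : (Σ j, κ j) → ℝ) (s : Σ j, κ j) :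
    rot (spinProd a) v s = rot (a s.1) (fun b => v ⟨s.1, b⟩) s.2 := by
  conv_lhs => rw [eq_sum_incl v]
  rw [map_sum, Finset.sum_apply, Finset.sum_eq_single s.1]
  · simp [rot_spinProd_incl, incl_apply]
  · intro j _ hj; simp [rot_spinProd_incl, incl_apply, Pi.single_eq_of_ne hj.symm]
  · simp

end Sum

section Forms

variable {A B : Type} [NormedAddCommGroup A] [NormedSpace ℝ A]
    [NormedAddCommGroup B] [NormedSpace ℝ B]

/-- The pullback of bilinear forms along a linear map. -/
def pullForm (p : B →L[ℝ] A) : (A →L[ℝ] A →L[ℝ] ℝ) →L[ℝ] (B →L[ℝ] B →L[ℝ] ℝ) :=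
  ((ContinuousLinearMap.compL ℝ B A (B →L[ℝ] ℝ)).flip p).comp
    (ContinuousLinearMap.compL ℝ A (A →L[ℝ] ℝ) (B →L[ℝ] ℝ)
      ((ContinuousLinearMap.compL ℝ B A ℝ).flip p))

lemma pullForm_apply (p : B →L[ℝ] A) (b : A →L[ℝ] A →L[ℝ] ℝ) (u v : B) :
    pullForm p b u v = b (p u) (p v) := rfl

lemma contMDiffAt_clm {EE HH : Type*} [NormedAddCommGroup EE] [NormedSpace ℝ EE]
    [TopologicalSpace HH] {II : ModelWithCorners ℝ EE HH} {MM : Type*} [TopologicalSpace MM]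
    [ChartedSpace HH MM] (L : A →L[ℝ] B) {F : MM → A} {x : MM}
    (hF : ContMDiffAt II 𝓘(ℝ, A) ∞ F x) : ContMDiffAt II 𝓘(ℝ, B) ∞ (fun y => L (F y)) x :=
  (L.contMDiff (n := ∞)).contMDiffAt.comp x hF

set_option synthInstance.maxHeartbeats 400000 in
lemma contMDiffAt_pullForm {EE HH : Type*} [NormedAddCommGroup EE] [NormedSpace ℝ EE]
    [TopologicalSpace HH] {II : ModelWithCorners ℝ EE HH} {MM : Type*} [TopologicalSpace MM]
    [ChartedSpace HH MM] (p : B →L[ℝ] A) {F : MM → A →L[ℝ] A →L[ℝ] ℝ} {x : MM}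
    (hF : ContMDiffAt II 𝓘(ℝ, A →L[ℝ] A →L[ℝ] ℝ) ∞ F x) :
    ContMDiffAt II 𝓘(ℝ, B →L[ℝ] B →L[ℝ] ℝ) ∞ (fun y => pullForm p (F y)) x :=
  contMDiffAt_clm (A := A →L[ℝ] A →L[ℝ] ℝ) (B := B →L[ℝ] B →L[ℝ] ℝ) (pullForm p) hF

end Forms

section PiManifold

variable {J : Type} [Fintype J] {E : J → Type} [∀ j, NormedAddCommGroup (E j)]
  [∀ j, NormedSpace ℝ (E j)] {H : J → Type} [∀ j, TopologicalSpace (H j)]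
  (I : ∀ j, ModelWithCorners ℝ (E j) (H j))
  {M : J → Type*} [∀ j, TopologicalSpace (M j)] [∀ j, ChartedSpace (H j) (M j)]

lemma range_pi : Set.range (ModelWithCorners.pi I) = Set.univ.pi fun j => Set.range (I j) := by
  change Set.range (fun (f : ∀ j, H j) j => I j (f j)) = _
  exact Set.range_piMap _

instance isManifold_pi [∀ j, IsManifold (I j) ∞ (M j)] :
    IsManifold (ModelWithCorners.pi I) ∞ (∀ j, M j) := by
  apply isManifold_of_contDiffOn
  rintro _ _ ⟨e, he, rfl⟩ ⟨e', he', rfl⟩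
  rw [contDiffOn_pi]
  intro j
  have h := (contDiffGroupoid ∞ (I j)).compatible (he j trivial) (he' j trivial)
  rw [contDiffGroupoid, mem_groupoid_of_pregroupoid] at h
  have h1 := h.1
  simp only [contDiffPregroupoid] at h1
  refine ContDiffOn.comp (t := (I j).symm ⁻¹' ((e j).symm.trans (e' j)).source ∩ Set.range (I j))
    (f := fun y : (∀ j, E j) => y j) h1 (ContinuousLinearMap.proj (R := ℝ) (φ := E) j).contDiff.contDiffOn ?_
  rintro y ⟨hy, hy'⟩
  rw [range_pi] at hy'
  refine ⟨?_, hy' j trivial⟩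
  have h2 := hy.1
  have h3 := hy.2
  refine ⟨h2 j trivial, h3 j trivial⟩

lemma extChartAt_pi (x y : ∀ j, M j) (j : J) :
    extChartAt (ModelWithCorners.pi I) x y j = extChartAt (I j) (x j) (y j) := rfl

lemma extChartAt_pi_symm (x : ∀ j, M j) (y : ∀ j, E j) (j : J) :
    (extChartAt (ModelWithCorners.pi I) x).symm y j = (extChartAt (I j) (x j)).symm (y j) := rfl

lemma mem_chart_source_pi {x y : ∀ j, M j} :
    y ∈ (chartAt (ModelPi H) x).source ↔ ∀ j, y j ∈ (chartAt (H j) (x j)).source := by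
  change y ∈ Set.univ.pi _ ↔ _
  simp

lemma contMDiff_eval (j : J) :
    ContMDiff (ModelWithCorners.pi I) (I j) ∞ (fun x : ∀ j, M j => x j) := by
  intro x
  rw [contMDiffAt_iff]
  refine ⟨(continuous_apply j).continuousAt, ?_⟩
  refine ((ContinuousLinearMap.proj (R := ℝ) (φ := E) j).contDiff.contDiffWithinAt (s := Set.range (ModelWithCorners.pi I))
    (x := extChartAt (ModelWithCorners.pi I) x x)).congr_of_eventuallyEq ?_ ?_
  · filter_upwards [extChartAt_target_mem_nhdsWithin (I := ModelWithCorners.pi I) x] with y hy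
    simp only [Function.comp_apply, extChartAt_pi_symm]
    apply (extChartAt (I j) (x j)).right_inv
    have h1 : y j ∈ Set.range (I j) := by
      have := extChartAt_target_subset_range (I := ModelWithCorners.pi I) x hy
      rw [range_pi] at this; exact this j trivial
    rw [extChartAt_target] at hy ⊢
    exact ⟨hy.1 j trivial, h1⟩
  · simp only [Function.comp_apply, extChartAt_pi_symm, extChartAt_pi]
    rw [(extChartAt (I j) (x j)).left_inv (mem_extChartAt_source (x j))]
    rfl

/-- The tangent space of the product is the product of the tangent spaces: under this
identification the differentials of the projections are the coordinate maps. -/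
lemma mfderiv_eval (x : ∀ j, M j) (j : J) (v : TangentSpace (ModelWithCorners.pi I) x) :
    mfderiv (ModelWithCorners.pi I) (I j) (fun x : ∀ j, M j => x j) x v = v j := by
  have hd : HasMFDerivAt (ModelWithCorners.pi I) (I j) (fun x : ∀ j, M j => x j) x
      (ContinuousLinearMap.proj (R := ℝ) (φ := E) j) := by
    refine ⟨(continuous_apply j).continuousAt, ?_⟩
    refine (ContinuousLinearMap.proj (R := ℝ) (φ := E) j).hasFDerivWithinAt.congr_of_eventuallyEq
      ?_ ?_
    · filter_upwards [extChartAt_target_mem_nhdsWithin (I := ModelWithCorners.pi I) x] with y hy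
      simp only [writtenInExtChartAt, Function.comp_apply, extChartAt_pi_symm]
      apply (extChartAt (I j) (x j)).right_inv
      have h1 : y j ∈ Set.range (I j) := by
        have := extChartAt_target_subset_range (I := ModelWithCorners.pi I) x hy
        rw [range_pi] at this; exact this j trivial
      rw [extChartAt_target] at hy ⊢
      exact ⟨hy.1 j trivial, h1⟩
    · simp only [writtenInExtChartAt, Function.comp_apply, extChartAt_pi_symm, extChartAt_pi]
      rw [(extChartAt (I j) (x j)).left_inv (mem_extChartAt_source (x j))]
      rfl
  rw [hd.mfderiv]
  rfl

variable [∀ j, IsManifold (I j) ∞ (M j)]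

lemma tangentCoordChange_pi {x y z : ∀ j, M j} (hx : z ∈ (chartAt (ModelPi H) x).source)
    (hy : z ∈ (chartAt (ModelPi H) y).source) (v : ∀ j, E j) (j : J) :
    tangentCoordChange (ModelWithCorners.pi I) x y z v j =
      tangentCoordChange (I j) (x j) (y j) (z j) (v j) := by
  have hx' := mem_chart_source_pi.1 hx
  have hy' := mem_chart_source_pi.1 hy
  have hd : HasFDerivWithinAt
      ((extChartAt (ModelWithCorners.pi I) y) ∘ (extChartAt (ModelWithCorners.pi I) x).symm)
      (ContinuousLinearMap.pi fun j => (tangentCoordChange (I j) (x j) (y j) (z j)).comp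
        (ContinuousLinearMap.proj (R := ℝ) (φ := E) j))
      (Set.range (ModelWithCorners.pi I)) (extChartAt (ModelWithCorners.pi I) x z) := by
    rw [hasFDerivWithinAt_pi']
    intro k
    have h1 := hasFDerivWithinAt_tangentCoordChange (I := I k) (x := x k) (y := y k) (z := z k)
      ⟨by rw [extChartAt_source]; exact hx' k, by rw [extChartAt_source]; exact hy' k⟩
    have h2 := h1.comp (extChartAt (ModelWithCorners.pi I) x z)
      (f := fun z : (∀ j, E j) => z k) (s := Set.range (ModelWithCorners.pi I))
      ((ContinuousLinearMap.proj (R := ℝ) (φ := E) k).hasFDerivWithinAt)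
      (by intro z hz; rw [range_pi] at hz; exact hz k trivial)
    exact h2
  have hd' := hasFDerivWithinAt_tangentCoordChange (I := ModelWithCorners.pi I) (x := x) (y := y)
    (z := z) ⟨by rw [extChartAt_source]; exact hx, by rw [extChartAt_source]; exact hy⟩
  have hu : UniqueDiffWithinAt ℝ (Set.range (ModelWithCorners.pi I))
      (extChartAt (ModelWithCorners.pi I) x z) :=
    (ModelWithCorners.pi I).uniqueDiffOn _ ⟨_, rfl⟩
  rw [hu.eq hd' hd]
  rfl

lemma trivializationAt_snd {EE HH : Type} [NormedAddCommGroup EE] [NormedSpace ℝ EE]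
    [TopologicalSpace HH] (II : ModelWithCorners ℝ EE HH) {MM : Type*} [TopologicalSpace MM]
    [ChartedSpace HH MM] [IsManifold II ∞ MM] (x y : MM) (v : TangentSpace II y) :
    (trivializationAt EE (TangentSpace II) x ⟨y, v⟩).2 = tangentCoordChange II y x y v := rfl

lemma form_inCoordinates {EE HH : Type} [NormedAddCommGroup EE] [NormedSpace ℝ EE]
    [TopologicalSpace HH] (II : ModelWithCorners ℝ EE HH) {MM : Type*} [TopologicalSpace MM]
    [ChartedSpace HH MM] [IsManifold II ∞ MM] {x₀ x : MM} (hx : x ∈ (chartAt HH x₀).source)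
    (φ : TangentSpace II x →L[ℝ] TangentSpace II x →L[ℝ] ℝ) (u v : EE) :
    ContinuousLinearMap.inCoordinates EE (fun x : MM => TangentSpace II x) (EE →L[ℝ] ℝ)
      (fun x : MM => TangentSpace II x →L[ℝ] ℝ) x₀ x x₀ x φ u v =
    φ (tangentCoordChange II x₀ x x u) (tangentCoordChange II x₀ x x v) := by
  have e1 := inCoordinates_apply_eq₂ (F₃ := ℝ) (E₃ := Trivial MM ℝ)
    (E₁ := fun x : MM => TangentSpace II x)
    (E₂ := fun x : MM => TangentSpace II x) (x₀ := x₀) (x := x)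
    (ϕ := φ) (v := u) (w := v) hx hx (Set.mem_univ _)
  refine Eq.trans e1 ?_
  simp only [Trivial.fiberBundle_trivializationAt', Trivial.linearMapAt_trivialization,
    LinearMap.id_coe, id_eq]
  have h : ∀ u, (trivializationAt EE (fun x : MM => TangentSpace II x) x₀).symm x u =
      tangentCoordChange II x₀ x x u := fun u =>
    ((trivializationAt EE (TangentSpace II) x₀).symmL_apply (R := ℝ) hx u).symm.trans
    (congrArg (fun L : EE →L[ℝ] EE => L u)
      (TangentBundle.symmL_trivializationAt_eq_core (I := II) hx))
  rw [h, h]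

/-- The orthogonal sum of bilinear forms on the factors. -/
def sumForm (b : ∀ j, E j →L[ℝ] E j →L[ℝ] ℝ) : (∀ j, E j) →L[ℝ] (∀ j, E j) →L[ℝ] ℝ :=
  ∑ j, pullForm (ContinuousLinearMap.proj (R := ℝ) (φ := E) j) (b j)

lemma sumForm_apply (b : ∀ j, E j →L[ℝ] E j →L[ℝ] ℝ) (u v : ∀ j, E j) :
    sumForm b u v = ∑ j, b j (u j) (v j) := by
  simp [sumForm, sum_apply, pullForm_apply]

/-- The product metric `g = ∑ⱼ pⱼ^* gⱼ`. -/
def productMetric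
    (g : ∀ j, ContMDiffRiemannianMetric (I j) ∞ (E j) (fun x : M j => TangentSpace (I j) x)) :
    ContMDiffRiemannianMetric (ModelWithCorners.pi I) ∞ (∀ j, E j)
      (fun x : ∀ j, M j => TangentSpace (ModelWithCorners.pi I) x) where
  inner x := sumForm (E := E) fun j => (g j).inner (x j)
  symm x v w := by
    refine (sumForm_apply _ _ _).trans (Eq.trans ?_ (sumForm_apply _ _ _).symm)
    exact Finset.sum_congr rfl fun j _ => (g j).symm (x j) _ _
  pos x v hv := by
    obtain ⟨j, hj⟩ : ∃ j, v j ≠ 0 := by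
      by_contra! h
      exact hv (funext h)
    refine lt_of_lt_of_eq ?_ (sumForm_apply _ _ _).symm
    refine Finset.sum_pos' (fun k _ => ?_) ⟨j, Finset.mem_univ _, (g j).pos (x j) _ hj⟩
    by_cases hk : v k = 0
    · refine le_of_eq (Eq.symm ?_)
      rw [hk]; exact ((g k).inner (x k) 0).map_zero
    · exact ((g k).pos (x k) _ hk).le
  isVonNBounded x := by
    refine (Bornology.isVonNBounded_pi_iff (𝕜 := ℝ) (E := E)).2 fun j => ?_
    refine ((g j).isVonNBounded (x j)).subset ?_
    rintro _ ⟨v, hv, rfl⟩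
    refine lt_of_le_of_lt ?_ (show sumForm (E := E) (fun j => (g j).inner (x j)) v v < 1 from hv)
    refine le_of_le_of_eq ?_ (sumForm_apply _ _ _).symm
    refine Finset.single_le_sum (f := fun k => (g k).inner (x k) (v k) (v k)) (fun k _ => ?_)
      (Finset.mem_univ j)
    by_cases hk : v k = 0
    · refine le_of_eq (Eq.symm ?_)
      rw [hk]; exact ((g k).inner (x k) 0).map_zero
    · exact ((g k).pos (x k) _ hk).le
  contMDiff := by
    intro x₀
    rw [contMDiffAt_hom_bundle]
    refine ⟨contMDiffAt_id, ?_⟩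
    have h1 : ∀ j, ContMDiffAt (ModelWithCorners.pi I) 𝓘(ℝ, E j →L[ℝ] E j →L[ℝ] ℝ) ∞
        (fun x : ∀ j, M j => ContinuousLinearMap.inCoordinates (E j)
          (fun y : M j => TangentSpace (I j) y) (E j →L[ℝ] ℝ)
          (fun y : M j => TangentSpace (I j) y →L[ℝ] ℝ) (x₀ j) (x j) (x₀ j) (x j)
            ((g j).inner (x j))) x₀ := by
      intro j
      have h := (g j).contMDiff (x₀ j)
      rw [contMDiffAt_hom_bundle] at h
      exact h.2.comp x₀ (contMDiff_eval I j x₀)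
    have h2 := ContMDiffAt.sum (t := Finset.univ) fun j _ => 
      contMDiffAt_pullForm (ContinuousLinearMap.proj (R := ℝ) (φ := E) j) (h1 j)
    refine h2.congr_of_eventuallyEq ?_
    filter_upwards [chart_source_mem_nhds (ModelPi H) x₀] with x hx
    have hx' := mem_chart_source_pi.1 hx
    ext u v
    refine Eq.trans (form_inCoordinates (ModelWithCorners.pi I) hx _ u v) ?_
    rw [sum_apply, sum_apply]
    refine Eq.trans (sumForm_apply _ _ _) ?_
    refine Finset.sum_congr rfl fun j _ => ?_
    refine Eq.trans ?_ (form_inCoordinates (I j) (hx' j) _ (u j) (v j)).symm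
    rw [tangentCoordChange_pi I hx (mem_chart_source _ x),
      tangentCoordChange_pi I hx (mem_chart_source _ x)]
    rfl

variable [DecidableEq J]

lemma contMDiffOn_single (j : J) (e : ∀ y : M j, TangentSpace (I j) y) (U : Set (M j))
    (he : ContMDiffOn (I j) (I j).tangent ∞ (fun y => (⟨y, e y⟩ : TangentBundle (I j) (M j))) U)
    (s : ∀ x : ∀ j, M j, TangentSpace (ModelWithCorners.pi I) x)
    (hs : ∀ x k, s x k = (Pi.single j (e (x j)) : ∀ j, E j) k) :
    ContMDiffOn (ModelWithCorners.pi I) (ModelWithCorners.pi I).tangent ∞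
      (fun x => (⟨x, s x⟩ : TangentBundle (ModelWithCorners.pi I) (∀ j, M j))) {x | x j ∈ U} := by
  intro x₀ hx₀
  have h1 := he (x₀ j) hx₀
  rw [Bundle.contMDiffWithinAt_section] at h1 ⊢
  have h2 := h1.comp x₀ (contMDiff_eval I j).contMDiffAt.contMDiffWithinAt
    (s := {x | x j ∈ U}) (fun x hx => hx)
  have h3 := (ContinuousLinearMap.single ℝ E j).contMDiff (n := ∞) |>.contMDiffAt
    |>.comp_contMDiffWithinAt _ h2
  have key : ∀ x ∈ (chartAt (ModelPi H) x₀).source,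
      (trivializationAt (∀ j, E j) (TangentSpace (ModelWithCorners.pi I)) x₀
        ⟨x, s x⟩).2 = ContinuousLinearMap.single ℝ E j
        ((trivializationAt (E j) (TangentSpace (I j)) (x₀ j) ⟨x j, e (x j)⟩).2) := by
    intro x hx
    rw [trivializationAt_snd, trivializationAt_snd]
    funext k
    refine (tangentCoordChange_pi I (mem_chart_source _ x) hx (s x) k).trans ?_
    rw [hs]
    by_cases hk : k = j
    · subst hk
      rw [ContinuousLinearMap.single_apply, Pi.single_eq_same]
      exact congrArg _ (Pi.single_eq_same (M := E) k (e (x k)))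
    · rw [ContinuousLinearMap.single_apply, Pi.single_eq_of_ne hk]
      exact (congrArg _ (Pi.single_eq_of_ne (M := E) hk (e (x j)))).trans (map_zero _)
  refine h3.congr_of_eventuallyEq ?_ (key x₀ (mem_chart_source _ _))
  filter_upwards [mem_nhdsWithin_of_mem_nhds (chart_source_mem_nhds (ModelPi H) x₀)] with x hx
  exact key x hx

end PiManifold

section Manifold

variable {E H : Type} [NormedAddCommGroup E] [NormedSpace ℝ E] [TopologicalSpace H]
  (I : ModelWithCorners ℝ E H) {M : Type u} [TopologicalSpace M] [ChartedSpace H M]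

/-- Smoothness on `U` of a map into a finite dimensional real vector space `A`: every linear
coordinate of the map is smooth. -/
def SmoothOn {A : Type*} [AddCommGroup A] [Module ℝ A] (f : M → A) (U : Set M) : Prop :=
  ∀ ℓ : A →ₗ[ℝ] ℝ, ContMDiffOn I 𝓘(ℝ, ℝ) ∞ (fun x => ℓ (f x)) U

variable (M) [IsManifold I ∞ M] (κ : Type) [Fintype κ] [DecidableEq κ]

/-- The data making `M` an oriented Riemannian manifold: a smooth Riemannian metric and an
orientation of every tangent space which is given, locally, by a smooth frame. The index type `κ`
labels the members of a frame. -/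
structure OrientedRiemannian where
  metric : ContMDiffRiemannianMetric I ∞ E (fun x : M => TangentSpace I x)
  orientation : ∀ x : M, Orientation ℝ (TangentSpace I x) κ
  locally_framed : ∀ x₀ : M, ∃ U : Set M, IsOpen U ∧ x₀ ∈ U ∧
    ∃ b : ∀ x : M, Module.Basis κ ℝ (TangentSpace I x),
      (∀ k, ContMDiffOn I I.tangent ∞ (fun x => (⟨x, b x k⟩ : TangentBundle I M)) U) ∧
      ∀ x ∈ U, (b x).orientation = orientation x

variable {I M κ}

/-- The fibre over `x` of the bundle `P_SO` of oriented orthonormal frames; a frame is regarded as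
an oriented linear isometry from Euclidean space to the tangent space. -/
structure Frame (g : OrientedRiemannian I M κ) (x : M) where
  toEquiv : (κ → ℝ) ≃ₗ[ℝ] TangentSpace I x
  inner_eq : ∀ v w, g.metric.inner x (toEquiv v) (toEquiv w) = v ⬝ᵥ w
  oriented : ((Pi.basisFun ℝ κ).map toEquiv).orientation = g.orientation x

/-- The right action of `Spin` on frames through the covering `Spin → SO`. -/
def Frame.rotate {g : OrientedRiemannian I M κ} {x : M} (f : Frame g x) (a : Spin κ) :
    Frame g x where
  toEquiv := (rotEquiv a).trans f.toEquiv
  inner_eq v w := (f.inner_eq _ _).trans (dot_rot a v w)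
  oriented := by
    have h : ((Pi.basisFun ℝ κ).map (rotEquiv a)).orientation = (Pi.basisFun ℝ κ).orientation :=
      ((Pi.basisFun ℝ κ).orientation_comp_linearEquiv_eq_iff_det_pos (rotEquiv a)).2
        (det_rot_pos a)
    have e : (Pi.basisFun ℝ κ).map ((rotEquiv a).trans f.toEquiv) =
        ((Pi.basisFun ℝ κ).map (rotEquiv a)).map f.toEquiv := by
      ext k; rfl
    rw [e, Module.Basis.orientation_map, h, ← Module.Basis.orientation_map, f.oriented]

variable (I M κ)

/-- A smooth principal `Spin`-bundle over `M`, given by its fibres with their simply transitive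
right `Spin`-action (`div p q` is the unique element with `p · div p q = q`) and by a bundle atlas of
local sections `sec a` over the open sets `dom a`, whose transition functions are smooth maps into
the spin group, regarded as a subset of the Clifford algebra. The values of `sec a` outside
`dom a` play no role. -/
structure SpinPrincipalBundle where
  fiber : M → Type w
  act : ∀ {x : M}, fiber x → Spin κ → fiber x
  act_one : ∀ {x : M} (p : fiber x), act p 1 = p
  act_mul : ∀ {x : M} (p : fiber x) (a b : Spin κ), act p (a * b) = act (act p a) b
  div : ∀ {x : M}, fiber x → fiber x → Spin κ
  act_div : ∀ {x : M} (p q : fiber x), act p (div p q) = q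
  div_act : ∀ {x : M} (p : fiber x) (a : Spin κ), div p (act p a) = a
  Index : Type w'
  dom : Index → Set M
  isOpen_dom : ∀ a, IsOpen (dom a)
  cover : ∀ x : M, ∃ a, x ∈ dom a
  sec : Index → ∀ x : M, fiber x
  smooth_transition : ∀ a b,
    SmoothOn I (fun x => (div (sec a x) (sec b x) : Cl κ)) (dom a ∩ dom b)

variable {I M κ}

/-- A spin structure on an oriented Riemannian manifold: a principal `Spin`-bundle with a smooth
map to the bundle of oriented orthonormal frames which is equivariant with respect to the covering
`Spin → SO`. -/
structure SpinStructure (g : OrientedRiemannian I M κ) extends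
    SpinPrincipalBundle.{u, w, w'} I M κ where
  frame : ∀ {x : M}, fiber x → Frame g x
  frame_act : ∀ {x : M} (p : fiber x) (a : Spin κ), frame (act p a) = (frame p).rotate a
  smooth_frame : ∀ (a : Index) (k : κ), ContMDiffOn I I.tangent ∞
    (fun x => (⟨x, (frame (sec a x)).toEquiv (Pi.single k 1)⟩ : TangentBundle I M)) (dom a)

end Manifold

section Product

variable {J : Type} [Fintype J] [DecidableEq J] {E : J → Type} [∀ j, NormedAddCommGroup (E j)]
  [∀ j, NormedSpace ℝ (E j)] {H : J → Type} [∀ j, TopologicalSpace (H j)]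
  {I : ∀ j, ModelWithCorners ℝ (E j) (H j)}
  {M : J → Type u} [∀ j, TopologicalSpace (M j)] [∀ j, ChartedSpace (H j) (M j)]
  [∀ j, IsManifold (I j) ∞ (M j)] {κ : J → Type} [∀ j, Fintype (κ j)] [∀ j, DecidableEq (κ j)]

/-- The identification `⨁ T M_j = T M`, see `mfderiv_eval`. -/
def tangentSum (x : ∀ j, M j) :
    (∀ j, TangentSpace (I j) (x j)) ≃ₗ[ℝ] TangentSpace (ModelWithCorners.pi I) x :=
  LinearEquiv.refl ℝ (∀ j, E j)

lemma pi_orientation_congr {V : J → Type} [∀ j, AddCommGroup (V j)] [∀ j, Module ℝ (V j)]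
    (b b' : ∀ j, Module.Basis (κ j) ℝ (V j)) (h : ∀ j, (b j).orientation = (b' j).orientation) :
    (Pi.basis b).orientation = (Pi.basis b').orientation := by
  rw [Module.Basis.orientation_eq_iff_det_pos, Module.Basis.det_apply]
  let e := Fintype.equivFin J
  have entry : ∀ s t, (Pi.basis b).toMatrix (Pi.basis b') s t =
      (b s.1).repr ((Pi.single t.1 (b' t.1 t.2) : ∀ j, V j) s.1) s.2 := by
    intro s t
    rw [Module.Basis.toMatrix_apply, Pi.basis_repr, Pi.basis_apply]
  have tri : Matrix.BlockTriangular ((Pi.basis b).toMatrix (Pi.basis b'))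
      (fun s : Σ j, κ j => e s.1) := by
    intro s t hst
    have hne : s.1 ≠ t.1 := by
      intro h
      change e t.1 < e s.1 at hst
      rw [h] at hst
      exact lt_irrefl _ hst
    rw [entry, Pi.single_eq_of_ne hne]
    simp
  rw [tri.det_fintype]
  refine Finset.prod_pos fun k _ => ?_
  obtain ⟨j, rfl⟩ := e.surjective k
  let q : κ j ≃ {s : Σ j, κ j // e s.1 = e j} :=
    { toFun := fun a => ⟨⟨j, a⟩, rfl⟩
      invFun := fun s => (e.injective s.2) ▸ s.1.2
      left_inv := fun a => rfl
      right_inv := by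
        rintro ⟨⟨i, a⟩, h⟩
        obtain rfl := e.injective h
        rfl }
  rw [← Matrix.det_submatrix_equiv_self q]
  have : (Matrix.toSquareBlock ((Pi.basis b).toMatrix (Pi.basis b'))
      (fun s : Σ j, κ j => e s.1) (e j)).submatrix q q = (b j).toMatrix (b' j) := by
    ext a c
    rw [Matrix.submatrix_apply, Matrix.toSquareBlock_def, Matrix.of_apply, entry]
    simp [q, Module.Basis.toMatrix_apply]
  rw [this, ← Module.Basis.det_apply]
  exact (Module.Basis.orientation_eq_iff_det_pos _ _).1 (h j)

/-- A positively oriented basis of the tangent space. -/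
def posBasis {E H : Type} [NormedAddCommGroup E] [NormedSpace ℝ E] [TopologicalSpace H]
    {I : ModelWithCorners ℝ E H} {M : Type u} [TopologicalSpace M] [ChartedSpace H M]
    [IsManifold I ∞ M] {κ : Type} [Fintype κ] [DecidableEq κ] (g : OrientedRiemannian I M κ)
    (x : M) : Module.Basis κ ℝ (TangentSpace I x) :=
  (g.locally_framed x).choose_spec.2.2.choose x

lemma posBasis_orientation {E H : Type} [NormedAddCommGroup E] [NormedSpace ℝ E]
    [TopologicalSpace H] {I : ModelWithCorners ℝ E H} {M : Type u} [TopologicalSpace M]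
    [ChartedSpace H M] [IsManifold I ∞ M] {κ : Type} [Fintype κ] [DecidableEq κ]
    (g : OrientedRiemannian I M κ) (x : M) : (posBasis g x).orientation = g.orientation x :=
  (g.locally_framed x).choose_spec.2.2.choose_spec.2 x (g.locally_framed x).choose_spec.2.1

/-- The Riemannian product, with the product orientation: concatenating positively oriented bases
of the `T M_j` gives a positively oriented basis of `T M`. -/
def product (g : ∀ j, OrientedRiemannian (I j) (M j) (κ j)) :
    OrientedRiemannian (ModelWithCorners.pi I) (∀ j, M j) (Σ j, κ j) where
  metric := productMetric I fun j => (g j).metric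
  orientation x := ((Pi.basis fun j => posBasis (g j) (x j)).map (tangentSum x)).orientation
  locally_framed x₀ := by
    choose U hU hx b hb hbo using fun j => (g j).locally_framed (x₀ j)
    refine ⟨Set.univ.pi U, isOpen_set_pi Set.finite_univ fun j _ => hU j, fun j _ => hx j,
      fun x => (Pi.basis fun j => b j (x j)).map (tangentSum x), ?_, ?_⟩
    · rintro ⟨j, k⟩
      refine (contMDiffOn_single I j (fun y => b j y k) (U j) (hb j k) _ ?_).mono
        (fun x hx => hx j trivial)
      intro x i
      rw [Module.Basis.map_apply, Pi.basis_apply]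
      rfl
    · intro x hx
      rw [Module.Basis.orientation_map, Module.Basis.orientation_map]
      congr 1
      exact pi_orientation_congr _ _ fun j =>
        (hbo j (x j) (hx j trivial)).trans (posBasis_orientation (g j) (x j)).symm

lemma product_inner (g : ∀ j, OrientedRiemannian (I j) (M j) (κ j)) (x : ∀ j, M j)
    (v w : TangentSpace (ModelWithCorners.pi I) x) :
    (product g).metric.inner x v w = ∑ j, (g j).metric.inner (x j) (v j) (w j) :=
  sumForm_apply _ _ _

/-- The orthonormal frame of the product obtained by joining orthonormal frames of the factors. -/
def productFrame {g : ∀ j, OrientedRiemannian (I j) (M j) (κ j)} {x : ∀ j, M j}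
    (f : ∀ j, Frame (g j) (x j)) : Frame (product g) x where
  toEquiv := ((LinearEquiv.piCurry ℝ fun (j : J) (_ : κ j) => ℝ).trans
    (LinearEquiv.piCongrRight fun j => (f j).toEquiv)).trans (tangentSum x)
  inner_eq v w := by
    rw [product_inner]
    have : ∀ j, (g j).metric.inner (x j) ((f j).toEquiv fun a => v ⟨j, a⟩)
        ((f j).toEquiv fun a => w ⟨j, a⟩) = ∑ a, v ⟨j, a⟩ * w ⟨j, a⟩ :=
      fun j => (f j).inner_eq _ _
    rw [dotProduct, Fintype.sum_sigma]
    exact Finset.sum_congr rfl fun j _ => this j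
  oriented := by
    have e : (Pi.basisFun ℝ (Σ j, κ j)).map
        (((LinearEquiv.piCurry ℝ fun (j : J) (_ : κ j) => ℝ).trans
          (LinearEquiv.piCongrRight fun j => (f j).toEquiv)).trans (tangentSum x)) =
        (Pi.basis fun j => (Pi.basisFun ℝ (κ j)).map (f j).toEquiv).map (tangentSum x) := by
      apply Module.Basis.eq_of_apply_eq
      rintro ⟨j, a⟩
      rw [Module.Basis.map_apply, Module.Basis.map_apply, Pi.basis_apply]
      simp only [LinearEquiv.trans_apply]
      congr 1
      funext k
      rw [LinearEquiv.piCongrRight_apply]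
      by_cases h : k = j
      · subst h
        simp only [Pi.basisFun_apply, Pi.single_eq_same, Module.Basis.map_apply]
        congr 1
        funext c
        simp [Sigma.curry, Pi.single_apply]
      · rw [Pi.single_eq_of_ne h]
        convert map_zero (f k).toEquiv
        funext c
        simp [Sigma.curry, h]
    rw [e]
    change _ = ((Pi.basis fun j => posBasis (g j) (x j)).map (tangentSum x)).orientation
    rw [Module.Basis.orientation_map, Module.Basis.orientation_map]
    congr 1
    exact pi_orientation_congr _ _ fun j =>
      (f j).oriented.trans (posBasis_orientation (g j) (x j)).symm

end Product

section Smooth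

variable {E H : Type} [NormedAddCommGroup E] [NormedSpace ℝ E] [TopologicalSpace H]
  {I : ModelWithCorners ℝ E H} {M : Type u} [TopologicalSpace M] [ChartedSpace H M]

lemma SmoothOn.linear {A B : Type*} [AddCommGroup A] [Module ℝ A] [AddCommGroup B] [Module ℝ B]
    {f : M → A} {U : Set M} (hf : SmoothOn I f U) (L : A →ₗ[ℝ] B) :
    SmoothOn I (fun x => L (f x)) U := fun ℓ => hf (ℓ ∘ₗ L)

lemma SmoothOn.mono {A : Type*} [AddCommGroup A] [Module ℝ A] {f : M → A} {U V : Set M}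
    (hf : SmoothOn I f U) (h : V ⊆ U) : SmoothOn I f V := fun ℓ => (hf ℓ).mono h

lemma SmoothOn.congr {A : Type*} [AddCommGroup A] [Module ℝ A] {f f' : M → A} {U : Set M}
    (hf : SmoothOn I f U) (h : ∀ x ∈ U, f' x = f x) : SmoothOn I f' U :=
  fun ℓ => (hf ℓ).congr fun x hx => by rw [h x hx]

lemma SmoothOn.mul {A : Type*} [Ring A] [Algebra ℝ A] [FiniteDimensional ℝ A]
    {f f' : M → A} {U : Set M} (hf : SmoothOn I f U) (hf' : SmoothOn I f' U) :
    SmoothOn I (fun x => f x * f' x) U := by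
  intro ℓ
  let b := Module.finBasis ℝ A
  have h : ∀ x, ℓ (f x * f' x) = ∑ k, b.coord k (f x) * (ℓ ∘ₗ LinearMap.mulLeft ℝ (b k)) (f' x) := by
    intro x
    conv_lhs => rw [← b.sum_repr (f x), Finset.sum_mul, map_sum]
    exact Finset.sum_congr rfl fun k _ => by simp
  simp only [h]
  exact contMDiffOn_finsetSum fun k _ => (hf (b.coord k)).mul (hf' _)

lemma SmoothOn.multilinear {J : Type} [Fintype J] {A : J → Type*} {B : Type*}
    [∀ j, AddCommGroup (A j)] [∀ j, Module ℝ (A j)] [∀ j, FiniteDimensional ℝ (A j)]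
    [AddCommGroup B] [Module ℝ B] (m : MultilinearMap ℝ A B) {f : ∀ j, M → A j} {U : Set M}
    (hf : ∀ j, SmoothOn I (f j) U) : SmoothOn I (fun x => m fun j => f j x) U := by
  classical
  intro ℓ
  let b := fun j => Module.finBasis ℝ (A j)
  have h : ∀ x, ℓ (m fun j => f j x) =
      ∑ r : ∀ j, Fin (Module.finrank ℝ (A j)),
        (∏ j, (b j).coord (r j) (f j x)) * ℓ (m fun j => b j (r j)) := by
    intro x
    have e : (fun j => f j x) = fun j => ∑ k, (b j).coord k (f j x) • b j k := by
      funext j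
      exact ((b j).sum_repr (f j x)).symm
    rw [e, MultilinearMap.map_sum, map_sum]
    exact Finset.sum_congr rfl fun r _ => by
      rw [MultilinearMap.map_smul_univ, map_smul, smul_eq_mul]
  simp only [h]
  exact contMDiffOn_finsetSum fun r _ =>
    (contMDiffOn_finsetProd fun j _ => hf j ((b j).coord (r j))).mul contMDiffOn_const

lemma smoothOn_noncommProd {J κ : Type} [DecidableEq J] [Fintype κ] (s : Finset J) (f : J → M → Spin κ)
    (hc : ∀ x, (s : Set J).Pairwise (Function.onFun Commute fun j => f j x)) {U : Set M}
    (hf : ∀ j, SmoothOn I (fun x => (f j x : Cl κ)) U) :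
    SmoothOn I (fun x => ((s.noncommProd (fun j => f j x) (hc x) : Spin κ) : Cl κ)) U := by
  induction s using Finset.induction_on with
  | empty =>
    simp only [Finset.noncommProd_empty]
    exact fun ℓ => contMDiffOn_const
  | insert j s hj ih =>
    have := (hf j).mul (ih fun x => (hc x).mono (by simp))
    refine this.congr fun x _ => ?_
    rw [Finset.noncommProd_insert_of_notMem _ _ _ _ hj, Submonoid.coe_mul]

end Smooth

section Induced

variable {J : Type} [Fintype J] {E : J → Type} [∀ j, NormedAddCommGroup (E j)]
  [∀ j, NormedSpace ℝ (E j)] {H : J → Type} [∀ j, TopologicalSpace (H j)]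
  {I : ∀ j, ModelWithCorners ℝ (E j) (H j)}
  {M : J → Type u} [∀ j, TopologicalSpace (M j)] [∀ j, ChartedSpace (H j) (M j)]

lemma SmoothOn.comp_eval {A : Type*} [AddCommGroup A] [Module ℝ A] (j : J) {f : M j → A}
    {U : Set (M j)} (hf : SmoothOn (I j) f U) {V : Set (∀ j, M j)} (hV : ∀ x ∈ V, x j ∈ U) :
    SmoothOn (ModelWithCorners.pi I) (fun x : ∀ j, M j => f (x j)) V :=
  fun ℓ => (hf ℓ).comp (contMDiff_eval I j).contMDiffOn hV

variable [DecidableEq J] [∀ j, IsManifold (I j) ∞ (M j)] {κ : J → Type} [∀ j, Fintype (κ j)]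
  [∀ j, DecidableEq (κ j)] {g : ∀ j, OrientedRiemannian (I j) (M j) (κ j)}

lemma Frame.ext' {E H : Type} [NormedAddCommGroup E] [NormedSpace ℝ E]
    [TopologicalSpace H] {I : ModelWithCorners ℝ E H} {M : Type u} [TopologicalSpace M]
    [ChartedSpace H M] [IsManifold I ∞ M] {κ : Type} [Fintype κ] [DecidableEq κ]
    {g : OrientedRiemannian I M κ} {x : M} {f f' : Frame g x}
    (h : ∀ v, f.toEquiv v = f'.toEquiv v) : f = f' := by
  obtain ⟨e, _, _⟩ := f
  obtain ⟨e', _, _⟩ := f'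
  have : e = e' := LinearEquiv.ext h
  subst this
  rfl

lemma Frame.rotate_mul {E H : Type} [NormedAddCommGroup E] [NormedSpace ℝ E]
    [TopologicalSpace H] {I : ModelWithCorners ℝ E H} {M : Type u} [TopologicalSpace M]
    [ChartedSpace H M] [IsManifold I ∞ M] {κ : Type} [Fintype κ] [DecidableEq κ]
    {g : OrientedRiemannian I M κ} {x : M} (f : Frame g x) (a b : Spin κ) :
    f.rotate (a * b) = (f.rotate a).rotate b :=
  Frame.ext' fun v => congrArg f.toEquiv (rot_mul a b v)

lemma Frame.rotate_one {E H : Type} [NormedAddCommGroup E] [NormedSpace ℝ E]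
    [TopologicalSpace H] {I : ModelWithCorners ℝ E H} {M : Type u} [TopologicalSpace M]
    [ChartedSpace H M] [IsManifold I ∞ M] {κ : Type} [Fintype κ] [DecidableEq κ]
    {g : OrientedRiemannian I M κ} {x : M} (f : Frame g x) : f.rotate 1 = f :=
  Frame.ext' fun v => congrArg f.toEquiv (rot_one v)

lemma productFrame_rotate {x : ∀ j, M j} (f : ∀ j, Frame (g j) (x j)) (a : ∀ j, Spin (κ j)) :
    productFrame (fun j => (f j).rotate (a j)) = (productFrame f).rotate (spinProd a) := by
  refine Frame.ext' fun v => funext fun j => ?_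
  change (f j).toEquiv (rot (a j) fun b => v ⟨j, b⟩) =
    (f j).toEquiv fun b => rot (spinProd a) v ⟨j, b⟩
  congr 1
  funext b
  rw [rot_spinProd]

variable (P : ∀ j, SpinStructure.{u, w, w'} (g j))

/-- The fibre over `x` of `(∏ P_j) ×_{∏ Spin(κ j)} Spin(⨁ κ)`. The class of a pair `(p, b)` is
recorded as the equivariant map `F : ∏ P_j → Spin(⨁ κ)` with `F p = b`. -/
@[ext] structure InducedFiber (x : ∀ j, M j) where
  toFun : (∀ j, (P j).fiber (x j)) → Spin (Σ j, κ j)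
  equivariant : ∀ (p : ∀ j, (P j).fiber (x j)) (a : ∀ j, Spin (κ j)),
    toFun (fun j => (P j).act (p j) (a j)) = (spinProd a)⁻¹ * toFun p

variable {P}

lemma SpinPrincipalBundle.div_act_right {E H : Type} [NormedAddCommGroup E] [NormedSpace ℝ E]
    [TopologicalSpace H] {I : ModelWithCorners ℝ E H} {M : Type u} [TopologicalSpace M]
    [ChartedSpace H M] {κ : Type} [Fintype κ]
    (P : SpinPrincipalBundle.{u, w, w'} I M κ) {x : M} (p q : P.fiber x) (a : Spin κ) :
    P.div p (P.act q a) = P.div p q * a := by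
  rw [← P.div_act p (P.div p q * a), P.act_mul, P.act_div]

lemma SpinPrincipalBundle.div_self {E H : Type} [NormedAddCommGroup E] [NormedSpace ℝ E]
    [TopologicalSpace H] {I : ModelWithCorners ℝ E H} {M : Type u} [TopologicalSpace M]
    [ChartedSpace H M] {κ : Type} [Fintype κ]
    (P : SpinPrincipalBundle.{u, w, w'} I M κ) {x : M} (p : P.fiber x) : P.div p p = 1 := by
  conv_lhs => rw [← P.act_one p]
  rw [P.act_one, ← P.div_act p 1, P.act_one]

lemma InducedFiber.apply_eq {x : ∀ j, M j} (F : InducedFiber P x)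
    (p q : ∀ j, (P j).fiber (x j)) :
    F.toFun q = (spinProd fun j => (P j).div (p j) (q j))⁻¹ * F.toFun p := by
  rw [← F.equivariant]
  exact congrArg F.toFun (funext fun j => ((P j).act_div _ _).symm)

variable (P)

/-- The map `∏ P_j → P`, `p ↦ [p, 1]`, exhibiting `∏ P_j` as a reduction of the induced bundle. -/
def reduction {x : ∀ j, M j} (p : ∀ j, (P j).fiber (x j)) : InducedFiber P x :=
  ⟨fun q => (spinProd fun j => (P j).div (p j) (q j))⁻¹, fun q a => by
    rw [← mul_inv_rev, ← map_mul]
    exact congrArg (fun c => (spinProd c)⁻¹) (funext fun j => (P j).div_act_right _ _ _)⟩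

/-- A point of `∏ P_j` over `x`. -/
def basePoint (x : ∀ j, M j) (j : J) : (P j).fiber (x j) :=
  (P j).sec ((P j).cover (x j)).choose (x j)

lemma frame_indep {x : ∀ j, M j} (F : InducedFiber P x) (p q : ∀ j, (P j).fiber (x j)) :
    (productFrame fun j => (P j).frame (q j)).rotate (F.toFun q) =
      (productFrame fun j => (P j).frame (p j)).rotate (F.toFun p) := by
  have h : (fun j => (P j).frame (q j)) =
      fun j => ((P j).frame (p j)).rotate ((P j).div (p j) (q j)) := by
    funext j
    rw [← (P j).frame_act, (P j).act_div]
  rw [h, productFrame_rotate, F.apply_eq p q, ← Frame.rotate_mul, mul_inv_cancel_left]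

/-- The induced spin structure on the Riemannian product: the principal bundle
`(∏ P_j) ×_{∏ Spin(κ j)} Spin(⨁ κ)`, where `[p, b]` is mapped to the frame obtained by joining the
frames of the `p j` and rotating by `b`. Its local sections are the `[(s_j), 1]`. -/
def inducedSpinStructure : SpinStructure.{u, w, w'} (product g) where
  fiber := InducedFiber P
  act F b := ⟨fun p => F.toFun p * b, fun p a => by rw [F.equivariant, mul_assoc]⟩
  act_one F := InducedFiber.ext (funext fun p => mul_one _)
  act_mul F a b := InducedFiber.ext (funext fun p => (mul_assoc _ _ _).symm)
  div {x} F F' := (F.toFun (basePoint P x))⁻¹ * F'.toFun (basePoint P x)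
  act_div {x} F F' := by
    refine InducedFiber.ext (funext fun p => ?_)
    change F.toFun p * ((F.toFun (basePoint P x))⁻¹ * F'.toFun (basePoint P x)) = F'.toFun p
    rw [F.apply_eq (basePoint P x) p, F'.apply_eq (basePoint P x) p, mul_assoc,
      mul_inv_cancel_left]
  div_act F a := inv_mul_cancel_left _ _
  Index := ∀ j, (P j).Index
  dom a := Set.univ.pi fun j => (P j).dom (a j)
  isOpen_dom a := isOpen_set_pi Set.finite_univ fun j _ => (P j).isOpen_dom (a j)
  cover x := ⟨fun j => ((P j).cover (x j)).choose, fun j _ => ((P j).cover (x j)).choose_spec⟩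
  sec a x := reduction P fun j => (P j).sec (a j) (x j)
  smooth_transition a b := by
    have key : ∀ x : ∀ j, M j,
        ((reduction P fun j => (P j).sec (a j) (x j)).toFun (basePoint P x))⁻¹ *
          (reduction P fun j => (P j).sec (b j) (x j)).toFun (basePoint P x) =
        spinProd fun j => (P j).div ((P j).sec (a j) (x j)) ((P j).sec (b j) (x j)) := by
      intro x
      change (spinProd _)⁻¹⁻¹ * (spinProd _)⁻¹ = _
      rw [inv_inv, ← map_inv, ← map_mul]
      refine congrArg spinProd (funext fun j => ?_)
      rw [Pi.mul_apply, Pi.inv_apply, mul_inv_eq_iff_eq_mul, ← (P j).div_act_right, (P j).act_div]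
    refine SmoothOn.congr ?_ (fun x _ => congrArg Subtype.val (key x))
    simp only [spinProd, MonoidHom.noncommPiCoprod_apply]
    refine smoothOn_noncommProd _ _ _ fun j => ?_
    refine SmoothOn.comp_eval (f := fun y => CliffordAlgebra.map (incl j)
      ((P j).div ((P j).sec (a j) y) ((P j).sec (b j) y) : Cl (κ j))) j
      (((P j).smooth_transition (a j) (b j)).linear (CliffordAlgebra.map (incl j)).toLinearMap) ?_
    exact fun x hx => ⟨hx.1 j trivial, hx.2 j trivial⟩
  frame {x} F := (productFrame fun j => (P j).frame (basePoint P x j)).rotate (F.toFun (basePoint P x))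
  frame_act F a := Frame.rotate_mul _ _ _
  smooth_frame a k := by
    obtain ⟨j, k⟩ := k
    have key : ∀ x : ∀ j, M j,
        (productFrame fun j => (P j).frame (basePoint P x j)).rotate
          ((reduction P fun j => (P j).sec (a j) (x j)).toFun (basePoint P x)) =
        productFrame fun j => (P j).frame ((P j).sec (a j) (x j)) := by
      intro x
      rw [frame_indep P _ fun j => (P j).sec (a j) (x j)]
      have : (reduction P fun j => (P j).sec (a j) (x j)).toFun
          (fun j => (P j).sec (a j) (x j)) = 1 := by
        change (spinProd _)⁻¹ = 1
        rw [inv_eq_one, ← map_one spinProd]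
        exact congrArg spinProd (funext fun j => (P j).div_self _)
      rw [this, Frame.rotate_one]
    simp only [key]
    refine (contMDiffOn_single I j (fun y => ((P j).frame ((P j).sec (a j) y)).toEquiv
      (Pi.single k 1)) _ ((P j).smooth_frame (a j) k) _ ?_).mono (fun x hx => hx j trivial)
    intro x i
    change ((P i).frame ((P i).sec (a i) (x i))).toEquiv
      (fun c => (Pi.single ⟨j, k⟩ 1 : (Σ j, κ j) → ℝ) ⟨i, c⟩) = _
    by_cases h : i = j
    · subst h
      refine Eq.trans ?_ (Pi.single_eq_same (M := E) i _).symm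
      congr 1
      funext c
      simp [Pi.single_apply]
    · refine Eq.trans ?_ (Pi.single_eq_of_ne (M := E) h _).symm
      refine Eq.trans (congrArg _ ?_) (map_zero ((P i).frame ((P i).sec (a i) (x i))).toEquiv)
      funext c
      simp [h]

end Induced

section Bundles

variable {E H : Type} [NormedAddCommGroup E] [NormedSpace ℝ E] [TopologicalSpace H]
  (I : ModelWithCorners ℝ E H) (M : Type u) [TopologicalSpace M] [ChartedSpace H M]

/-- A smooth complex vector bundle over `M`, given by its fibres and a bundle atlas: a cover of `M`
by open sets `dom a` with linear trivializations `triv a` whose transition functions are smooth.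
The values of `triv a` outside `dom a` play no role. -/
structure ComplexBundle where
  fiber : M → Type f
  [addCommGroup : ∀ x, AddCommGroup (fiber x)]
  [module : ∀ x, Module ℂ (fiber x)]
  model : Type m
  [addCommGroupModel : AddCommGroup model]
  [moduleModel : Module ℂ model]
  [finiteModel : FiniteDimensional ℂ model]
  Index : Type w'
  dom : Index → Set M
  isOpen_dom : ∀ a, IsOpen (dom a)
  cover : ∀ x : M, ∃ a, x ∈ dom a
  triv : Index → ∀ x : M, fiber x ≃ₗ[ℂ] model
  smooth_transition : ∀ (a b : Index) (v : model),
    SmoothOn I (fun x => triv b x ((triv a x).symm v)) (dom a ∩ dom b)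

attribute [instance] ComplexBundle.addCommGroup ComplexBundle.module
  ComplexBundle.addCommGroupModel ComplexBundle.moduleModel ComplexBundle.finiteModel

variable {I M}

/-- An isomorphism of smooth complex vector bundles over the identity of `M`. -/
structure ComplexBundle.Iso (B : ComplexBundle.{u, w', f, m} I M)
    (C : ComplexBundle.{u, w, v, v'} I M) where
  equiv : ∀ x : M, B.fiber x ≃ₗ[ℂ] C.fiber x
  smooth : ∀ (a : B.Index) (b : C.Index) (v : B.model),
    SmoothOn I (fun x => C.triv b x (equiv x ((B.triv a x).symm v))) (B.dom a ∩ C.dom b)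
  smooth_symm : ∀ (a : B.Index) (b : C.Index) (v : C.model),
    SmoothOn I (fun x => B.triv a x ((equiv x).symm ((C.triv b x).symm v))) (B.dom a ∩ C.dom b)

end Bundles

section Spinors

/-- A complex spinor module: an irreducible complex representation of the Clifford algebra. -/
structure SpinorModule (κ : Type) [Fintype κ] where
  carrier : Type v
  [addCommGroup : AddCommGroup carrier]
  [module : Module ℂ carrier]
  [finite : FiniteDimensional ℂ carrier]
  c : Cl κ →ₐ[ℝ] Module.End ℂ carrier
  nontrivial : Nontrivial carrier
  irreducible : ∀ V : Submodule ℂ carrier, (∀ (z : Cl κ), ∀ s ∈ V, c z s ∈ V) → V = ⊥ ∨ V = ⊤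

attribute [instance] SpinorModule.addCommGroup SpinorModule.module SpinorModule.finite

variable {E H : Type} [NormedAddCommGroup E] [NormedSpace ℝ E] [TopologicalSpace H]
  {I : ModelWithCorners ℝ E H} {M : Type u} [TopologicalSpace M] [ChartedSpace H M]
  [IsManifold I ∞ M] {κ : Type} [Fintype κ] [DecidableEq κ] {g : OrientedRiemannian I M κ}
  (P : SpinStructure.{u, w, w'} g) (Δ : SpinorModule.{v} κ)

/-- The fibre over `x` of the associated bundle `P ×_Spin Δ`. The class of a pair `(p, s)` is
recorded as the equivariant map `f : P_x → Δ` with `f p = s`. -/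
def spinorSubmodule (x : M) : Submodule ℂ (P.fiber x → Δ.carrier) where
  carrier := {f | ∀ (p : P.fiber x) (a : Spin κ),
    f (P.act p a) = Δ.c ((a⁻¹ : Spin κ) : Cl κ) (f p)}
  zero_mem' p a := (map_zero _).symm
  add_mem' {f f'} hf hf' p a := by
    rw [Pi.add_apply, Pi.add_apply, hf, hf', map_add]
  smul_mem' r f hf p a := by
    rw [Pi.smul_apply, Pi.smul_apply, hf, map_smul]

/-- The fibre of `P ×_Spin Δ` as a type. -/
def spinorFiber (x : M) : Type (max w v) := spinorSubmodule P Δ x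

instance (x : M) : AddCommGroup (spinorFiber P Δ x) :=
  inferInstanceAs (AddCommGroup (spinorSubmodule P Δ x))

instance (x : M) : Module ℂ (spinorFiber P Δ x) :=
  inferInstanceAs (Module ℂ (spinorSubmodule P Δ x))

lemma div_inv {x : M} (p q : P.fiber x) : (P.div p q)⁻¹ = P.div q p := by
  rw [inv_eq_iff_mul_eq_one, ← P.div_act_right, P.act_div, P.div_self]

variable {P Δ}

lemma spinorFiber_apply {x : M} (s : spinorFiber P Δ x) (p q : P.fiber x) :
    s.1 q = Δ.c (P.div q p : Spin κ) (s.1 p) := by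
  have := s.2 p (P.div p q)
  rwa [P.act_div, div_inv] at this

/-- The isomorphism of the fibre with `Δ` given by a point `p` of the spin structure. -/
def evalAt {x : M} (p : P.fiber x) : spinorFiber P Δ x ≃ₗ[ℂ] Δ.carrier where
  toFun s := s.1 p
  map_add' _ _ := rfl
  map_smul' _ _ := rfl
  invFun v := ⟨fun q => Δ.c (P.div q p : Spin κ) v, fun q a => by
    change Δ.c (P.div (P.act q a) p : Spin κ) v = Δ.c ((a⁻¹ : Spin κ) : Cl κ) (Δ.c _ v)
    rw [← Module.End.mul_apply, ← map_mul, ← Submonoid.coe_mul, ← div_inv P p, P.div_act_right,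
      mul_inv_rev, div_inv]⟩
  left_inv s := Subtype.ext (funext fun q => (spinorFiber_apply s p q).symm)
  right_inv v := by
    change Δ.c (P.div p p : Spin κ) v = v
    rw [P.div_self, Submonoid.coe_one, map_one, Module.End.one_apply]

lemma evalAt_symm_apply {x : M} (p q : P.fiber x) (v : Δ.carrier) :
    evalAt q ((evalAt p).symm v) = Δ.c (P.div q p : Spin κ) v := rfl

lemma smoothOn_transition (a b : P.Index) (v : Δ.carrier) :
    SmoothOn I (fun x => evalAt (P.sec b x) ((evalAt (P.sec a x)).symm v))
      (P.dom a ∩ P.dom b) :=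
  ((P.smooth_transition b a).mono fun _ hx => ⟨hx.2, hx.1⟩).linear
    { toFun := fun z => Δ.c z v
      map_add' := fun z z' => by rw [map_add, LinearMap.add_apply]
      map_smul' := fun r z => by rw [map_smul, LinearMap.smul_apply, RingHom.id_apply] }

variable (P Δ)

/-- The spinor bundle `P ×_Spin Δ` of a spin structure. -/
def spinorBundle : ComplexBundle.{u, w', max w v, v} I M where
  fiber x := spinorFiber P Δ x
  model := Δ.carrier
  Index := P.Index
  dom := P.dom
  isOpen_dom := P.isOpen_dom
  cover := P.cover
  triv a x := evalAt (P.sec a x)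
  smooth_transition := smoothOn_transition

lemma frame_symm_act {x : M} (p : P.fiber x) (a : Spin κ) (X : TangentSpace I x) :
    (P.frame (P.act p a)).toEquiv.symm X = rot a⁻¹ ((P.frame p).toEquiv.symm X) := by
  rw [LinearEquiv.symm_apply_eq, P.frame_act]
  change X = (P.frame p).toEquiv (rot a (rot a⁻¹ _))
  rw [← rot_mul, mul_inv_cancel, rot_one, LinearEquiv.apply_symm_apply]

/-- Clifford multiplication by the tangent vector `X`: `X · [p, s] = [p, v · s]`, where `v` is the
coordinate vector of `X` in the frame of `p`. -/
def cliffordMul {x : M} (X : TangentSpace I x) : spinorFiber P Δ x →ₗ[ℂ] spinorFiber P Δ x where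
  toFun s := ⟨fun p => Δ.c (ι (stdForm κ) ((P.frame p).toEquiv.symm X)) (s.1 p), fun p a => by
    change Δ.c (ι (stdForm κ) ((P.frame (P.act p a)).toEquiv.symm X)) (s.1 (P.act p a)) =
      Δ.c ((a⁻¹ : Spin κ) : Cl κ) (Δ.c (ι (stdForm κ) ((P.frame p).toEquiv.symm X)) (s.1 p))
    rw [s.2, frame_symm_act, ι_rot, inv_inv, ← Module.End.mul_apply, ← Module.End.mul_apply,
      ← map_mul, ← map_mul, mul_assoc, coe_mul_coe_inv, mul_one]⟩
  map_add' s s' := Subtype.ext (funext fun p => map_add _ _ _)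
  map_smul' r s := Subtype.ext (funext fun p => map_smul _ _ _)

end Spinors

section Grading

/-- The volume element `e₁ ⋯ e_D` of the Clifford algebra. -/
def vol (D : ℕ) : Cl (Fin D) :=
  ((List.finRange D).map fun k => ι (stdForm (Fin D)) (Pi.single k 1)).prod

lemma single_anticomm {κ : Type} [Fintype κ] [DecidableEq κ] {k l : κ} (h : k ≠ l) :
    ι (stdForm κ) (Pi.single k 1) * ι (stdForm κ) (Pi.single l 1) =
      -(ι (stdForm κ) (Pi.single l 1) * ι (stdForm κ) (Pi.single k 1)) := by
  rw [eq_neg_iff_add_eq_zero]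
  refine ι_mul_ι_add_swap_of_isOrtho ?_
  rw [QuadraticMap.isOrtho_def]
  simp only [stdForm_apply, Pi.add_apply, mul_add, add_mul, Finset.sum_add_distrib]
  simp [Pi.single_apply, h, h.symm]

lemma single_mul_vol {D : ℕ} (k : Fin D) :
    ι (stdForm (Fin D)) (Pi.single k 1) * vol D =
      ((-1 : ℝ) ^ (D - 1)) • (vol D * ι (stdForm (Fin D)) (Pi.single k 1)) := by
  have h : ∀ l : List (Fin D), ι (stdForm (Fin D)) (Pi.single k 1) *
      (l.map fun k => ι (stdForm (Fin D)) (Pi.single k 1)).prod =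
      ((-1 : ℝ) ^ (l.countP fun j => j ≠ k)) •
        ((l.map fun k => ι (stdForm (Fin D)) (Pi.single k 1)).prod *
          ι (stdForm (Fin D)) (Pi.single k 1)) := by
    intro l
    induction l with
    | nil => simp
    | cons j l ih =>
      rw [List.map_cons, List.prod_cons, List.countP_cons]
      by_cases hj : j = k
      · subst hj
        rw [mul_assoc, ih]
        simp
      · rw [← mul_assoc, single_anticomm (Ne.symm hj), neg_mul, mul_assoc, ih]
        simp [hj, pow_succ, mul_assoc]
  have e : (List.finRange D).countP (fun j => j ≠ k) = D - 1 := by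
    have h1 := List.length_eq_countP_add_countP (fun j => decide (j = k)) (l := List.finRange D)
    have h2 : (List.finRange D).countP (fun j => decide (j = k)) = 1 := by
      have := List.count_eq_one_of_mem (List.nodup_finRange D) (List.mem_finRange k)
      rw [List.count] at this
      convert this using 2
      funext j
      exact Bool.eq_iff_iff.2 (by simp)
    simp only [List.length_finRange] at h1
    rw [h2] at h1
    simp at h1 ⊢
    omega
  rw [vol, h, e]

lemma ι_mul_vol {D : ℕ} (v : Fin D → ℝ) : ι (stdForm (Fin D)) v * vol D =
    ((-1 : ℝ) ^ (D - 1)) • (vol D * ι (stdForm (Fin D)) v) := by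
  have : v = ∑ k, v k • (Pi.single k 1 : Fin D → ℝ) := by
    ext j; simp [Finset.sum_apply, Pi.single_apply]
  rw [this]
  simp only [map_sum, map_smul, Finset.sum_mul, Finset.mul_sum, Finset.smul_sum]
  refine Finset.sum_congr rfl fun k _ => ?_
  rw [smul_mul_assoc, single_mul_vol, mul_smul_comm, smul_comm]

lemma commute_vol {D : ℕ} (a : Spin (Fin D)) : (a : Cl (Fin D)) * vol D = vol D * a := by
  have h : (a : Cl (Fin D)) ∈ evenOdd (stdForm (Fin D)) 0 := spinGroup.mem_even a.2
  generalize (a : Cl (Fin D)) = z at h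
  induction z, h using CliffordAlgebra.even_induction with
  | algebraMap r => exact Algebra.commutes r _
  | add x y hx hy ihx ihy => rw [add_mul, mul_add, ihx, ihy]
  | ι_mul_ι_mul v w x hx ih =>
    rw [mul_assoc, ih, ← mul_assoc, mul_assoc (ι _ v), ι_mul_vol, mul_smul_comm, ← mul_assoc,
      ι_mul_vol, smul_mul_assoc, smul_mul_assoc, smul_mul_assoc, smul_smul, ← pow_add]
    rw [Even.neg_one_pow ⟨D - 1, rfl⟩, one_smul]
    simp only [mul_assoc]

variable {D : ℕ}

/-- The half `Δ^ε` of a spinor module, `ε = ±1`. In even dimension it is the eigenspace of the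
normalized volume element `i^(D/2) e₁ ⋯ e_D` (an involution), in odd dimension it is all of `Δ`. -/
def half (Δ : SpinorModule.{v} (Fin D)) (ε : ℂ) : Submodule ℂ Δ.carrier :=
  if Even D then Module.End.eigenspace (Complex.I ^ (D / 2) • Δ.c (vol D)) ε else ⊤

lemma c_mem_half {Δ : SpinorModule.{v} (Fin D)} {ε : ℂ} (a : Spin (Fin D)) {s : Δ.carrier}
    (hs : s ∈ half Δ ε) : Δ.c (a : Cl (Fin D)) s ∈ half Δ ε := by
  unfold half at hs ⊢
  split_ifs at hs ⊢ with h
  · rw [Module.End.mem_eigenspace_iff] at hs ⊢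
    rw [LinearMap.smul_apply, ← Module.End.mul_apply, ← map_mul, ← commute_vol, map_mul,
      Module.End.mul_apply, ← map_smul, ← LinearMap.smul_apply, hs, map_smul]
  · trivial

variable {E H : Type} [NormedAddCommGroup E] [NormedSpace ℝ E] [TopologicalSpace H]
  {I : ModelWithCorners ℝ E H} {M : Type u} [TopologicalSpace M] [ChartedSpace H M]
  [IsManifold I ∞ M] {g : OrientedRiemannian I M (Fin D)}
  (P : SpinStructure.{u, w, w'} g) (Δ : SpinorModule.{v} (Fin D))

/-- The fibre of the half spinor bundle `P ×_Spin Δ^ε`. -/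
def halfFiber (ε : ℂ) (x : M) : Submodule ℂ (spinorFiber P Δ x) :=
  ⨅ p : P.fiber x, (half Δ ε).comap (evalAt p).toLinearMap

lemma halfFiber_map (ε : ℂ) {x : M} (p : P.fiber x) :
    (halfFiber P Δ ε x).map (evalAt p).toLinearMap = half Δ ε := by
  apply le_antisymm
  · rintro _ ⟨s, hs, rfl⟩
    exact (Submodule.mem_iInf _).1 hs p
  · intro v hv
    refine ⟨(evalAt p).symm v, ?_, (evalAt p).apply_symm_apply v⟩
    exact (Submodule.mem_iInf _).2 fun q => c_mem_half _ hv

end Grading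

section Tensor

variable {N : ℕ}

/-- Given spaces `F_i` with subspaces `F_i^+` and `F_i^-`, this is the subspace of
`⨂_i (F_i ⊕ F_i)` that is the tensor product of the diagonals `Δ(F_i ⊕ F_i)` for `i ∈ T` and of
the `F_i^+ ⊕ F_i^-` for `i ∉ T`. -/
def tensorSub {F : Fin N → Type v} [∀ i, AddCommGroup (F i)] [∀ i, Module ℂ (F i)]
    (T : Finset (Fin N)) (Fp Fm : ∀ i, Submodule ℂ (F i)) :
    Submodule ℂ (⨂[ℂ] i, F i × F i) :=
  Submodule.span ℂ {t | ∃ ξ : ∀ i, F i × F i, PiTensorProduct.tprod ℂ ξ = t ∧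
    ∀ i, if i ∈ T then (ξ i).1 = (ξ i).2 else (ξ i).1 ∈ Fp i ∧ (ξ i).2 ∈ Fm i}

lemma tensorSub_map {F : Fin N → Type v} [∀ i, AddCommGroup (F i)] [∀ i, Module ℂ (F i)]
    {G : Fin N → Type v'} [∀ i, AddCommGroup (G i)] [∀ i, Module ℂ (G i)]
    (T : Finset (Fin N)) {Fp Fm : ∀ i, Submodule ℂ (F i)} {Gp Gm : ∀ i, Submodule ℂ (G i)}
    (e : ∀ i, F i ≃ₗ[ℂ] G i) (hp : ∀ i, (Fp i).map (e i).toLinearMap = Gp i)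
    (hm : ∀ i, (Fm i).map (e i).toLinearMap = Gm i) :
    (tensorSub T Fp Fm).map
      (PiTensorProduct.congr fun i => (e i).prodCongr (e i)).toLinearMap = tensorSub T Gp Gm := by
  rw [tensorSub, Submodule.map_span, tensorSub]
  congr 1
  ext t
  constructor
  · rintro ⟨_, ⟨ξ, rfl, hξ⟩, rfl⟩
    refine ⟨fun i => (e i).prodCongr (e i) (ξ i), (PiTensorProduct.congr_tprod _ _).symm, ?_⟩
    intro i
    have h := hξ i
    split_ifs at h ⊢
    · exact congrArg (e i) h
    · rw [← hp, ← hm]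
      exact ⟨⟨_, h.1, rfl⟩, ⟨_, h.2, rfl⟩⟩
  · rintro ⟨ξ, rfl, hξ⟩
    refine ⟨PiTensorProduct.tprod ℂ fun i => ((e i).prodCongr (e i)).symm (ξ i), ⟨_, rfl, ?_⟩, ?_⟩
    · intro i
      have h := hξ i
      split_ifs at h ⊢
      · exact congrArg (e i).symm h
      · rw [← hp, ← hm] at h
        obtain ⟨⟨s, hs, h1⟩, ⟨s', hs', h2⟩⟩ := h
        have e1 : (e i).symm (ξ i).1 = s := by rw [LinearEquiv.symm_apply_eq]; exact h1.symm
        have e2 : (e i).symm (ξ i).2 = s' := by rw [LinearEquiv.symm_apply_eq]; exact h2.symm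
        exact ⟨(congrArg (· ∈ Fp i) e1).mpr hs, (congrArg (· ∈ Fm i) e2).mpr hs'⟩
    · refine (PiTensorProduct.congr_tprod _ _).trans ?_
      congr 1
      funext i
      exact LinearEquiv.apply_symm_apply _ _

/-- Operators `X_i` of the `F_i` act on `⨂_i (F_i ⊕ F_i)` through
`X Ξ = ∑_i (-1)^(ε_1 + ⋯ + ε_(i-1)) ξ_1 ⊗ ⋯ ⊗ X_i ξ_i ⊗ ⋯ ⊗ ξ_N` for homogeneous `ξ_j` of parity
`ε_j`, where the first summand of `F_j ⊕ F_j` is even, the second is odd, and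
`X_i (ξ⁺, ξ⁻) = (X_i ξ⁻, X_i ξ⁺)`. -/
def cliffordTensor {F : Fin N → Type v} [∀ i, AddCommGroup (F i)] [∀ i, Module ℂ (F i)]
    (X : ∀ i, F i →ₗ[ℂ] F i) : (⨂[ℂ] i, F i × F i) →ₗ[ℂ] (⨂[ℂ] i, F i × F i) :=
  ∑ i, PiTensorProduct.map fun j =>
    if j < i then LinearMap.prodMap LinearMap.id (-LinearMap.id)
    else if j = i then
      LinearMap.prod (X j ∘ₗ LinearMap.snd ℂ (F j) (F j)) (X j ∘ₗ LinearMap.fst ℂ (F j) (F j))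
    else LinearMap.id

end Tensor

section ProductSpinors

variable {N : ℕ} {E : Fin N → Type} [∀ j, NormedAddCommGroup (E j)]
  [∀ j, NormedSpace ℝ (E j)] {H : Fin N → Type} [∀ j, TopologicalSpace (H j)]
  {I : ∀ j, ModelWithCorners ℝ (E j) (H j)}
  {M : Fin N → Type u} [∀ j, TopologicalSpace (M j)] [∀ j, ChartedSpace (H j) (M j)]
  [∀ j, IsManifold (I j) ∞ (M j)] {D : Fin N → ℕ}
  {g : ∀ j, OrientedRiemannian (I j) (M j) (Fin (D j))}
  (P : ∀ j, SpinStructure.{u, w, w'} (g j)) (Δ : ∀ j, SpinorModule.{v} (Fin (D j)))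
  (T : Finset (Fin N))

/-- The fibre of the bundle `S` over the product: the tensor product of the diagonals of
`S_i ⊕ S_i` for `i ∈ T` and of the `S_i^+ ⊕ S_i^-` for `i ∉ T`. -/
def productFiber (x : ∀ j, M j) :
    Submodule ℂ (⨂[ℂ] i, spinorFiber (P i) (Δ i) (x i) × spinorFiber (P i) (Δ i) (x i)) :=
  tensorSub T (fun i => halfFiber (P i) (Δ i) 1 (x i)) (fun i => halfFiber (P i) (Δ i) (-1) (x i))

/-- The standard fibre of the bundle `S`. -/
def stdFiber : Submodule ℂ (⨂[ℂ] i, (Δ i).carrier × (Δ i).carrier) :=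
  tensorSub T (fun i => half (Δ i) 1) (fun i => half (Δ i) (-1))

variable {P}

/-- The isomorphism of the fibre of `S` with its standard fibre given by a point of `∏ P_i`. -/
def productEval {x : ∀ j, M j} (p : ∀ j, (P j).fiber (x j)) :
    productFiber P Δ T x ≃ₗ[ℂ] stdFiber Δ T :=
  LinearEquiv.ofSubmodules
    (PiTensorProduct.congr fun i => (evalAt (Δ := Δ i) (p i)).prodCongr (evalAt (p i))) _ _
    (tensorSub_map T _ (fun i => halfFiber_map (P i) (Δ i) 1 (p i))
      fun i => halfFiber_map (P i) (Δ i) (-1) (p i))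

lemma productEval_transition {x : ∀ j, M j} (p q : ∀ j, (P j).fiber (x j)) (v : stdFiber Δ T) :
    (productEval Δ T q ((productEval Δ T p).symm v) : ⨂[ℂ] i, (Δ i).carrier × (Δ i).carrier) =
      PiTensorProduct.map (fun i => LinearMap.prodMap
        ((evalAt (p i)).symm.trans (evalAt (Δ := Δ i) (q i))).toLinearMap
        ((evalAt (p i)).symm.trans (evalAt (Δ := Δ i) (q i))).toLinearMap) v.1 := by
  change PiTensorProduct.congr _ ((PiTensorProduct.congr _).symm v.1) = _
  generalize v.1 = v
  induction v using PiTensorProduct.induction_on with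
  | smul_tprod r ξ =>
    rw [map_smul, map_smul, map_smul, PiTensorProduct.congr_symm_tprod,
      PiTensorProduct.congr_tprod, PiTensorProduct.map_tprod]
    rfl
  | add v v' hv hv' => rw [map_add, map_add, map_add, hv, hv']

lemma SmoothOn.add {E H : Type} [NormedAddCommGroup E] [NormedSpace ℝ E] [TopologicalSpace H]
    {I : ModelWithCorners ℝ E H} {M : Type u} [TopologicalSpace M] [ChartedSpace H M]
    {A : Type*} [AddCommGroup A] [Module ℝ A] {f f' : M → A} {U : Set M}
    (hf : SmoothOn I f U) (hf' : SmoothOn I f' U) : SmoothOn I (fun x => f x + f' x) U := by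
  intro ℓ
  simp only [map_add]
  exact (hf ℓ).add (hf' ℓ)

lemma SmoothOn.prodMk {E H : Type} [NormedAddCommGroup E] [NormedSpace ℝ E] [TopologicalSpace H]
    {I : ModelWithCorners ℝ E H} {M : Type u} [TopologicalSpace M] [ChartedSpace H M]
    {A B : Type*} [AddCommGroup A] [Module ℝ A] [AddCommGroup B] [Module ℝ B] {f : M → A}
    {f' : M → B} {U : Set M} (hf : SmoothOn I f U) (hf' : SmoothOn I f' U) :
    SmoothOn I (fun x => (f x, f' x)) U :=
  ((hf.linear (LinearMap.inl ℝ A B)).add (hf'.linear (LinearMap.inr ℝ A B))).congr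
    fun x _ => by simp

lemma smoothOn_productEval (a b : ∀ j, (P j).Index) (v : stdFiber Δ T) :
    SmoothOn (ModelWithCorners.pi I) (fun x : ∀ j, M j =>
      productEval Δ T (fun j => (P j).sec (b j) (x j))
        ((productEval Δ T fun j => (P j).sec (a j) (x j)).symm v))
      ((Set.univ.pi fun j => (P j).dom (a j)) ∩ Set.univ.pi fun j => (P j).dom (b j)) := by
  suffices h : SmoothOn (ModelWithCorners.pi I) (fun x : ∀ j, M j =>
      (productEval Δ T (fun j => (P j).sec (b j) (x j))
        ((productEval Δ T fun j => (P j).sec (a j) (x j)).symm v) :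
          ⨂[ℂ] i, (Δ i).carrier × (Δ i).carrier))
      ((Set.univ.pi fun j => (P j).dom (a j)) ∩ Set.univ.pi fun j => (P j).dom (b j)) by
    intro ℓ
    obtain ⟨ℓ', hℓ⟩ := LinearMap.exists_extend (p := (stdFiber Δ T).restrictScalars ℝ) ℓ
    exact (h ℓ').congr fun x _ => (LinearMap.congr_fun hℓ _).symm
  simp only [productEval_transition]
  generalize v.1 = v
  induction v using PiTensorProduct.induction_on with
  | smul_tprod r ξ =>
    have h := SmoothOn.multilinear (I := ModelWithCorners.pi I) (M := ∀ j, M j)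
      ((PiTensorProduct.tprod ℂ (s := fun i => (Δ i).carrier × (Δ i).carrier)).restrictScalars ℝ)
      (f := fun j x => (evalAt ((P j).sec (b j) (x j)) ((evalAt ((P j).sec (a j) (x j))).symm (ξ j).1),
        evalAt ((P j).sec (b j) (x j)) ((evalAt ((P j).sec (a j) (x j))).symm (ξ j).2)))
      (U := (Set.univ.pi fun j => (P j).dom (a j)) ∩ Set.univ.pi fun j => (P j).dom (b j))
      (fun j => ((smoothOn_transition (a j) (b j) (ξ j).1).comp_eval j
          fun x hx => ⟨hx.1 j trivial, hx.2 j trivial⟩).prodMk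
        ((smoothOn_transition (a j) (b j) (ξ j).2).comp_eval j
          fun x hx => ⟨hx.1 j trivial, hx.2 j trivial⟩))
    refine (h.linear ((LinearMap.lsmul ℂ _ r).restrictScalars ℝ)).congr fun x _ => ?_
    rw [map_smul, PiTensorProduct.map_tprod]
    rfl
  | add v v' hv hv' =>
    simp only [map_add]
    exact hv.add hv'

variable (P)

/-- The bundle `S` over the product manifold, constructed from the spinor bundles of the factors. -/
def productSpinorBundle :
    ComplexBundle.{u, w', max w v, v} (ModelWithCorners.pi I) (∀ j, M j) where
  fiber x := productFiber P Δ T x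
  model := stdFiber Δ T
  Index := ∀ j, (P j).Index
  dom a := Set.univ.pi fun j => (P j).dom (a j)
  isOpen_dom a := isOpen_set_pi Set.finite_univ fun j _ => (P j).isOpen_dom (a j)
  cover x := ⟨fun j => ((P j).cover (x j)).choose, fun j _ => ((P j).cover (x j)).choose_spec⟩
  triv a x := productEval Δ T fun j => (P j).sec (a j) (x j)
  smooth_transition a b v := smoothOn_productEval (P := P) Δ T a b v

end ProductSpinors

end SpinProduct

end

/-!
Vectors of different factors `Mᵢ` have to anticommute, and this is arranged as in the
Jordan–Wigner transformation: the action of `Xᵢ` on `Sᵢ ⊕ Sᵢ` is accompanied by a string of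
commuting involutions on the other factors. The gradings `(a, b) ↦ (a, -b)` used in the Clifford
multiplication of `W` do not preserve the diagonal of a factor in `T`, so strings skip these
factors. The lost sign is regained by an operator `(a, b) ↦ (-i b, i a)` at the end of the string,
which anticommutes with the grading and with the Clifford multiplication of its factor. For
`i ∈ T` the string ends at an odd-dimensional factor outside `T`, where `S⁺ = S⁻`, and different
`i ∈ T` have different ends; as there may be one factor in `T` too many, one string may run
through all factors without an end. In this way `Ŝ` becomes a `Cl(D)`-module.

A product of two vectors of the same factor cancels the strings, so on the product of the spin
groups the module structure is the tensor product of the actions on the `Δᵢ`, whatever the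
strings.

Averaging linear maps over the finite group generated by the `eₖ`, with traces computed on the
monomials in the `eₖ`, shows that an irreducible module has dimension `2 ^ [D / 2]` and that a
module of this dimension is isomorphic to it, possibly up to `eₖ ↦ -eₖ` if `D` is odd. This
applies to `Ŝ`, and the isomorphism `L` it gives is equivariant under the product of the spin
groups, since their elements are even; hence `L` induces an isomorphism of bundles. If `T`
contains at most the last index, and its string has no end, the strings are the signs in the
Clifford multiplication of `W`, and the isomorphism is compatible with Clifford multiplication up
to the sign `ε`.
-/

noncomputable section

namespace SpinProduct

section Schur

variable {K : Type*} [Field K] {R A B : Type*} [AddCommGroup A] [Module K A] [AddCommGroup B]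
  [Module K B]

/-- A family of operators is irreducible if its space is nonzero and has no invariant subspaces
other than zero and the whole space. -/
structure IsIrreducible (α : R → Module.End K A) : Prop where
  nontrivial : Nontrivial A
  eq_bot_or_eq_top : ∀ V : Submodule K A, (∀ r, ∀ s ∈ V, α r s ∈ V) → V = ⊥ ∨ V = ⊤

lemma SpinorModule.isIrreducible {κ : Type} [Fintype κ] (Δ : SpinorModule.{v} κ) :
    IsIrreducible Δ.c :=
  ⟨Δ.nontrivial, Δ.irreducible⟩

lemma IsIrreducible.comp_surjective {S : Type*} {α : R → Module.End K A} (hα : IsIrreducible α)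
    {σ : S → R} (hσ : Function.Surjective σ) : IsIrreducible (α ∘ σ) :=
  ⟨hα.nontrivial, fun V hV => hα.eq_bot_or_eq_top V (hσ.forall.2 hV)⟩

lemma IsIrreducible.exists_linearEquiv {α : R → Module.End K A} {β : R → Module.End K B}
    [FiniteDimensional K A] [FiniteDimensional K B] (hβ : IsIrreducible β)
    (hd : Module.finrank K A = Module.finrank K B) {F : A →ₗ[K] B} (hF : F ≠ 0)
    (h : ∀ r x, F (α r x) = β r (F x)) :
    ∃ L : A ≃ₗ[K] B, ∀ r x, L (α r x) = β r (L x) := by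
  have hinv : ∀ r, ∀ s ∈ LinearMap.range F, β r s ∈ LinearMap.range F := by
    rintro r _ ⟨x, rfl⟩
    exact ⟨α r x, h r x⟩
  have hsurj : Function.Surjective F :=
    LinearMap.range_eq_top.1 <|
      (hβ.eq_bot_or_eq_top _ hinv).resolve_left (mt LinearMap.range_eq_bot.1 hF)
  have hinj : Function.Injective F :=
    (LinearMap.injective_iff_surjective_of_finrank_eq_finrank hd).2 hsurj
  exact ⟨LinearEquiv.ofBijective F ⟨hinj, hsurj⟩, h⟩

lemma IsIrreducible.exists_eq_smul_one [IsAlgClosed K] [FiniteDimensional K A]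
    {α : R → Module.End K A} (hα : IsIrreducible α) {F : Module.End K A}
    (hF : ∀ r x, F (α r x) = α r (F x)) : ∃ c : K, F = c • 1 := by
  have := hα.nontrivial
  obtain ⟨c, hc⟩ := Module.End.exists_eigenvalue F
  have hinv : ∀ r, ∀ s ∈ F.eigenspace c, α r s ∈ F.eigenspace c := by
    intro r s hs
    rw [Module.End.mem_eigenspace_iff] at hs ⊢
    rw [hF, hs, map_smul]
  have htop := (hα.eq_bot_or_eq_top _ hinv).resolve_left hc
  refine ⟨c, LinearMap.ext fun x => ?_⟩
  exact Module.End.mem_eigenspace_iff.1 (htop ▸ Submodule.mem_top)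

end Schur

section Monomials

variable {κ : Type} [Fintype κ] [DecidableEq κ]

/-- The generator `e_k` of the Clifford algebra. -/
def gen (k : κ) : Cl κ := ι (stdForm κ) (Pi.single k 1)

lemma gen_mul_self (k : κ) : gen k * gen k = -1 := by
  simp [gen, stdForm_apply, Pi.single_apply]

lemma gen_anticomm {k l : κ} (h : k ≠ l) : gen k * gen l = -(gen l * gen k) :=
  single_anticomm h

lemma star_gen (k : κ) : star (gen k) = -gen k := star_ι _

lemma isUnit_gen (k : κ) : IsUnit (gen k) :=
  ⟨⟨gen k, -gen k, by simp [gen_mul_self], by simp [gen_mul_self]⟩, rfl⟩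

lemma ι_eq_sum_gen (v : κ → ℝ) : ι (stdForm κ) v = ∑ k, v k • gen k := by
  conv_lhs => rw [pi_eq_sum_univ' v]
  simp only [map_sum, map_smul, gen]

/-- The monomial `e_{k₁} ⋯ e_{k_r}` in the generators of the Clifford algebra. -/
def monomial (m : List κ) : Cl κ := (m.map gen).prod

lemma vol_eq_monomial (D : ℕ) : vol D = monomial (List.finRange D) := rfl

lemma monomial_cons (k : κ) (m : List κ) : monomial (k :: m) = gen k * monomial m :=
  List.prod_cons

lemma isUnit_monomial (m : List κ) : IsUnit (monomial m) :=
  List.prod_isUnit fun x hx => by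
    obtain ⟨k, -, rfl⟩ := List.mem_map.1 hx
    exact isUnit_gen k

lemma involute_monomial (m : List κ) :
    involute (monomial m) = (-1 : ℝ) ^ m.length • monomial m := by
  induction m with
  | nil => simp [monomial]
  | cons j m ih => simp [monomial_cons, gen, ih, pow_succ]

lemma gen_mul_monomial_of_notMem {k : κ} {m : List κ} (hk : k ∉ m) :
    gen k * monomial m = (-1 : ℝ) ^ m.length • (monomial m * gen k) := by
  induction m with
  | nil => simp [monomial]
  | cons j m ih =>
    obtain ⟨hkj, hkm⟩ := not_or.1 (mt List.mem_cons.2 hk)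
    rw [monomial_cons, ← mul_assoc, gen_anticomm hkj, neg_mul, mul_assoc, ih hkm]
    simp [pow_succ, mul_assoc]

lemma gen_mul_monomial_of_mem {k : κ} {m : List κ} (hm : m.Nodup) (hk : k ∈ m) :
    gen k * monomial m = (-1 : ℝ) ^ (m.length - 1) • (monomial m * gen k) := by
  induction m with
  | nil => simp at hk
  | cons j m ih =>
    obtain ⟨hjm, hm⟩ := List.nodup_cons.1 hm
    rcases List.mem_cons.1 hk with rfl | hkm
    · rw [monomial_cons, mul_assoc, ← mul_smul_comm, List.length_cons, Nat.add_sub_cancel,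
        ← gen_mul_monomial_of_notMem hjm]
    · have hkj : k ≠ j := fun e => hjm (e ▸ hkm)
      obtain ⟨n, hn⟩ := Nat.exists_eq_add_one.2 (List.length_pos_of_mem hkm)
      rw [monomial_cons, ← mul_assoc, gen_anticomm hkj, neg_mul, mul_assoc, ih hm hkm]
      simp [hn, pow_succ, mul_assoc]

lemma monomial_mul_self {m : List κ} (hm : m.Nodup) :
    monomial m * monomial m = (-1 : Cl κ) ^ (m.length + 1).choose 2 := by
  induction m with
  | nil => simp [monomial]
  | cons j m ih =>
    obtain ⟨hjm, hm⟩ := List.nodup_cons.1 hm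
    have h : monomial m * gen j = (-1 : ℝ) ^ m.length • (gen j * monomial m) := by
      rw [gen_mul_monomial_of_notMem hjm, smul_smul, ← mul_pow]
      simp
    calc monomial (j :: m) * monomial (j :: m)
        = gen j * (monomial m * gen j) * monomial m := by simp only [monomial_cons, mul_assoc]
      _ = (-1 : ℝ) ^ m.length • (gen j * gen j * (monomial m * monomial m)) := by
        simp only [h, mul_smul_comm, smul_mul_assoc, mul_assoc]
      _ = (-1 : Cl κ) ^ ((j :: m).length + 1).choose 2 := by
        rw [gen_mul_self, ih hm, List.length_cons, Nat.choose_succ_succ' (m.length + 1),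
          Nat.choose_one_right, pow_add, pow_succ, Algebra.smul_def]
        simp

lemma vol_mul_vol {D : ℕ} (hD : Even D) : vol D * vol D = (-1 : Cl (Fin D)) ^ (D / 2) := by
  obtain ⟨r, rfl⟩ := hD.two_dvd
  have hchoose : (2 * r + 1).choose 2 = (2 * r + 1) * r := by
    rw [Nat.choose_two_right, Nat.add_sub_cancel, mul_left_comm, Nat.mul_div_cancel_left _ two_pos]
  rw [vol_eq_monomial, monomial_mul_self (List.nodup_finRange _), List.length_finRange, hchoose,
    pow_mul, Odd.neg_one_pow ⟨r, rfl⟩, Nat.mul_div_cancel_left _ two_pos]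

lemma commute_monomial_univ (hκ : Odd (Fintype.card κ)) (z : Cl κ) :
    Commute z (monomial Finset.univ.toList) := by
  induction z using CliffordAlgebra.induction with
  | algebraMap r => exact Algebra.commutes r _
  | ι v =>
    rw [ι_eq_sum_gen]
    refine Commute.sum_left _ _ _ fun k _ => Commute.smul_left ?_ _
    have h := gen_mul_monomial_of_mem (Finset.nodup_toList Finset.univ)
      (Finset.mem_toList.2 (Finset.mem_univ k))
    rwa [Finset.length_toList, Finset.card_univ, (hκ.tsub_odd odd_one).neg_one_pow, one_smul] at h
  | mul a b ha hb => exact ha.mul_left hb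
  | add a b ha hb => exact ha.add_left hb

end Monomials

section Averaging

section Field

variable {K : Type*} [Field K] {A B : Type*} [AddCommGroup A] [Module K A] [AddCommGroup B]
  [Module K B]

/-- The operator `f ↦ Y ∘ f ∘ X` on the space of linear maps. -/
def sandwich (X : Module.End K A) (Y : Module.End K B) : Module.End K (A →ₗ[K] B) :=
  LinearMap.compRight K Y ∘ₗ LinearMap.lcomp K B X

lemma trace_sandwich [FiniteDimensional K A] [FiniteDimensional K B] (X : Module.End K A)
    (Y : Module.End K B) :
    LinearMap.trace K _ (sandwich X Y) = LinearMap.trace K A X * LinearMap.trace K B Y := by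
  have h : sandwich X Y =
      (dualTensorHomEquiv K A B).conj (TensorProduct.map (Module.Dual.transpose (R := K) X) Y) := by
    rw [LinearEquiv.conj_apply, LinearEquiv.eq_comp_toLinearMap_symm]
    ext
    simp [sandwich, Module.Dual.transpose_apply]
  rw [h, LinearMap.trace_conj' (R := K) (M := Module.Dual K A ⊗[K] B) (N := A →ₗ[K] B),
    LinearMap.trace_tensorProduct', LinearMap.trace_transpose']

lemma trace_eq_zero_of_anticommute [CharZero K] {X Y : Module.End K A} (hY : IsUnit Y)
    (h : Y * X = -(X * Y)) : LinearMap.trace K A X = 0 := by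
  obtain ⟨u, rfl⟩ := hY
  have hconj := LinearMap.trace_conj K X u
  rw [h, neg_mul, mul_assoc, Units.mul_inv, mul_one, map_neg] at hconj
  exact neg_eq_self.1 hconj

end Field

variable {κ : Type} [Fintype κ] {A : Type v} [AddCommGroup A] [Module ℂ A] {B : Type v'}
  [AddCommGroup B] [Module ℂ B]

/-- The action `f ↦ β z ∘ f ∘ α (star z)` of the multiplicative monoid of the Clifford algebra on
the linear maps from one representation to another. As `star e_k` is the inverse of `e_k`, the
intertwiners are the linear maps fixed by the generators. -/
def conjRep (α : Cl κ →ₐ[ℝ] Module.End ℂ A) (β : Cl κ →ₐ[ℝ] Module.End ℂ B) :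
    Cl κ →* Module.End ℂ (A →ₗ[ℂ] B) where
  toFun z := sandwich (α (star z)) (β z)
  map_one' := by ext; simp [sandwich]
  map_mul' y z := by ext; simp [sandwich]

variable (α : Cl κ →ₐ[ℝ] Module.End ℂ A) (β : Cl κ →ₐ[ℝ] Module.End ℂ B)

lemma conjRep_apply (z : Cl κ) (f : A →ₗ[ℂ] B) : conjRep α β z f = β z ∘ₗ f ∘ₗ α (star z) := rfl

lemma conjRep_neg (z : Cl κ) : conjRep α β (-z) = conjRep α β z := by
  ext
  simp [conjRep_apply]

variable [DecidableEq κ]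

lemma commute_conjRep_gen (k l : κ) : Commute (conjRep α β (gen k)) (conjRep α β (gen l)) := by
  rcases eq_or_ne k l with rfl | h
  · rfl
  · rw [Commute, SemiconjBy, ← map_mul, gen_anticomm h, conjRep_neg, map_mul]

lemma conjRep_gen_mul_self (k : κ) : conjRep α β (gen k) * conjRep α β (gen k) = 1 := by
  rw [← map_mul, gen_mul_self, conjRep_neg, map_one]

/-- The sum of the conjugates of a linear map by the submonomials of the monomial given by a list,
in the factorized form `∏ (1 + conjugation by e_k)`. -/
def average (l : List κ) : Module.End ℂ (A →ₗ[ℂ] B) :=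
  (l.map fun k => 1 + conjRep α β (gen k)).prod

lemma average_cons (k : κ) (l : List κ) :
    average α β (k :: l) = (1 + conjRep α β (gen k)) * average α β l :=
  List.prod_cons

lemma conjRep_gen_mul_average {k : κ} {l : List κ} (hk : k ∈ l) :
    conjRep α β (gen k) * average α β l = average α β l := by
  induction l with
  | nil => simp at hk
  | cons j l ih =>
    rcases List.mem_cons.1 hk with rfl | hkl
    · rw [average_cons, ← mul_assoc, mul_add, mul_one, conjRep_gen_mul_self, add_comm]
    · have hcomm := (Commute.one_right _).add_right (commute_conjRep_gen α β k j)
      rw [average_cons, ← mul_assoc, hcomm.eq, mul_assoc, ih hkl]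

lemma map_gen_average (k : κ) (f : A →ₗ[ℂ] B) (x : A) :
    β (gen k) (average α β Finset.univ.toList f x) =
      average α β Finset.univ.toList f (α (gen k) x) := by
  have h := conjRep_gen_mul_average α β (Finset.mem_toList.2 (Finset.mem_univ k))
  have hx := LinearMap.congr_fun (LinearMap.congr_fun h f) (α (gen k) x)
  have hsq : α (gen k) (α (gen k) x) = -x := by
    rw [← Module.End.mul_apply, ← map_mul, gen_mul_self, map_neg, map_one]
    rfl
  simpa [conjRep_apply, star_gen, hsq] using hx

lemma average_map (f : A →ₗ[ℂ] B) (z : Cl κ) (x : A) :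
    average α β Finset.univ.toList f (α z x) = β z (average α β Finset.univ.toList f x) := by
  induction z using CliffordAlgebra.induction generalizing x with
  | algebraMap r => simp [Module.algebraMap_end_apply, ← Complex.coe_smul]
  | ι v => simp [ι_eq_sum_gen, map_gen_average, ← Complex.coe_smul]
  | mul a b ha hb => rw [map_mul, map_mul, Module.End.mul_apply, Module.End.mul_apply, ha, hb]
  | add a b ha hb =>
    rw [map_add, map_add, LinearMap.add_apply, LinearMap.add_apply, map_add, ha, hb]

lemma average_eq_sum (l : List κ) :
    average α β l = (l.sublists'.map fun m => conjRep α β (monomial m)).sum := by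
  induction l with
  | nil => simp [average, monomial]
  | cons k l ih =>
    rw [average_cons, add_mul, one_mul, ih, List.sublists'_cons, List.map_append, List.sum_append,
      List.map_map, ← List.sum_map_mul_left]
    simp only [Function.comp_def, monomial_cons, map_mul]

lemma trace_average_self (l : List κ) (f : Module.End ℂ A) :
    LinearMap.trace ℂ A (average α α l f) = 2 ^ l.length * LinearMap.trace ℂ A f := by
  induction l with
  | nil => simp [average]
  | cons k l ih =>
    have hconj : LinearMap.trace ℂ A (conjRep α α (gen k) (average α α l f)) =
        LinearMap.trace ℂ A (average α α l f) := by
      rw [conjRep_apply, ← Module.End.mul_eq_comp, ← Module.End.mul_eq_comp,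
        LinearMap.trace_mul_comm, mul_assoc, ← map_mul, star_gen, neg_mul, gen_mul_self, neg_neg,
        map_one, mul_one]
    rw [average_cons, Module.End.mul_apply, LinearMap.add_apply, Module.End.one_apply, map_add,
      hconj, ih, List.length_cons]
    ring

lemma trace_map_eq_zero_of_anticommute {z : Cl κ} {k : κ} (h : gen k * z = -(z * gen k)) :
    LinearMap.trace ℂ B (β z) = 0 :=
  trace_eq_zero_of_anticommute ((isUnit_gen k).map β) (by simp only [← map_mul, ← map_neg, h])

lemma trace_monomial_eq_zero_of_even {m : List κ} (hm : m.Nodup) (h0 : m ≠ [])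
    (he : Even m.length) : LinearMap.trace ℂ B (β (monomial m)) = 0 := by
  obtain ⟨k, hk⟩ := List.exists_mem_of_ne_nil m h0
  have hodd : Odd (m.length - 1) := Nat.Even.sub_odd (List.length_pos_iff.2 h0) he odd_one
  exact trace_map_eq_zero_of_anticommute β <| by
    rw [gen_mul_monomial_of_mem hm hk, hodd.neg_one_pow, neg_one_smul]

lemma trace_monomial_eq_zero_of_odd {m : List κ} (ho : Odd m.length) {k : κ} (hk : k ∉ m) :
    LinearMap.trace ℂ B (β (monomial m)) = 0 :=
  trace_map_eq_zero_of_anticommute β <| by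
    rw [gen_mul_monomial_of_notMem hk, ho.neg_one_pow, neg_one_smul]

lemma sum_sublists'_eq_nil {M : Type*} [AddCommMonoid M] {ι : Type*} {l : List ι} {φ : List ι → M}
    (hφ : ∀ m, m.Sublist l → m ≠ [] → φ m = 0) : (l.sublists'.map φ).sum = φ [] := by
  induction l with
  | nil => simp
  | cons k l ih =>
    have hk : (l.sublists'.map (φ ∘ List.cons k)).sum = 0 := by
      refine List.sum_eq_zero fun y hy => ?_
      obtain ⟨m, hm, rfl⟩ := List.mem_map.1 hy
      exact hφ _ ((List.mem_sublists'.1 hm).cons_cons k) (List.cons_ne_nil k m)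
    rw [List.sublists'_cons, List.map_append, List.sum_append, List.map_map, hk, add_zero,
      ih fun m hm => hφ m (hm.cons k)]

variable [FiniteDimensional ℂ A] [FiniteDimensional ℂ B]

lemma trace_average (l : List κ) :
    LinearMap.trace ℂ _ (average α β l) = (l.sublists'.map fun m =>
      LinearMap.trace ℂ A (α (star (monomial m))) * LinearMap.trace ℂ B (β (monomial m))).sum := by
  rw [average_eq_sum, map_list_sum, List.map_map]
  exact congrArg List.sum (List.map_congr_left fun m _ => trace_sandwich _ _)

lemma trace_average_of_even (hκ : Even (Fintype.card κ)) :
    LinearMap.trace ℂ _ (average α β Finset.univ.toList) =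
      Module.finrank ℂ A * Module.finrank ℂ B := by
  rw [trace_average, sum_sublists'_eq_nil fun m hsub h0 => ?_]
  · simp [monomial, LinearMap.trace_one]
  · have hm : m.Nodup := (Finset.nodup_toList _).sublist hsub
    rcases Nat.even_or_odd m.length with he | ho
    · rw [trace_monomial_eq_zero_of_even β hm h0 he, mul_zero]
    · obtain ⟨k, hk⟩ : ∃ k, k ∉ m := by
        by_contra! hall
        have hlen := List.toFinset_card_of_nodup hm
        rw [Finset.eq_univ_iff_forall.2 fun k => List.mem_toFinset.2 (hall k)] at hlen
        exact Nat.not_even_iff_odd.2 ho (hlen ▸ hκ)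
      rw [trace_monomial_eq_zero_of_odd β ho hk, mul_zero]

-- Only the unit monomial survives in the sum: the involution changes the sign of the odd monomials,
-- and the even ones other than the unit have no trace.
lemma trace_average_add_trace_average_involute :
    LinearMap.trace ℂ _ (average α β (Finset.univ : Finset κ).toList) +
        LinearMap.trace ℂ _ (average α (β.comp involute) (Finset.univ : Finset κ).toList) =
      2 * (Module.finrank ℂ A * Module.finrank ℂ B) := by
  rw [trace_average, trace_average, ← List.sum_map_add, sum_sublists'_eq_nil fun m hsub h0 => ?_]
  · simp [monomial, LinearMap.trace_one, two_mul]
  · have hm : m.Nodup := (Finset.nodup_toList _).sublist hsub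
    rw [AlgHom.comp_apply, involute_monomial]
    rcases Nat.even_or_odd m.length with he | ho
    · rw [he.neg_one_pow, one_smul, trace_monomial_eq_zero_of_even β hm h0 he, mul_zero, add_zero]
    · rw [ho.neg_one_pow, neg_one_smul, map_neg, map_neg, mul_neg, add_neg_cancel]

end Averaging

section Uniqueness

variable {κ : Type} [Fintype κ] [DecidableEq κ] {A : Type v} [AddCommGroup A] [Module ℂ A]
  {B : Type v'} [AddCommGroup B] [Module ℂ B] [FiniteDimensional ℂ A] [FiniteDimensional ℂ B]
  {α : Cl κ →ₐ[ℝ] Module.End ℂ A} {β : Cl κ →ₐ[ℝ] Module.End ℂ B}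

lemma exists_linearEquiv_of_average_ne_zero (hβ : IsIrreducible β)
    (hd : Module.finrank ℂ A = Module.finrank ℂ B)
    (h : LinearMap.trace ℂ _ (average α β (Finset.univ : Finset κ).toList) ≠ 0) :
    ∃ L : A ≃ₗ[ℂ] B, ∀ z x, L (α z x) = β z (L x) := by
  have hne : average α β (Finset.univ : Finset κ).toList ≠ 0 := fun h0 => h (by rw [h0, map_zero])
  obtain ⟨f, hf⟩ := DFunLike.exists_ne hne
  exact hβ.exists_linearEquiv hd hf (average_map α β f)

omit [DecidableEq κ] in
theorem exists_linearEquiv_or_involute (hβ : IsIrreducible β)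
    (hd : Module.finrank ℂ A = Module.finrank ℂ B) :
    (∃ L : A ≃ₗ[ℂ] B, ∀ z x, L (α z x) = β z (L x)) ∨
      Odd (Fintype.card κ) ∧ ∃ L : A ≃ₗ[ℂ] B, ∀ z x, L (α z x) = β (involute z) (L x) := by
  classical
  have := hβ.nontrivial
  have hB : (Module.finrank ℂ B : ℂ) ≠ 0 := Nat.cast_ne_zero.2 Module.finrank_pos.ne'
  by_cases h : LinearMap.trace ℂ _ (average α β (Finset.univ : Finset κ).toList) = 0
  · have hodd : ¬Even (Fintype.card κ) := fun he =>
      mul_ne_zero hB hB (by rw [← h, trace_average_of_even α β he, hd])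
    have hsum := trace_average_add_trace_average_involute α β
    rw [h, zero_add, hd] at hsum
    exact .inr ⟨Nat.not_even_iff_odd.1 hodd, exists_linearEquiv_of_average_ne_zero
      (β := β.comp involute) (hβ.comp_surjective involute_involutive.surjective) hd
      (hsum ▸ mul_ne_zero two_ne_zero (mul_ne_zero hB hB))⟩
  · exact .inl (exists_linearEquiv_of_average_ne_zero hβ hd h)

lemma IsIrreducible.trace_average (hα : IsIrreducible α) :
    LinearMap.trace ℂ _ (average α α (Finset.univ : Finset κ).toList) = 2 ^ Fintype.card κ := by
  have := hα.nontrivial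
  have hd : (Module.finrank ℂ A : ℂ) ≠ 0 := Nat.cast_ne_zero.2 Module.finrank_pos.ne'
  have havg : (Module.finrank ℂ A : ℂ) • average α α (Finset.univ : Finset κ).toList =
      (2 : ℂ) ^ Fintype.card κ • (LinearMap.trace ℂ A).smulRight (1 : Module.End ℂ A) := by
    refine LinearMap.ext fun f => ?_
    obtain ⟨c, hc⟩ := hα.exists_eq_smul_one (average_map α α f)
    have htr := trace_average_self α Finset.univ.toList f
    rw [hc, map_smul, LinearMap.trace_one, Finset.length_toList, Finset.card_univ,
      smul_eq_mul] at htr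
    rw [LinearMap.smul_apply, LinearMap.smul_apply, LinearMap.smulRight_apply, hc, smul_smul,
      smul_smul, ← htr, mul_comm]
  have htr := congrArg (LinearMap.trace ℂ _) havg
  rw [map_smul, map_smul, LinearMap.trace_smulRight, LinearMap.trace_one, smul_eq_mul, smul_eq_mul,
    mul_comm] at htr
  exact mul_right_cancel₀ hd htr

-- In odd dimension the volume element is central, hence a nonzero scalar, but an intertwiner
-- with the twist by the involution anticommutes with it.
lemma IsIrreducible.average_involute (hα : IsIrreducible α) (hκ : Odd (Fintype.card κ)) :
    average α (α.comp involute) (Finset.univ : Finset κ).toList = 0 := by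
  have := hα.nontrivial
  set volume : Cl κ := monomial Finset.univ.toList
  obtain ⟨c, hc⟩ := hα.exists_eq_smul_one (F := α volume) fun z x => by
    rw [← Module.End.mul_apply, ← map_mul, ← (commute_monomial_univ hκ z).eq, map_mul]
    rfl
  have hc0 : c ≠ 0 := by
    rintro rfl
    rw [zero_smul] at hc
    exact not_isUnit_zero (hc ▸ (isUnit_monomial Finset.univ.toList).map α)
  refine LinearMap.ext fun f => LinearMap.ext fun x => ?_
  have h := average_map α (α.comp involute) f volume x
  rw [AlgHom.comp_apply, involute_monomial, Finset.length_toList, Finset.card_univ, hκ.neg_one_pow,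
    neg_one_smul, map_neg, hc, LinearMap.neg_apply, LinearMap.smul_apply, LinearMap.smul_apply,
    map_smul, Module.End.one_apply, Module.End.one_apply, eq_neg_iff_add_eq_zero,
    ← add_smul] at h
  exact (smul_eq_zero.1 h).resolve_left (mt add_self_eq_zero.1 hc0)

omit [DecidableEq κ] in
theorem IsIrreducible.finrank_eq (hα : IsIrreducible α) :
    Module.finrank ℂ A = 2 ^ (Fintype.card κ / 2) := by
  classical
  have hself := hα.trace_average
  refine Nat.mul_self_inj.1 ?_
  rcases Nat.even_or_odd' (Fintype.card κ) with ⟨r, hr | hr⟩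
  · rw [trace_average_of_even α α (hr ▸ even_two_mul r)] at hself
    have hsq : Module.finrank ℂ A * Module.finrank ℂ A = 2 ^ Fintype.card κ := by
      exact_mod_cast hself
    rw [hsq, hr, Nat.mul_div_cancel_left r two_pos, two_mul, pow_add]
  · have hsum := trace_average_add_trace_average_involute α α
    rw [hself, hα.average_involute ⟨r, hr⟩, map_zero, add_zero] at hsum
    have hsq : 2 ^ Fintype.card κ = 2 * (Module.finrank ℂ A * Module.finrank ℂ A) := by
      exact_mod_cast hsum
    rw [show Fintype.card κ / 2 = r by omega, ← pow_add, ← two_mul]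
    rw [hr, pow_succ'] at hsq
    exact (Nat.eq_of_mul_eq_mul_left two_pos hsq).symm

end Uniqueness

section TensorFactors

lemma piTensorProduct_map_injective {ι K : Type*} [Field K] {G : ι → Type*} {H : ι → Type*}
    [∀ i, AddCommGroup (G i)] [∀ i, Module K (G i)] [∀ i, AddCommGroup (H i)] [∀ i, Module K (H i)]
    {f : ∀ i, G i →ₗ[K] H i} (hf : ∀ i, Function.Injective (f i)) :
    Function.Injective (PiTensorProduct.map f) := by
  choose ρ hρ using fun i =>
    (f i).exists_leftInverse_of_injective (LinearMap.ker_eq_bot.2 (hf i))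
  refine Function.LeftInverse.injective (g := PiTensorProduct.map ρ) fun t => ?_
  rw [← LinearMap.comp_apply, ← PiTensorProduct.map_comp]
  simp only [hρ, PiTensorProduct.map_id, LinearMap.id_apply]

lemma finrank_piTensorProduct {ι K : Type*} [Fintype ι] [Field K] {G : ι → Type*}
    [∀ i, AddCommGroup (G i)] [∀ i, Module K (G i)] [∀ i, FiniteDimensional K (G i)] :
    Module.finrank K (⨂[K] i, G i) = ∏ i, Module.finrank K (G i) := by
  classical
  rw [Module.finrank_eq_card_basis (Basis.piTensorProduct fun i => Module.finBasis K (G i)),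
    Fintype.card_pi]
  simp only [Fintype.card_fin]

variable {N : ℕ} {F : Fin N → Type v} [∀ i, AddCommGroup (F i)] [∀ i, Module ℂ (F i)]

/-- The factors of which `tensorSub T Fp Fm` is the tensor product: the diagonal of `F i ⊕ F i`
for `i ∈ T` and `Fp i ⊕ Fm i` otherwise. -/
def tensorFactor (T : Finset (Fin N)) (Fp Fm : ∀ i, Submodule ℂ (F i)) (i : Fin N) :
    Submodule ℂ (F i × F i) :=
  if i ∈ T then LinearMap.eqLocus (LinearMap.fst ℂ (F i) (F i)) (LinearMap.snd ℂ (F i) (F i))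
  else (Fp i).prod (Fm i)

variable {T : Finset (Fin N)} {Fp Fm : ∀ i, Submodule ℂ (F i)}

lemma mem_tensorFactor {i : Fin N} {ξ : F i × F i} :
    ξ ∈ tensorFactor T Fp Fm i ↔ if i ∈ T then ξ.1 = ξ.2 else ξ.1 ∈ Fp i ∧ ξ.2 ∈ Fm i := by
  unfold tensorFactor
  split_ifs
  · exact LinearMap.mem_eqLocus
  · exact Submodule.mem_prod

lemma tensorSub_eq_range :
    tensorSub T Fp Fm = LinearMap.range (PiTensorProduct.mapIncl (tensorFactor T Fp Fm)) := by
  rw [PiTensorProduct.mapIncl, PiTensorProduct.map_range_eq_span_tprod, tensorSub]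
  congr 1
  ext t
  constructor
  · rintro ⟨ξ, rfl, hξ⟩
    exact ⟨fun i => ⟨ξ i, mem_tensorFactor.2 (hξ i)⟩, rfl⟩
  · rintro ⟨ξ, rfl⟩
    exact ⟨fun i => (ξ i).1, rfl, fun i => mem_tensorFactor.1 (ξ i).2⟩

lemma finrank_tensorSub [∀ i, FiniteDimensional ℂ (F i)] (T : Finset (Fin N))
    (Fp Fm : ∀ i, Submodule ℂ (F i)) :
    Module.finrank ℂ (tensorSub T Fp Fm) = ∏ i, Module.finrank ℂ (tensorFactor T Fp Fm i) := by
  rw [tensorSub_eq_range, ← finrank_piTensorProduct]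
  exact LinearMap.finrank_range_of_inj
    (piTensorProduct_map_injective fun i => (tensorFactor T Fp Fm i).injective_subtype)

lemma map_mem_tensorSub {f : ∀ i, Module.End ℂ (F i × F i)}
    (hf : ∀ i, ∀ ξ ∈ tensorFactor T Fp Fm i, f i ξ ∈ tensorFactor T Fp Fm i)
    {t : ⨂[ℂ] i, F i × F i} (ht : t ∈ tensorSub T Fp Fm) :
    PiTensorProduct.map f t ∈ tensorSub T Fp Fm := by
  suffices h : tensorSub T Fp Fm ≤ (tensorSub T Fp Fm).comap (PiTensorProduct.map f) from h ht
  refine Submodule.span_le.2 ?_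
  rintro _ ⟨ξ, rfl, hξ⟩
  rw [SetLike.mem_coe, Submodule.mem_comap, PiTensorProduct.map_tprod]
  exact Submodule.subset_span ⟨_, rfl, fun i =>
    mem_tensorFactor.1 (hf i _ (mem_tensorFactor.2 (hξ i)))⟩

end TensorFactors

section SiteOperators

/-- The grading operator `(a, b) ↦ (a, -b)` of `F ⊕ F`. -/
def gradeOp (F : Type v) [AddCommGroup F] [Module ℂ F] : Module.End ℂ (F × F) :=
  LinearMap.prodMap LinearMap.id (-LinearMap.id)

/-- The operator `(a, b) ↦ (-i b, i a)` of `F ⊕ F`: an involution that anticommutes both with the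
grading and with every operator `swapOp X`. -/
def phaseOp (F : Type v) [AddCommGroup F] [Module ℂ F] : Module.End ℂ (F × F) :=
  LinearMap.prod (-Complex.I • LinearMap.snd ℂ F F) (Complex.I • LinearMap.fst ℂ F F)

/-- The odd operator `(a, b) ↦ (X b, X a)` of `F ⊕ F`. -/
def swapOp {F : Type v} [AddCommGroup F] [Module ℂ F] :
    Module.End ℂ F →ₗ[ℂ] Module.End ℂ (F × F) where
  toFun X := LinearMap.prod (X ∘ₗ LinearMap.snd ℂ F F) (X ∘ₗ LinearMap.fst ℂ F F)
  map_add' _ _ := rfl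
  map_smul' _ _ := rfl

variable {F : Type v} [AddCommGroup F] [Module ℂ F]

lemma gradeOp_apply (ξ : F × F) : gradeOp F ξ = (ξ.1, -ξ.2) := rfl

lemma phaseOp_apply (ξ : F × F) : phaseOp F ξ = (-Complex.I • ξ.2, Complex.I • ξ.1) := rfl

lemma swapOp_apply (X : Module.End ℂ F) (ξ : F × F) : swapOp X ξ = (X ξ.2, X ξ.1) := rfl

lemma gradeOp_mul_self : gradeOp F * gradeOp F = 1 :=
  LinearMap.ext fun ξ => by simp [gradeOp_apply]

lemma phaseOp_mul_self : phaseOp F * phaseOp F = 1 :=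
  LinearMap.ext fun ξ => by simp [phaseOp_apply, smul_smul]

lemma swapOp_mul_swapOp (X Y : Module.End ℂ F) :
    swapOp X * swapOp Y = LinearMap.prodMap (X * Y) (X * Y) :=
  rfl

lemma swapOp_anticomm_gradeOp (X : Module.End ℂ F) :
    swapOp X * gradeOp F + gradeOp F * swapOp X = 0 :=
  LinearMap.ext fun ξ => by simp [swapOp_apply, gradeOp_apply]

lemma swapOp_anticomm_phaseOp (X : Module.End ℂ F) :
    swapOp X * phaseOp F + phaseOp F * swapOp X = 0 :=
  LinearMap.ext fun ξ => by simp [swapOp_apply, phaseOp_apply]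

lemma phaseOp_anticomm_gradeOp : phaseOp F * gradeOp F + gradeOp F * phaseOp F = 0 :=
  LinearMap.ext fun ξ => by simp [phaseOp_apply, gradeOp_apply]

end SiteOperators

section JordanWigner

lemma map_mul_map_add_of_anticommute {ι R : Type*} [CommSemiring R] {G : ι → Type*}
    [∀ i, AddCommMonoid (G i)] [∀ i, Module R (G i)] {f g : ∀ j, Module.End R (G j)} (j₀ : ι)
    (h₀ : f j₀ * g j₀ + g j₀ * f j₀ = 0) (h : ∀ j ≠ j₀, f j * g j = g j * f j) :
    (PiTensorProduct.map f * PiTensorProduct.map g + PiTensorProduct.map g * PiTensorProduct.map f :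
      Module.End R (⨂[R] i, G i)) = 0 := by
  classical
  have hfg : (fun j => f j * g j) = Function.update (fun j => g j * f j) j₀ (f j₀ * g j₀) :=
    (Function.update_eq_iff.2 ⟨rfl, fun j hj => (h j hj).symm⟩).symm
  have hgf : (fun j => g j * f j) = Function.update (fun j => g j * f j) j₀ (g j₀ * f j₀) :=
    (Function.update_eq_self j₀ _).symm
  rw [← PiTensorProduct.map_mul, ← PiTensorProduct.map_mul, hfg, hgf, Function.update_idem,
    ← PiTensorProduct.map_update_add, h₀]
  exact (PiTensorProduct.mapMultilinear R G G).map_update_zero _ j₀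

lemma sum_mul_self_of_anticommute {R ι : Type*} [Semiring R] (s : Finset ι) {a : ι → R}
    (h : ∀ i k, i ≠ k → a i * a k + a k * a i = 0) :
    (∑ i ∈ s, a i) * ∑ i ∈ s, a i = ∑ i ∈ s, a i * a i := by
  classical
  induction s using Finset.induction_on with
  | empty => simp only [Finset.sum_empty, mul_zero]
  | insert i s hi ih =>
    have hcross : a i * ∑ k ∈ s, a k + (∑ k ∈ s, a k) * a i = 0 := by
      rw [Finset.mul_sum, Finset.sum_mul, ← Finset.sum_add_distrib]
      exact Finset.sum_eq_zero fun k hk => h i k (ne_of_mem_of_not_mem hk hi).symm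
    rw [Finset.sum_insert hi, Finset.sum_insert hi, add_mul, mul_add, mul_add, ih, ← add_assoc,
      add_assoc (a i * a i), hcross, add_zero]

variable {ι : Type*} [LinearOrder ι] (F : ι → Type v) [∀ i, AddCommGroup (F i)]
  [∀ i, Module ℂ (F i)] (T : Finset ι) (r : ι → WithTop ι)

/-- The operator on the `j`-th factor of a Jordan–Wigner string ending at `s`: the grading before
`s` and the phase operator at `s`, with the sites of `T` left out. A string with `s = ⊤` runs
through all sites and has no phase operator. -/
def siteOp (s : WithTop ι) (j : ι) : Module.End ℂ (F j × F j) :=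
  if j ∈ T then 1 else if (j : WithTop ι) < s then gradeOp (F j)
  else if (j : WithTop ι) = s then phaseOp (F j) else 1

/-- The condition on the ends `r i` of the strings under which the operators
`twistedTerm T r i X` anticommute for different `i`: the string of `i ∉ T` ends at `i` itself, and
the strings of the elements of `T` have distinct ends, none of them in `T`. -/
structure IsJordanWigner : Prop where
  of_notMem : ∀ i ∉ T, r i = i
  injOn : Set.InjOn r T
  notMem : ∀ i ∈ T, ∀ j : ι, r i = j → j ∉ T

variable {F}

/-- The action of `X` on the `i`-th factor of `⨂ i, F i ⊕ F i`, twisted on the other factors by the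
Jordan–Wigner string ending at `r i`. -/
def twistedTerm (i : ι) (X : Module.End ℂ (F i)) : Module.End ℂ (⨂[ℂ] i, F i × F i) :=
  PiTensorProduct.map (Function.update (siteOp F T (r i)) i (swapOp X))

variable {T r}

lemma siteOp_of_mem (s : WithTop ι) {j : ι} (hj : j ∈ T) : siteOp F T s j = 1 := if_pos hj

lemma siteOp_of_lt {s : WithTop ι} {j : ι} (hj : j ∉ T) (h : j < s) :
    siteOp F T s j = gradeOp (F j) := by
  rw [siteOp, if_neg hj, if_pos h]

lemma siteOp_coe_self {j : ι} (hj : j ∉ T) : siteOp F T j j = phaseOp (F j) := by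
  rw [siteOp, if_neg hj, if_neg (lt_irrefl _), if_pos rfl]

lemma siteOp_of_gt {s : WithTop ι} {j : ι} (h : s < j) : siteOp F T s j = 1 := by
  rw [siteOp, if_neg h.not_gt, if_neg h.ne', ite_self]

lemma siteOp_mul_self (s : WithTop ι) (j : ι) : siteOp F T s j * siteOp F T s j = 1 := by
  unfold siteOp
  split_ifs <;> simp only [mul_one, gradeOp_mul_self, phaseOp_mul_self]

lemma siteOp_commute {s t : WithTop ι} (hst : s ≤ t) {j : ι} (hj : (j : WithTop ι) ≠ s) :
    siteOp F T s j * siteOp F T t j = siteOp F T t j * siteOp F T s j := by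
  by_cases hT : j ∈ T
  · rw [siteOp_of_mem s hT, siteOp_of_mem t hT]
  · rcases lt_or_gt_of_ne hj with h | h
    · rw [siteOp_of_lt hT h, siteOp_of_lt hT (h.trans_le hst)]
    · rw [siteOp_of_gt h, mul_one, one_mul]

lemma swapOp_anticomm_siteOp {s : WithTop ι} {j : ι} (hj : j ∉ T) (h : j ≤ s)
    (X : Module.End ℂ (F j)) : swapOp X * siteOp F T s j + siteOp F T s j * swapOp X = 0 := by
  rcases h.lt_or_eq with h | rfl
  · rw [siteOp_of_lt hj h, swapOp_anticomm_gradeOp]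
  · rw [siteOp_coe_self hj, swapOp_anticomm_phaseOp]

namespace IsJordanWigner

variable (hr : IsJordanWigner T r)
include hr

lemma siteOp_eq_one {i k : ι} (hle : r i ≤ r k) (hk : r i ≠ k) : siteOp F T (r i) k = 1 := by
  by_cases hkT : k ∈ T
  · exact siteOp_of_mem _ hkT
  · exact siteOp_of_gt ((hr.of_notMem k hkT ▸ hle).lt_of_ne hk)

lemma twistedTerm_anticomm_of_notMem {i k : ι} (hik : i ≠ k) (hi : i ∉ T) (hle : r i ≤ r k)
    (X : Module.End ℂ (F i)) (Y : Module.End ℂ (F k)) :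
    twistedTerm T r i X * twistedTerm T r k Y + twistedTerm T r k Y * twistedTerm T r i X = 0 := by
  have hri := hr.of_notMem i hi
  refine map_mul_map_add_of_anticommute i ?_ fun j hji => ?_
  · rw [Function.update_self, Function.update_of_ne hik]
    exact swapOp_anticomm_siteOp hi (hri ▸ hle) X
  · have hj : (j : WithTop ι) ≠ r i := fun e => hji (WithTop.coe_injective (e.trans hri))
    rw [Function.update_of_ne hji]
    rcases eq_or_ne j k with rfl | hjk
    · rw [hr.siteOp_eq_one hle hj.symm, mul_one, one_mul]
    · rw [Function.update_of_ne hjk, siteOp_commute hle hj]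

lemma twistedTerm_anticomm_of_mem {i k : ι} (hi : i ∈ T) (hlt : r i < r k)
    (X : Module.End ℂ (F i)) (Y : Module.End ℂ (F k)) :
    twistedTerm T r i X * twistedTerm T r k Y + twistedTerm T r k Y * twistedTerm T r i X = 0 := by
  have hik : i ≠ k := fun e => hlt.ne (congrArg r e)
  obtain ⟨j₀, hj₀⟩ : ∃ j₀ : ι, r i = j₀ := ⟨_, (WithTop.coe_untop _ hlt.ne_top).symm⟩
  have hj₀T : j₀ ∉ T := hr.notMem i hi j₀ hj₀
  have hj₀i : j₀ ≠ i := fun e => hj₀T (e ▸ hi)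
  have hj₀k : j₀ ≠ k := fun e => hlt.ne (by rw [hj₀, ← e, hr.of_notMem j₀ hj₀T])
  refine map_mul_map_add_of_anticommute j₀ ?_ fun j hj => ?_
  · have hlt' : (j₀ : WithTop ι) < r k := hj₀ ▸ hlt
    rw [Function.update_of_ne hj₀k, Function.update_of_ne hj₀i, siteOp_of_lt hj₀T hlt', hj₀,
      siteOp_coe_self hj₀T]
    exact phaseOp_anticomm_gradeOp
  · have hj' : (j : WithTop ι) ≠ r i := fun e => hj (WithTop.coe_injective (e.trans hj₀))
    rcases eq_or_ne j i with rfl | hji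
    · rw [Function.update_of_ne hik, siteOp_of_mem _ hi, mul_one, one_mul]
    rcases eq_or_ne j k with rfl | hjk
    · rw [Function.update_of_ne hji, hr.siteOp_eq_one hlt.le hj'.symm, mul_one, one_mul]
    · rw [Function.update_of_ne hji, Function.update_of_ne hjk, siteOp_commute hlt.le hj']

lemma twistedTerm_anticomm {i k : ι} (hik : i ≠ k) (X : Module.End ℂ (F i))
    (Y : Module.End ℂ (F k)) :
    twistedTerm T r i X * twistedTerm T r k Y + twistedTerm T r k Y * twistedTerm T r i X = 0 := by
  wlog hle : r i ≤ r k ∧ (i ∈ T → r i < r k) generalizing i k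
  · refine (add_comm _ _).trans (this hik.symm Y X ?_)
    by_cases h : r i ≤ r k
    · have hi : i ∈ T := by tauto
      have heq : r i = r k := by_contra fun hne => hle ⟨h, fun _ => h.lt_of_ne hne⟩
      exact ⟨heq.ge, fun hk => absurd (hr.injOn hi hk heq) hik⟩
    · exact ⟨(not_le.1 h).le, fun _ => not_le.1 h⟩
  · by_cases hi : i ∈ T
    · exact hr.twistedTerm_anticomm_of_mem hi (hle.2 hi) X Y
    · exact hr.twistedTerm_anticomm_of_notMem hik hi hle.1 X Y

end IsJordanWigner

lemma twistedTerm_mul_twistedTerm (i : ι) (X Y : Module.End ℂ (F i)) :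
    twistedTerm T r i X * twistedTerm T r i Y =
      PiTensorProduct.map (Function.update 1 i (LinearMap.prodMap (X * Y) (X * Y))) := by
  rw [twistedTerm, twistedTerm, ← PiTensorProduct.map_mul]
  congr 1
  funext j
  rcases eq_or_ne j i with rfl | h
  · simp only [Function.update_self, swapOp_mul_swapOp]
  · simp only [Function.update_of_ne h, siteOp_mul_self, Pi.one_apply]

variable (T r) in
lemma twistedTerm_add (i : ι) (X Y : Module.End ℂ (F i)) :
    twistedTerm T r i (X + Y) = twistedTerm T r i X + twistedTerm T r i Y := by
  rw [twistedTerm, map_add, PiTensorProduct.map_update_add]; rfl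

variable (T r) in
lemma twistedTerm_smul (i : ι) (c : ℂ) (X : Module.End ℂ (F i)) :
    twistedTerm T r i (c • X) = c • twistedTerm T r i X := by
  rw [twistedTerm, map_smul, PiTensorProduct.map_update_smul]; rfl

lemma map_update_prodMap_smul_one (i : ι) (c : ℂ) :
    PiTensorProduct.map (Function.update (1 : ∀ i, Module.End ℂ (F i × F i)) i
      (LinearMap.prodMap (c • 1) (c • 1))) = c • 1 := by
  have e : LinearMap.prodMap (c • 1) (c • 1) = c • (1 : Module.End ℂ (F i × F i)) := rfl
  rw [e, PiTensorProduct.map_update_smul]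
  congr 1
  exact (congrArg PiTensorProduct.map (Function.update_eq_self i _)).trans PiTensorProduct.map_one

lemma IsJordanWigner.sum_twistedTerm_mul_self [Fintype ι] (hr : IsJordanWigner T r)
    {X : ∀ i, Module.End ℂ (F i)} {q : ι → ℂ} (hX : ∀ i, X i * X i = q i • 1) :
    (∑ i, twistedTerm T r i (X i)) * ∑ i, twistedTerm T r i (X i) = (∑ i, q i) • 1 := by
  rw [sum_mul_self_of_anticommute _ fun i k hik => hr.twistedTerm_anticomm hik _ _, Finset.sum_smul]
  refine Finset.sum_congr rfl fun i _ => ?_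
  rw [twistedTerm_mul_twistedTerm, hX, map_update_prodMap_smul_one]

end JordanWigner

section StringEnds

variable {ι : Type*} [LinearOrder ι] {T : Finset ι}

lemma isJordanWigner_ite_top (hT : T.card ≤ 1) :
    IsJordanWigner T fun i => if i ∈ T then ⊤ else (i : WithTop ι) where
  of_notMem _ hi := if_neg hi
  injOn i hi k hk _ := Finset.card_le_one.1 hT i hi k hk
  notMem _ hi _ h := absurd (h.symm.trans (if_pos hi)) WithTop.coe_ne_top

lemma exists_isJordanWigner {U : Finset ι} (hTU : Disjoint T U) (hcard : T.card ≤ U.card + 1) :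
    ∃ r, IsJordanWigner T r ∧ ∀ i ∈ T, ∀ j : ι, r i = j → j ∈ U := by
  obtain ⟨f⟩ : Nonempty (T ↪ WithTop U) := by
    refine Function.Embedding.nonempty_of_card_le ?_
    rw [Fintype.card_coe]
    exact hcard.trans_eq (by rw [← Fintype.card_coe U]; exact Fintype.card_option.symm)
  let r (i : ι) : WithTop ι := if h : i ∈ T then (f ⟨i, h⟩).map Subtype.val else i
  have r_of_mem {i : ι} (hi : i ∈ T) : r i = (f ⟨i, hi⟩).map Subtype.val := dif_pos hi
  have mem_U : ∀ i ∈ T, ∀ j : ι, r i = j → j ∈ U := by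
    intro i hi j h
    rw [r_of_mem hi, WithTop.map_eq_some_iff] at h
    obtain ⟨u, -, rfl⟩ := h
    exact u.2
  refine ⟨r, ⟨fun i hi => dif_neg hi, fun i hi k hk h => ?_, fun i hi j h => ?_⟩, mem_U⟩
  · rw [r_of_mem hi, r_of_mem hk] at h
    exact congrArg Subtype.val (f.injective (WithTop.map_injective Subtype.val_injective h))
  · exact Finset.disjoint_right.1 hTU (mem_U i hi j h)

end StringEnds

section Strings

variable {N : ℕ} {F : Fin N → Type v} [∀ i, AddCommGroup (F i)] [∀ i, Module ℂ (F i)]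
  {T : Finset (Fin N)} {r : Fin N → WithTop (Fin N)}

lemma siteOp_mem_tensorFactor {Fp Fm : ∀ i, Submodule ℂ (F i)} {s : WithTop (Fin N)} {j : Fin N}
    (hs : s = j → Fp j = ⊤ ∧ Fm j = ⊤) {ξ : F j × F j}
    (hξ : ξ ∈ tensorFactor T Fp Fm j) : siteOp F T s j ξ ∈ tensorFactor T Fp Fm j := by
  rw [mem_tensorFactor] at hξ ⊢
  unfold siteOp
  split_ifs at hξ ⊢ with hT hlt heq
  · exact hξ
  · exact ⟨hξ.1, Submodule.neg_mem _ hξ.2⟩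
  · rw [(hs heq.symm).1, (hs heq.symm).2]
    exact ⟨Submodule.mem_top, Submodule.mem_top⟩
  · exact hξ

lemma swapOp_mem_tensorFactor {Fp Fm : ∀ i, Submodule ℂ (F i)} {i : Fin N}
    {X : Module.End ℂ (F i)} (hp : Set.MapsTo X (Fp i) (Fm i)) (hm : Set.MapsTo X (Fm i) (Fp i))
    {ξ : F i × F i} (hξ : ξ ∈ tensorFactor T Fp Fm i) :
    swapOp X ξ ∈ tensorFactor T Fp Fm i := by
  rw [mem_tensorFactor] at hξ ⊢
  rw [swapOp_apply]
  split_ifs at hξ ⊢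
  · exact congrArg X hξ.symm
  · exact ⟨hm hξ.2, hp hξ.1⟩

lemma IsJordanWigner.twistedTerm_mem_tensorSub {Fp Fm : ∀ i, Submodule ℂ (F i)}
    (hr : IsJordanWigner T r) (hphase : ∀ i ∈ T, ∀ j : Fin N, r i = j → Fp j = ⊤ ∧ Fm j = ⊤)
    {i : Fin N} {X : Module.End ℂ (F i)} (hp : Set.MapsTo X (Fp i) (Fm i))
    (hm : Set.MapsTo X (Fm i) (Fp i)) {t : ⨂[ℂ] i, F i × F i} (ht : t ∈ tensorSub T Fp Fm) :
    twistedTerm T r i X t ∈ tensorSub T Fp Fm := by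
  refine map_mem_tensorSub (fun j ξ hξ => ?_) ht
  rcases eq_or_ne j i with rfl | hj
  · rw [Function.update_self]
    exact swapOp_mem_tensorFactor hp hm hξ
  · rw [Function.update_of_ne hj]
    refine siteOp_mem_tensorFactor (fun h => hphase i (not_imp_comm.1 (hr.of_notMem i) ?_) j h) hξ
    exact fun e => hj (WithTop.coe_injective (h.symm.trans e))

lemma sum_twistedTerm_eq_cliffordTensor (hT : ∀ k ∈ T, ∀ j, j ≤ k)
    (hr : ∀ i, r i = if i ∈ T then ⊤ else (i : WithTop (Fin N))) (X : ∀ i, Module.End ℂ (F i)) :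
    ∑ i, twistedTerm T r i (X i) = cliffordTensor X := by
  refine Finset.sum_congr rfl fun i _ => congrArg PiTensorProduct.map (funext fun j => ?_)
  rcases eq_or_ne j i with rfl | hji
  · rw [Function.update_self, if_neg (lt_irrefl _), if_pos rfl]
    rfl
  rw [Function.update_of_ne hji, if_neg hji, hr]
  split_ifs with hi hlt hlt
  · rw [siteOp_of_lt (fun hj => hlt.not_ge (hT j hj i)) (WithTop.coe_lt_top j)]
    rfl
  · exact absurd ((hT i hi j).lt_of_ne hji) hlt
  · rw [siteOp_of_lt (fun hj => hlt.not_ge (hT j hj i)) (WithTop.coe_lt_coe.2 hlt)]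
    rfl
  · rw [siteOp_of_gt (WithTop.coe_lt_coe.2 ((not_lt.1 hlt).lt_of_ne hji.symm))]
    rfl

end Strings

section ProductRepresentation

variable {J : Type} {κ : J → Type} [∀ i, Fintype (κ i)] {F : J → Type v}
  [∀ i, AddCommGroup (F i)] [∀ i, Module ℂ (F i)]

/-- The action of the product of the spin groups on `⨂ i, F i ⊕ F i`, each group acting diagonally
on its factor. -/
def spinTensor (γ : ∀ i, Cl (κ i) →ₐ[ℝ] Module.End ℂ (F i)) :
    (∀ i, Spin (κ i)) →* Module.End ℂ (⨂[ℂ] i, F i × F i) where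
  toFun a := PiTensorProduct.map fun i => LinearMap.prodMap (γ i (a i)) (γ i (a i))
  map_one' := (congrArg PiTensorProduct.map (funext fun i => by
    rw [Pi.one_apply, OneMemClass.coe_one, map_one]
    rfl)).trans PiTensorProduct.map_one
  map_mul' a b := (congrArg PiTensorProduct.map (funext fun i => by
    rw [Pi.mul_apply, MulMemClass.coe_mul, map_mul]
    rfl)).trans (PiTensorProduct.map_mul _ _)

lemma spinTensor_apply (γ : ∀ i, Cl (κ i) →ₐ[ℝ] Module.End ℂ (F i)) (a : ∀ i, Spin (κ i)) :
    spinTensor γ a = PiTensorProduct.map fun i => LinearMap.prodMap (γ i (a i)) (γ i (a i)) :=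
  rfl

variable [Fintype J] [LinearOrder J]

/-- The action of vectors of the orthogonal sum on `⨂ i, F i ⊕ F i` in which the `i`-th component
acts by `twistedTerm T r i`. -/
def vecAction (γ : ∀ i, Cl (κ i) →ₐ[ℝ] Module.End ℂ (F i)) (T : Finset J) (r : J → WithTop J) :
    ((Σ i, κ i) → ℝ) →ₗ[ℝ] Module.End ℂ (⨂[ℂ] i, F i × F i) where
  toFun v := ∑ i, twistedTerm T r i (γ i (ι (stdForm (κ i)) fun a => v ⟨i, a⟩))
  map_add' v w := by
    simp only [← Finset.sum_add_distrib, ← twistedTerm_add, ← map_add]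
    rfl
  map_smul' c v := by
    refine Eq.trans (Finset.sum_congr rfl fun i _ => ?_) (Finset.smul_sum (r := (c : ℂ))).symm
    rw [← twistedTerm_smul, Complex.coe_smul, ← map_smul, ← map_smul]
    rfl

variable (γ : ∀ i, Cl (κ i) →ₐ[ℝ] Module.End ℂ (F i)) {T : Finset J} {r : J → WithTop J}

lemma vecAction_apply (v : (Σ i, κ i) → ℝ) :
    vecAction γ T r v = ∑ i, twistedTerm T r i (γ i (ι (stdForm (κ i)) fun a => v ⟨i, a⟩)) :=
  rfl

lemma vecAction_incl (i : J) (w : κ i → ℝ) :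
    vecAction γ T r (incl i w) = twistedTerm T r i (γ i (ι (stdForm (κ i)) w)) := by
  rw [vecAction_apply, Finset.sum_eq_single_of_mem i (Finset.mem_univ i)]
  · congr 3
    funext a
    rw [incl_apply, Pi.single_eq_same]
  · intro k _ hk
    have h0 : (fun a => incl i w ⟨k, a⟩) = (0 : κ k → ℝ) := by
      funext a
      rw [incl_apply, Pi.single_eq_of_ne hk]
    simpa only [h0, map_zero, zero_smul] using twistedTerm_smul T r k 0 (0 : Module.End ℂ (F k))

lemma vecAction_mul_self (hr : IsJordanWigner T r) (v : (Σ i, κ i) → ℝ) :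
    vecAction γ T r v * vecAction γ T r v = algebraMap ℝ _ (stdForm (Σ i, κ i) v) := by
  have hq : stdForm (Σ i, κ i) v = ∑ i, stdForm (κ i) fun a => v ⟨i, a⟩ := by
    simp only [stdForm_apply, Fintype.sum_sigma, Finset.sum_neg_distrib]
  rw [vecAction_apply, hr.sum_twistedTerm_mul_self
      (q := fun i => ((stdForm (κ i) fun a => v ⟨i, a⟩ : ℝ) : ℂ)), ← Complex.ofReal_sum, ← hq,
    Algebra.algebraMap_eq_smul_one]
  · rfl
  intro i
  rw [← map_mul, ι_sq_scalar, AlgHom.commutes, Algebra.algebraMap_eq_smul_one, Complex.coe_smul]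

/-- The representation of the Clifford algebra of the orthogonal sum on `⨂ i, F i ⊕ F i` that
extends `vecAction γ T r`. -/
def tensorRep (hr : IsJordanWigner T r) :
    Cl (Σ i, κ i) →ₐ[ℝ] Module.End ℂ (⨂[ℂ] i, F i × F i) :=
  CliffordAlgebra.lift _ ⟨vecAction γ T r, vecAction_mul_self γ hr⟩

variable (hr : IsJordanWigner T r)

lemma tensorRep_ι (v : (Σ i, κ i) → ℝ) : tensorRep γ hr (ι _ v) = vecAction γ T r v :=
  CliffordAlgebra.lift_ι_apply _ _ _

lemma tensorRep_map_incl_of_mem_even (i : J) {x : Cl (κ i)}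
    (hx : x ∈ evenOdd (stdForm (κ i)) 0) :
    tensorRep γ hr (CliffordAlgebra.map (incl i) x) =
      PiTensorProduct.map (Function.update 1 i (LinearMap.prodMap (γ i x) (γ i x))) := by
  induction x, hx using CliffordAlgebra.even_induction with
  | algebraMap c =>
    rw [AlgHom.commutes, AlgHom.commutes, AlgHom.commutes, Algebra.algebraMap_eq_smul_one,
      Algebra.algebraMap_eq_smul_one, ← Complex.coe_smul]
    exact (map_update_prodMap_smul_one i (c : ℂ)).symm
  | add x y _ _ ihx ihy =>
    rw [map_add, map_add, ihx, ihy, ← PiTensorProduct.map_update_add, map_add]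
    rfl
  | ι_mul_ι_mul v w x _ ih =>
    rw [map_mul (CliffordAlgebra.map (incl i)), map_mul (CliffordAlgebra.map (incl i)),
      map_apply_ι, map_apply_ι, map_mul (tensorRep γ hr), map_mul (tensorRep γ hr), tensorRep_ι,
      tensorRep_ι, ih, vecAction_incl, vecAction_incl, twistedTerm_mul_twistedTerm,
      ← PiTensorProduct.map_mul]
    congr 1
    funext j
    rcases eq_or_ne j i with rfl | h
    · simp only [Function.update_self, map_mul]
      rfl
    · simp only [Function.update_of_ne h, Pi.one_apply, mul_one]

lemma tensorRep_spinProd (a : ∀ i, Spin (κ i)) :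
    tensorRep γ hr (spinProd a : Spin (Σ i, κ i)) = spinTensor γ a := by
  suffices h : ((tensorRep γ hr : Cl (Σ i, κ i) →* _).comp (Spin (Σ i, κ i)).subtype).comp
      spinProd = spinTensor γ from DFunLike.congr_fun h a
  refine MonoidHom.pi_ext fun i x => ?_
  have hx : (spinProd (Pi.mulSingle i x) : Spin (Σ i, κ i)) = spinIncl i x :=
    MonoidHom.noncommPiCoprod_mulSingle (hcomm := spinIncl_commute) spinIncl i x
  rw [MonoidHom.comp_apply, hx]
  refine (tensorRep_map_incl_of_mem_even γ hr i (spinGroup.mem_even x.2)).trans ?_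
  rw [spinTensor_apply]
  congr 1
  funext j
  rcases eq_or_ne j i with rfl | h
  · rw [Function.update_self, Pi.mulSingle_eq_same]
  · rw [Function.update_of_ne h, Pi.mulSingle_eq_of_ne h, OneMemClass.coe_one, map_one]
    rfl

end ProductRepresentation

section Restriction

variable {A : Type v} [AddCommGroup A] [Module ℂ A]

lemma mem_of_forall_ι_mem {κ : Type} [Fintype κ] {ρ : Cl κ →ₐ[ℝ] Module.End ℂ A}
    {p : Submodule ℂ A} (h : ∀ v, ∀ s ∈ p, ρ (ι (stdForm κ) v) s ∈ p) (z : Cl κ) :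
    ∀ s ∈ p, ρ z s ∈ p := by
  induction z using CliffordAlgebra.induction with
  | algebraMap c =>
    intro s hs
    rw [AlgHom.commutes, Module.algebraMap_end_apply, ← Complex.coe_smul]
    exact p.smul_mem _ hs
  | ι v => exact h v
  | mul x y hx hy =>
    intro s hs
    rw [map_mul]
    exact hx _ (hy s hs)
  | add x y hx hy =>
    intro s hs
    rw [map_add]
    exact p.add_mem (hx s hs) (hy s hs)

/-- The restriction of a representation to an invariant subspace. -/
def restrictRep {R : Type*} [Ring R] [Algebra ℝ R] (ρ : R →ₐ[ℝ] Module.End ℂ A)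
    (p : Submodule ℂ A) (h : ∀ z, ∀ s ∈ p, ρ z s ∈ p) : R →ₐ[ℝ] Module.End ℂ p where
  toFun z := (ρ z).restrict (h z)
  map_one' := LinearMap.ext fun s => Subtype.ext (by
    rw [LinearMap.coe_restrict_apply, map_one]; rfl)
  map_mul' x y := LinearMap.ext fun s => Subtype.ext (by
    rw [LinearMap.coe_restrict_apply, map_mul]; rfl)
  map_zero' := LinearMap.ext fun s => Subtype.ext (by
    rw [LinearMap.coe_restrict_apply, map_zero]; rfl)
  map_add' x y := LinearMap.ext fun s => Subtype.ext (by
    rw [LinearMap.coe_restrict_apply, map_add]; rfl)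
  commutes' c := LinearMap.ext fun s => Subtype.ext (by
    rw [LinearMap.coe_restrict_apply, AlgHom.commutes]; rfl)

end Restriction

section Halves

lemma isCompl_eigenspace_of_mul_self_eq_one {K V : Type*} [Field K] [NeZero (2 : K)]
    [AddCommGroup V] [Module K V] {J : Module.End K V} (hJ : J * J = 1) :
    IsCompl (J.eigenspace 1) (J.eigenspace (-1)) := by
  have hJJ : ∀ x, J (J x) = x := LinearMap.congr_fun hJ
  have hne : (1 : K) ≠ -1 := fun h => NeZero.ne (2 : K) <| by
    rw [← one_add_one_eq_two]
    exact eq_neg_iff_add_eq_zero.1 h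
  refine ⟨Module.End.disjoint_genEigenspace J hne 1 1,
    codisjoint_iff.2 (eq_top_iff.2 fun x _ => ?_)⟩
  refine Submodule.mem_sup.2 ⟨(2⁻¹ : K) • (x + J x), ?_, (2⁻¹ : K) • (x - J x), ?_, ?_⟩
  · rw [Module.End.mem_eigenspace_iff, map_smul, map_add, hJJ, one_smul, add_comm]
  · rw [Module.End.mem_eigenspace_iff, map_smul, map_sub, hJJ, neg_one_smul, ← smul_neg, neg_sub]
  · rw [← smul_add, add_add_sub_cancel, ← two_smul K x, smul_smul,
      inv_mul_cancel₀ (NeZero.ne (2 : K)), one_smul]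

variable {D : ℕ} (Δ : SpinorModule.{v} (Fin D))

lemma normalizedVol_mul_self (hD : Even D) :
    (Complex.I ^ (D / 2) • Δ.c (vol D)) * (Complex.I ^ (D / 2) • Δ.c (vol D)) = 1 := by
  have h : (-1 : Module.End ℂ Δ.carrier) = (-1 : ℂ) • 1 := by rw [neg_one_smul]
  rw [smul_mul_smul_comm, ← map_mul, vol_mul_vol hD, map_pow, map_neg, map_one, h, smul_pow,
    smul_smul, one_pow, ← mul_pow, ← mul_pow, Complex.I_mul_I, neg_one_mul, neg_neg, one_pow,
    one_smul]

lemma half_of_even (hD : Even D) (ε : ℂ) :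
    half Δ ε = Module.End.eigenspace (Complex.I ^ (D / 2) • Δ.c (vol D)) ε :=
  if_pos hD

lemma half_of_odd (hD : Odd D) (ε : ℂ) : half Δ ε = ⊤ :=
  if_neg (Nat.not_even_iff_odd.2 hD)

lemma finrank_half_add_finrank_half (hD : Even D) :
    Module.finrank ℂ (half Δ 1) + Module.finrank ℂ (half Δ (-1)) =
      Module.finrank ℂ Δ.carrier := by
  rw [half_of_even Δ hD, half_of_even Δ hD]
  exact Submodule.finrank_add_eq_of_isCompl
    (isCompl_eigenspace_of_mul_self_eq_one (normalizedVol_mul_self Δ hD))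

lemma vol_mul_ι (hD : Even D) (w : Fin D → ℝ) :
    vol D * ι (stdForm (Fin D)) w = -(ι (stdForm (Fin D)) w * vol D) := by
  rcases Nat.eq_zero_or_pos D with rfl | h0
  · rw [Subsingleton.elim w 0, map_zero, mul_zero, zero_mul, neg_zero]
  · have hodd : Odd (D - 1) := Nat.Even.sub_odd h0 hD odd_one
    rw [ι_mul_vol, hodd.neg_one_pow, neg_one_smul, neg_neg]

variable {Δ}

lemma ι_mem_half {ε : ℂ} (w : Fin D → ℝ) {s : Δ.carrier} (hs : s ∈ half Δ ε) :
    Δ.c (ι (stdForm (Fin D)) w) s ∈ half Δ (-ε) := by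
  by_cases hD : Even D
  · rw [half_of_even _ hD, Module.End.mem_eigenspace_iff] at hs ⊢
    rw [LinearMap.smul_apply, ← Module.End.mul_apply, ← map_mul, vol_mul_ι hD, map_neg, map_mul,
      LinearMap.neg_apply, Module.End.mul_apply, smul_neg, ← map_smul, ← LinearMap.smul_apply, hs,
      map_smul, neg_smul]
  · rw [half_of_odd _ (Nat.not_even_iff_odd.1 hD)]
    exact Submodule.mem_top

end Halves

section Dimension

lemma finrank_eqLocus_fst_snd {K V : Type*} [Field K] [AddCommGroup V] [Module K V] :
    Module.finrank K (LinearMap.eqLocus (LinearMap.fst K V V) (LinearMap.snd K V V)) =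
      Module.finrank K V := by
  have h : LinearMap.eqLocus (LinearMap.fst K V V) (LinearMap.snd K V V) =
      LinearMap.range (LinearMap.prod LinearMap.id LinearMap.id : V →ₗ[K] V × V) := by
    ext ξ
    exact ⟨fun hξ => ⟨ξ.1, Prod.ext rfl hξ⟩, by rintro ⟨x, rfl⟩; rfl⟩
  rw [h]
  exact LinearMap.finrank_range_of_inj fun x y hxy => congrArg Prod.fst hxy

lemma finrank_submodule_prod {K V W : Type*} [Field K] [AddCommGroup V] [Module K V]
    [AddCommGroup W] [Module K W] (p : Submodule K V) (q : Submodule K W) [FiniteDimensional K p]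
    [FiniteDimensional K q] :
    Module.finrank K (p.prod q) = Module.finrank K p + Module.finrank K q := by
  rw [← Module.finrank_prod,
    ← LinearMap.finrank_range_of_inj (f := p.subtype.prodMap q.subtype)
      (p.injective_subtype.prodMap q.injective_subtype),
    LinearMap.range_prodMap, Submodule.range_subtype, Submodule.range_subtype]

lemma finrank_half_prod_half {D : ℕ} (Δ : SpinorModule.{v} (Fin D)) :
    Module.finrank ℂ ((half Δ 1).prod (half Δ (-1))) =
      2 ^ (D / 2 + if Odd D then 1 else 0) := by
  have hd : Module.finrank ℂ Δ.carrier = 2 ^ (D / 2) := by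
    rw [Δ.isIrreducible.finrank_eq, Fintype.card_fin]
  rw [finrank_submodule_prod]
  by_cases hD : Odd D
  · rw [half_of_odd _ hD, half_of_odd _ hD, finrank_top, hd, if_pos hD, pow_succ, mul_two]
  · rw [finrank_half_add_finrank_half _ (Nat.not_odd_iff_even.1 hD), hd, if_neg hD, add_zero]

variable {N : ℕ} {D : Fin N → ℕ} (Δ : ∀ i, SpinorModule.{v} (Fin (D i))) {T : Finset (Fin N)}

lemma finrank_tensorFactor_half (i : Fin N) :
    Module.finrank ℂ (tensorFactor T (fun i => half (Δ i) 1) (fun i => half (Δ i) (-1)) i) =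
      2 ^ (D i / 2 + if i ∈ (Finset.univ.filter fun i => Odd (D i)) \ T then 1 else 0) := by
  unfold tensorFactor
  by_cases hi : i ∈ T
  · rw [if_pos hi, if_neg fun h => (Finset.mem_sdiff.1 h).2 hi, finrank_eqLocus_fst_snd, add_zero,
      (Δ i).isIrreducible.finrank_eq, Fintype.card_fin]
  · simp only [Finset.mem_sdiff, Finset.mem_filter_univ, and_iff_left hi]
    rw [if_neg hi, finrank_half_prod_half]

lemma sum_eq_two_mul_sum_div_two_add_card_odd {ι : Type*} [Fintype ι] (D : ι → ℕ) :
    ∑ i, D i = 2 * ∑ i, D i / 2 + (Finset.univ.filter fun i => Odd (D i)).card := by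
  simp only [Finset.card_filter, Finset.mul_sum, ← Finset.sum_add_distrib]
  refine Finset.sum_congr rfl fun i _ => ?_
  split_ifs with h
  · exact (Nat.two_mul_div_two_add_one_of_odd h).symm
  · exact (Nat.two_mul_div_two_of_even (Nat.not_odd_iff_even.1 h)).symm

/-- Every odd-dimensional factor outside `T` contributes an extra factor `2`, and there are
`N_o - T.card = [N_o / 2]` of them. -/
lemma finrank_stdFiber (hT : ∀ i ∈ T, Odd (D i))
    (hcard : T.card = (Finset.univ.filter fun i => Odd (D i)).card -
      (Finset.univ.filter fun i => Odd (D i)).card / 2) :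
    Module.finrank ℂ (stdFiber Δ T) = 2 ^ ((∑ i, D i) / 2) := by
  have hsub : T ⊆ Finset.univ.filter fun i => Odd (D i) :=
    fun i hi => (Finset.mem_filter_univ i).2 (hT i hi)
  rw [stdFiber, finrank_tensorSub,
    Finset.prod_congr rfl fun i _ => finrank_tensorFactor_half Δ i,
    Finset.prod_pow_eq_pow_sum, Finset.sum_add_distrib, Finset.sum_ite_mem, Finset.univ_inter,
    Finset.sum_const, Finset.card_sdiff_of_subset hsub, smul_eq_mul,
    sum_eq_two_mul_sum_div_two_add_card_odd D]
  congr 1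
  omega

end Dimension

section StandardFibre

variable {N : ℕ} {D : Fin N → ℕ} {Δ : ∀ i, SpinorModule.{v} (Fin (D i))} {T : Finset (Fin N)}

lemma exists_isJordanWigner_of_card_odd (hT : ∀ i ∈ T, Odd (D i))
    (hcard : T.card = (Finset.univ.filter fun i => Odd (D i)).card -
      (Finset.univ.filter fun i => Odd (D i)).card / 2) :
    ∃ r : Fin N → WithTop (Fin N), IsJordanWigner T r ∧
      (∀ i ∈ T, ∀ j : Fin N, r i = j → Odd (D j)) ∧
      ((∀ k ∈ T, ∀ j, j ≤ k) → ∀ i, r i = if i ∈ T then ⊤ else (i : WithTop (Fin N))) := by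
  by_cases hlast : ∀ k ∈ T, ∀ j, j ≤ k
  · refine ⟨_, isJordanWigner_ite_top (Finset.card_le_one.2 fun i hi j hj =>
      le_antisymm (hlast j hj i) (hlast i hi j)), fun i hi j hij => ?_, fun _ _ => rfl⟩
    exact absurd (hij.symm.trans (if_pos hi)) WithTop.coe_ne_top
  · set O := Finset.univ.filter fun i => Odd (D i)
    have hsub : T ⊆ O := fun i hi => (Finset.mem_filter_univ i).2 (hT i hi)
    obtain ⟨r, hr, hrO⟩ := exists_isJordanWigner (Finset.disjoint_sdiff (s := T) (t := O)) (by
      rw [Finset.card_sdiff_of_subset hsub]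
      omega)
    exact ⟨r, hr, fun i hi j hij =>
      (Finset.mem_filter_univ j).1 (Finset.mem_sdiff.1 (hrO i hi j hij)).1, fun h => absurd h hlast⟩

lemma spinTensor_mem_stdFiber (a : ∀ i, Spin (Fin (D i)))
    {t : ⨂[ℂ] i, (Δ i).carrier × (Δ i).carrier} (ht : t ∈ stdFiber Δ T) :
    spinTensor (fun i => (Δ i).c) a t ∈ stdFiber Δ T := by
  refine map_mem_tensorSub (fun i ξ hξ => ?_) ht
  rw [mem_tensorFactor] at hξ ⊢
  split_ifs at hξ ⊢
  · exact congrArg _ hξ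
  · exact ⟨c_mem_half _ hξ.1, c_mem_half _ hξ.2⟩

variable (Δ T) in
/-- The action of the product of the spin groups on the standard fibre of `S`. -/
def stdSpin (a : ∀ i, Spin (Fin (D i))) : Module.End ℂ (stdFiber Δ T) :=
  (spinTensor (fun i => (Δ i).c) a).restrict fun _ ht => spinTensor_mem_stdFiber a ht

variable {r : Fin N → WithTop (Fin N)}

lemma vecAction_mem_stdFiber (hr : IsJordanWigner T r)
    (hodd : ∀ i ∈ T, ∀ j : Fin N, r i = j → Odd (D j)) (v : (Σ i, Fin (D i)) → ℝ)
    {t : ⨂[ℂ] i, (Δ i).carrier × (Δ i).carrier} (ht : t ∈ stdFiber Δ T) :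
    vecAction (fun i => (Δ i).c) T r v t ∈ stdFiber Δ T := by
  rw [vecAction_apply, LinearMap.sum_apply]
  refine Submodule.sum_mem _ fun i _ => hr.twistedTerm_mem_tensorSub (fun k hk j h =>
    ⟨half_of_odd _ (hodd k hk j h) _, half_of_odd _ (hodd k hk j h) _⟩)
    (fun s hs => ι_mem_half _ hs) (fun s hs => ?_) ht
  simpa only [neg_neg, SetLike.mem_coe] using ι_mem_half (fun a => v ⟨i, a⟩) hs

variable (Δ) in
/-- The representation of the Clifford algebra of the orthogonal sum on the standard fibre of `S`
given by the twisted terms. It is induced by the Clifford multiplication of `W` if `T` contains at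
most the last index and the string of that index has no end. -/
def stdRep (hr : IsJordanWigner T r) (hodd : ∀ i ∈ T, ∀ j : Fin N, r i = j → Odd (D j)) :
    Cl (Σ i, Fin (D i)) →ₐ[ℝ] Module.End ℂ (stdFiber Δ T) :=
  restrictRep (tensorRep (fun i => (Δ i).c) hr) (stdFiber Δ T) <|
    mem_of_forall_ι_mem fun v s hs => by
    rw [tensorRep_ι]
    exact vecAction_mem_stdFiber hr hodd v hs

variable {hr : IsJordanWigner T r} {hodd : ∀ i ∈ T, ∀ j : Fin N, r i = j → Odd (D j)}

lemma coe_stdRep_ι (v : (Σ i, Fin (D i)) → ℝ) (s : stdFiber Δ T) :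
    (stdRep Δ hr hodd (ι (stdForm _) v) s : ⨂[ℂ] i, (Δ i).carrier × (Δ i).carrier) =
      vecAction (fun i => (Δ i).c) T r v s.1 :=
  LinearMap.congr_fun (tensorRep_ι _ hr v) s.1

lemma stdRep_spinProd (a : ∀ i, Spin (Fin (D i))) :
    stdRep Δ hr hodd (spinProd a : Spin (Σ i, Fin (D i))) = stdSpin Δ T a :=
  LinearMap.ext fun s => Subtype.ext (LinearMap.congr_fun (tensorRep_spinProd _ hr a) s.1)

variable {Δ₀ : SpinorModule.{v'} (Σ i, Fin (D i))}

/-- Equivariance of a map of standard fibres under the product of the spin groups. -/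
def SpinEquivariant (L : stdFiber Δ T ≃ₗ[ℂ] Δ₀.carrier) : Prop :=
  ∀ a s, L (stdSpin Δ T a s) = Δ₀.c (spinProd a : Spin (Σ i, Fin (D i))) (L s)

variable (Δ Δ₀) in
theorem exists_spinEquivariant (hr : IsJordanWigner T r)
    (hodd : ∀ i ∈ T, ∀ j : Fin N, r i = j → Odd (D j)) (hT : ∀ i ∈ T, Odd (D i))
    (hcard : T.card = (Finset.univ.filter fun i => Odd (D i)).card -
      (Finset.univ.filter fun i => Odd (D i)).card / 2) :
    ∃ L : stdFiber Δ T ≃ₗ[ℂ] Δ₀.carrier, SpinEquivariant L ∧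
      ∃ ε : ℝ, (ε = 1 ∨ ε = -1) ∧ (Even (∑ i, D i) → ε = 1) ∧
        ∀ v s, L (stdRep Δ hr hodd (ι (stdForm _) v) s) =
          (ε : ℂ) • Δ₀.c (ι (stdForm _) v) (L s) := by
  have hκ : Fintype.card (Σ i, Fin (D i)) = ∑ i, D i := by
    simp only [Fintype.card_sigma, Fintype.card_fin]
  have hd : Module.finrank ℂ (stdFiber Δ T) = Module.finrank ℂ Δ₀.carrier := by
    rw [finrank_stdFiber Δ hT hcard, Δ₀.isIrreducible.finrank_eq, hκ]
  rcases exists_linearEquiv_or_involute (A := stdFiber Δ T) (α := stdRep Δ hr hodd)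
    Δ₀.isIrreducible hd with ⟨L, hL⟩ | ⟨ho, L, hL⟩
  · refine ⟨L, fun a s => ?_, 1, Or.inl rfl, fun _ => rfl, fun v s => ?_⟩
    · rw [← stdRep_spinProd (hr := hr) (hodd := hodd), hL]
    · rw [hL, Complex.ofReal_one, one_smul]
  · refine ⟨L, fun a s => ?_, -1, Or.inr rfl, fun he => ?_, fun v s => ?_⟩
    · rw [← stdRep_spinProd (hr := hr) (hodd := hodd), hL, spinGroup.involute_eq (spinProd a).2]
    · exact absurd (hκ ▸ he) (Nat.not_even_iff_odd.2 ho)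
    · rw [hL, involute_ι, map_neg, Complex.ofReal_neg, Complex.ofReal_one, neg_one_smul,
        LinearMap.neg_apply]

end StandardFibre

section BundleIsomorphism

lemma congr_cliffordTensor {N : ℕ} {F : Fin N → Type v} [∀ i, AddCommGroup (F i)]
    [∀ i, Module ℂ (F i)] {G : Fin N → Type v'} [∀ i, AddCommGroup (G i)] [∀ i, Module ℂ (G i)]
    {e : ∀ i, F i ≃ₗ[ℂ] G i} {X : ∀ i, F i →ₗ[ℂ] F i} {Y : ∀ i, G i →ₗ[ℂ] G i}
    (h : ∀ i s, e i (X i s) = Y i (e i s)) (t : ⨂[ℂ] i, F i × F i) :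
    PiTensorProduct.congr (fun i => (e i).prodCongr (e i)) (cliffordTensor X t) =
      cliffordTensor Y (PiTensorProduct.congr (fun i => (e i).prodCongr (e i)) t) := by
  unfold cliffordTensor
  rw [LinearMap.sum_apply, LinearMap.sum_apply, map_sum]
  refine Finset.sum_congr rfl fun i _ => ?_
  induction t using PiTensorProduct.induction_on with
  | smul_tprod c ξ =>
    simp only [map_smul, PiTensorProduct.map_tprod, PiTensorProduct.congr_tprod]
    congr 2
    funext j
    split_ifs
    · exact Prod.ext rfl (map_neg (e j) _)
    · exact Prod.ext (h j _) (h j _)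
    · rfl
  | add t t' ht ht' => simp only [map_add, ht, ht']

variable {N : ℕ} {E : Fin N → Type} [∀ j, NormedAddCommGroup (E j)]
  [∀ j, NormedSpace ℝ (E j)] {H : Fin N → Type} [∀ j, TopologicalSpace (H j)]
  {I : ∀ j, ModelWithCorners ℝ (E j) (H j)}
  {M : Fin N → Type u} [∀ j, TopologicalSpace (M j)] [∀ j, ChartedSpace (H j) (M j)]
  [∀ j, IsManifold (I j) ∞ (M j)] {D : Fin N → ℕ}
  {g : ∀ j, OrientedRiemannian (I j) (M j) (Fin (D j))}
  (P : ∀ j, SpinStructure.{u, w, w'} (g j))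

lemma div_reduction {x : ∀ j, M j} (p q : ∀ j, (P j).fiber (x j)) :
    (inducedSpinStructure P).div (reduction P p) (reduction P q) =
      spinProd fun j => (P j).div (p j) (q j) := by
  change (spinProd _)⁻¹⁻¹ * (spinProd _)⁻¹ = _
  rw [inv_inv, ← map_inv, ← map_mul]
  refine congrArg spinProd (funext fun j => ?_)
  rw [Pi.mul_apply, Pi.inv_apply, mul_inv_eq_iff_eq_mul, ← (P j).div_act_right, (P j).act_div]

lemma frame_reduction {x : ∀ j, M j} (p : ∀ j, (P j).fiber (x j)) :
    (inducedSpinStructure P).frame (reduction P p) = productFrame fun j => (P j).frame (p j) := by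
  have h : (reduction P p).toFun p = 1 :=
    inv_eq_one.2 ((congrArg spinProd (funext fun j => (P j).div_self _)).trans (map_one spinProd))
  refine (frame_indep P (reduction P p) p (basePoint P x)).trans ?_
  rw [h, Frame.rotate_one]

lemma frame_reduction_symm {x : ∀ j, M j} (p : ∀ j, (P j).fiber (x j))
    (X : TangentSpace (ModelWithCorners.pi I) x) (k : Σ j, Fin (D j)) :
    ((inducedSpinStructure P).frame (reduction P p)).toEquiv.symm X k =
      ((P k.1).frame (p k.1)).toEquiv.symm ((tangentSum x).symm X k.1) k.2 := by
  rw [frame_reduction]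
  rfl

variable {P} {Δ : ∀ j, SpinorModule.{v} (Fin (D j))} {Δ₀ : SpinorModule.{v'} (Σ i, Fin (D i))}
  {T : Finset (Fin N)}

lemma productEval_eq_stdSpin {x : ∀ j, M j} (p q : ∀ j, (P j).fiber (x j))
    (s : productFiber P Δ T x) :
    productEval Δ T p s = stdSpin Δ T (fun j => (P j).div (p j) (q j)) (productEval Δ T q s) := by
  have h := productEval_transition Δ T q p (productEval Δ T q s)
  rw [LinearEquiv.symm_apply_apply] at h
  exact Subtype.ext h

variable (P) in
/-- The isomorphism of fibres given by an isomorphism of the standard fibres. It does not depend on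
the base point if the latter is equivariant, by `evalAt_fiberEquiv`. -/
def fiberEquiv (L : stdFiber Δ T ≃ₗ[ℂ] Δ₀.carrier) (x : ∀ j, M j) :
    productFiber P Δ T x ≃ₗ[ℂ] spinorFiber (inducedSpinStructure P) Δ₀ x :=
  ((productEval Δ T (basePoint P x)).trans L).trans
    (evalAt (P := inducedSpinStructure P) (reduction P (basePoint P x))).symm

variable {L : stdFiber Δ T ≃ₗ[ℂ] Δ₀.carrier}

lemma evalAt_fiberEquiv (hL : SpinEquivariant L) {x : ∀ j, M j} (p : ∀ j, (P j).fiber (x j))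
    (s : productFiber P Δ T x) :
    evalAt (P := inducedSpinStructure P) (reduction P p) (fiberEquiv P L x s) =
      L (productEval Δ T p s) := by
  rw [productEval_eq_stdSpin p (basePoint P x) s, hL, ← div_reduction]
  exact evalAt_symm_apply (P := inducedSpinStructure P) _ _ _

lemma productEval_fiberEquiv_symm (hL : SpinEquivariant L) {x : ∀ j, M j}
    (p : ∀ j, (P j).fiber (x j)) (σ : spinorFiber (inducedSpinStructure P) Δ₀ x) :
    productEval Δ T p ((fiberEquiv P L x).symm σ) =
      L.symm (evalAt (P := inducedSpinStructure P) (reduction P p) σ) := by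
  rw [LinearEquiv.eq_symm_apply, ← evalAt_fiberEquiv hL, LinearEquiv.apply_symm_apply]

variable (P) in
/-- The isomorphism of bundles given by an isomorphism of the standard fibres which is equivariant
under the product of the spin groups. -/
def bundleIso (hL : SpinEquivariant L) :
    (productSpinorBundle P Δ T).Iso (spinorBundle (inducedSpinStructure P) Δ₀) where
  equiv x := fiberEquiv P L x
  smooth a b s := by
    refine ((smoothOn_productEval (P := P) Δ T a b s).linear
      (L.toLinearMap.restrictScalars ℝ)).congr fun x _ => ?_
    exact evalAt_fiberEquiv hL _ _
  smooth_symm a b s := by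
    refine ((smoothOn_productEval (P := P) Δ T b a (L.symm s)).mono fun x hx =>
      ⟨hx.2, hx.1⟩).congr fun x _ => ?_
    refine congrArg (productEval Δ T fun j => (P j).sec (a j) (x j)) ?_
    refine (LinearEquiv.eq_symm_apply (productEval Δ T fun j => (P j).sec (b j) (x j))).2 ?_
    refine (productEval_fiberEquiv_symm hL _ _).trans ?_
    exact congrArg L.symm (LinearEquiv.apply_symm_apply _ _)

end BundleIsomorphism

section CliffordCompatibility

variable {N : ℕ} {E : Fin N → Type} [∀ j, NormedAddCommGroup (E j)]
  [∀ j, NormedSpace ℝ (E j)] {H : Fin N → Type} [∀ j, TopologicalSpace (H j)]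
  {I : ∀ j, ModelWithCorners ℝ (E j) (H j)}
  {M : Fin N → Type u} [∀ j, TopologicalSpace (M j)] [∀ j, ChartedSpace (H j) (M j)]
  [∀ j, IsManifold (I j) ∞ (M j)] {D : Fin N → ℕ}
  {g : ∀ j, OrientedRiemannian (I j) (M j) (Fin (D j))}
  {P : ∀ j, SpinStructure.{u, w, w'} (g j)} {Δ : ∀ j, SpinorModule.{v} (Fin (D j))}
  {T : Finset (Fin N)}

lemma evalAt_cliffordMul {E H : Type} [NormedAddCommGroup E] [NormedSpace ℝ E] [TopologicalSpace H]
    {I : ModelWithCorners ℝ E H} {M : Type u} [TopologicalSpace M] [ChartedSpace H M]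
    [IsManifold I ∞ M] {κ : Type} [Fintype κ] [DecidableEq κ] {g : OrientedRiemannian I M κ}
    (P : SpinStructure.{u, w, w'} g) (Δ : SpinorModule.{v} κ) {x : M} (p : P.fiber x)
    (X : TangentSpace I x) (s : spinorFiber P Δ x) :
    evalAt p (cliffordMul P Δ X s) =
      Δ.c (ι (stdForm κ) ((P.frame p).toEquiv.symm X)) (evalAt p s) :=
  rfl

lemma mem_productFiber_iff {x : ∀ j, M j} (p : ∀ j, (P j).fiber (x j))
    {t : ⨂[ℂ] i, spinorFiber (P i) (Δ i) (x i) × spinorFiber (P i) (Δ i) (x i)} :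
    t ∈ productFiber P Δ T x ↔ PiTensorProduct.congr
      (fun i => (evalAt (Δ := Δ i) (p i)).prodCongr (evalAt (p i))) t ∈ stdFiber Δ T := by
  have h := tensorSub_map T (fun i => evalAt (Δ := Δ i) (p i))
    (fun i => halfFiber_map (P i) (Δ i) 1 (p i)) fun i => halfFiber_map (P i) (Δ i) (-1) (p i)
  rw [stdFiber, ← h, productFiber]
  exact (Function.Injective.mem_set_image (LinearEquiv.injective _)).symm

variable {r : Fin N → WithTop (Fin N)}

lemma congr_evalAt_cliffordTensor (hT : ∀ k ∈ T, ∀ j, j ≤ k)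
    (hr : ∀ i, r i = if i ∈ T then ⊤ else (i : WithTop (Fin N))) {x : ∀ j, M j}
    (p : ∀ j, (P j).fiber (x j)) (X : TangentSpace (ModelWithCorners.pi I) x)
    (t : ⨂[ℂ] i, spinorFiber (P i) (Δ i) (x i) × spinorFiber (P i) (Δ i) (x i)) :
    PiTensorProduct.congr (fun i => (evalAt (Δ := Δ i) (p i)).prodCongr (evalAt (p i)))
        (cliffordTensor (fun i => cliffordMul (P i) (Δ i) ((tangentSum x).symm X i)) t) =
      vecAction (fun i => (Δ i).c) T r
        (((inducedSpinStructure P).frame (reduction P p)).toEquiv.symm X)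
        (PiTensorProduct.congr (fun i => (evalAt (Δ := Δ i) (p i)).prodCongr (evalAt (p i)))
          t) := by
  rw [vecAction_apply, sum_twistedTerm_eq_cliffordTensor hT hr]
  refine congr_cliffordTensor (fun i s => ?_) t
  rw [evalAt_cliffordMul]
  simp only [frame_reduction_symm]

variable {hr : IsJordanWigner T r} {hodd : ∀ i ∈ T, ∀ j : Fin N, r i = j → Odd (D j)}

lemma exists_productEval_cliffordTensor (hT : ∀ k ∈ T, ∀ j, j ≤ k)
    (hrT : ∀ i, r i = if i ∈ T then ⊤ else (i : WithTop (Fin N))) {x : ∀ j, M j}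
    (p : ∀ j, (P j).fiber (x j)) (X : TangentSpace (ModelWithCorners.pi I) x)
    (s : productFiber P Δ T x) :
    ∃ h : cliffordTensor (fun i => cliffordMul (P i) (Δ i) ((tangentSum x).symm X i)) s.1 ∈
        productFiber P Δ T x,
      productEval Δ T p ⟨_, h⟩ =
        stdRep Δ hr hodd (ι (stdForm _)
          (((inducedSpinStructure P).frame (reduction P p)).toEquiv.symm X))
          (productEval Δ T p s) := by
  have key := congr_evalAt_cliffordTensor (Δ := Δ) hT hrT p X s.1
  refine ⟨(mem_productFiber_iff p).2 ?_, Subtype.ext (key.trans ?_)⟩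
  · rw [key]
    exact vecAction_mem_stdFiber hr hodd _ ((mem_productFiber_iff p).1 s.2)
  · exact (coe_stdRep_ι (hr := hr) (hodd := hodd) _ (productEval Δ T p s)).symm

lemma exists_bundleIso_cliffordTensor {Δ₀ : SpinorModule.{v'} (Σ i, Fin (D i))}
    {L : stdFiber Δ T ≃ₗ[ℂ] Δ₀.carrier} (hL : SpinEquivariant L) {ε : ℂ}
    (hε : ∀ v s, L (stdRep Δ hr hodd (ι (stdForm _) v) s) =
      ε • Δ₀.c (ι (stdForm _) v) (L s))
    (hT : ∀ k ∈ T, ∀ j, j ≤ k)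
    (hrT : ∀ i, r i = if i ∈ T then ⊤ else (i : WithTop (Fin N)))
    {x : ∀ j, M j} (X : TangentSpace (ModelWithCorners.pi I) x) (s : productFiber P Δ T x) :
    ∃ h : cliffordTensor (fun i => cliffordMul (P i) (Δ i) ((tangentSum x).symm X i)) s.1 ∈
        productFiber P Δ T x,
      (bundleIso P hL).equiv x ⟨_, h⟩ =
        ε • cliffordMul (inducedSpinStructure P) Δ₀ X ((bundleIso P hL).equiv x s) := by
  obtain ⟨h, hs⟩ := exists_productEval_cliffordTensor (hr := hr) (hodd := hodd) hT hrT
    (basePoint P x) X s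
  refine ⟨h, (evalAt (P := inducedSpinStructure P) (Δ := Δ₀)
    (reduction P (basePoint P x))).injective ?_⟩
  refine (evalAt_fiberEquiv hL _ _).trans ?_
  rw [hs, hε, ← evalAt_fiberEquiv hL, map_smul]
  rfl

end CliffordCompatibility

end SpinProduct

end

theorem proposition4_general {N : ℕ} (D : Fin N → ℕ)
    {E : Fin N → Type} [∀ i, NormedAddCommGroup (E i)] [∀ i, NormedSpace ℝ (E i)]
    {H : Fin N → Type} [∀ i, TopologicalSpace (H i)] {I : ∀ i, ModelWithCorners ℝ (E i) (H i)}
    (M : Fin N → Type u) [∀ i, TopologicalSpace (M i)] [∀ i, ChartedSpace (H i) (M i)]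
    [∀ i, IsManifold (I i) ∞ (M i)]
    (g : ∀ i, SpinProduct.OrientedRiemannian (I i) (M i) (Fin (D i)))
    (P : ∀ i, SpinProduct.SpinStructure.{u, w, w'} (g i))
    (Δ : ∀ i, SpinProduct.SpinorModule.{v} (Fin (D i)))
    (Δ₀ : SpinProduct.SpinorModule.{v'} (Σ i, Fin (D i)))
    (T : Finset (Fin N)) (hT : ∀ i ∈ T, Odd (D i))
    (hcard : T.card = (Finset.univ.filter fun i => Odd (D i)).card -
      (Finset.univ.filter fun i => Odd (D i)).card / 2) :
    ∃ φ : (SpinProduct.productSpinorBundle P Δ T).Iso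
        (SpinProduct.spinorBundle (SpinProduct.inducedSpinStructure P) Δ₀),
      (∃ L : SpinProduct.stdFiber Δ T ≃ₗ[ℂ] Δ₀.carrier,
        ∀ (x : ∀ i, M i) (p : ∀ i, (P i).fiber (x i)) (s : SpinProduct.productFiber P Δ T x),
          SpinProduct.evalAt (P := SpinProduct.inducedSpinStructure P)
              (SpinProduct.reduction P p) (φ.equiv x s) =
            L (SpinProduct.productEval Δ T p s)) ∧
      ((∀ k ∈ T, ∀ j, j ≤ k) →
        ∃ ε : ℝ, (ε = 1 ∨ ε = -1) ∧ (Even (∑ i, D i) → ε = 1) ∧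
          ∀ (x : ∀ i, M i) (X : TangentSpace (ModelWithCorners.pi I) x)
            (s : SpinProduct.productFiber P Δ T x),
            ∃ h : SpinProduct.cliffordTensor (fun i => SpinProduct.cliffordMul (P i) (Δ i)
                ((SpinProduct.tangentSum x).symm X i)) s.1 ∈ SpinProduct.productFiber P Δ T x,
              φ.equiv x ⟨_, h⟩ = (ε : ℂ) •
                SpinProduct.cliffordMul (SpinProduct.inducedSpinStructure P) Δ₀ X
                  (φ.equiv x s)) := by
  obtain ⟨r, hr, hodd, hlast⟩ := SpinProduct.exists_isJordanWigner_of_card_odd hT hcard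
  obtain ⟨L, hL, ε, hε, heven, hcliff⟩ :=
    SpinProduct.exists_spinEquivariant Δ Δ₀ hr hodd hT hcard
  exact ⟨SpinProduct.bundleIso P hL, ⟨L, fun x p s => SpinProduct.evalAt_fiberEquiv hL p s⟩,
    fun hmax => ⟨ε, hε, heven, fun x X s =>
      SpinProduct.exists_bundleIso_cliffordTensor hL hcliff hmax (hlast hmax) X s⟩⟩

theorem proposition4 {N : ℕ} (D : Fin N → ℕ)
    (M : Fin N → Type u) [∀ i, TopologicalSpace (M i)]
    [∀ i, ChartedSpace (EuclideanSpace ℝ (Fin (D i))) (M i)]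
    [∀ i, IsManifold (𝓡 (D i)) ∞ (M i)]
    (g : ∀ i, SpinProduct.OrientedRiemannian (𝓡 (D i)) (M i) (Fin (D i)))
    (P : ∀ i, SpinProduct.SpinStructure.{u, w, w'} (g i))
    (Δ : ∀ i, SpinProduct.SpinorModule.{v} (Fin (D i)))
    (Δ₀ : SpinProduct.SpinorModule.{v'} (Σ i, Fin (D i)))
    (T : Finset (Fin N)) (hT : ∀ i ∈ T, Odd (D i))
    (hcard : T.card = (Finset.univ.filter fun i => Odd (D i)).card -
      (Finset.univ.filter fun i => Odd (D i)).card / 2) :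
    ∃ φ : (SpinProduct.productSpinorBundle P Δ T).Iso
        (SpinProduct.spinorBundle (SpinProduct.inducedSpinStructure P) Δ₀),
      (∃ L : SpinProduct.stdFiber Δ T ≃ₗ[ℂ] Δ₀.carrier,
        ∀ (x : ∀ i, M i) (p : ∀ i, (P i).fiber (x i)) (s : SpinProduct.productFiber P Δ T x),
          SpinProduct.evalAt (P := SpinProduct.inducedSpinStructure P)
              (SpinProduct.reduction P p) (φ.equiv x s) =
            L (SpinProduct.productEval Δ T p s)) ∧
      ((∀ k ∈ T, ∀ j, j ≤ k) →
        ∃ ε : ℝ, (ε = 1 ∨ ε = -1) ∧ (Even (∑ i, D i) → ε = 1) ∧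
          ∀ (x : ∀ i, M i)
            (X : TangentSpace (ModelWithCorners.pi fun i => 𝓡 (D i)) x)
            (s : SpinProduct.productFiber P Δ T x),
            ∃ h : SpinProduct.cliffordTensor (fun i => SpinProduct.cliffordMul (P i) (Δ i)
                ((SpinProduct.tangentSum x).symm X i)) s.1 ∈ SpinProduct.productFiber P Δ T x,
              φ.equiv x ⟨_, h⟩ = (ε : ℂ) •
                SpinProduct.cliffordMul (SpinProduct.inducedSpinStructure P) Δ₀ X
                  (φ.equiv x s)) := by
  exact proposition4_general D M g P Δ Δ₀ T hT hcard
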